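/- **Setting.** Let $\mathbb H$ be the hyperbolic plane, $\Gamma=\mathrm{PSL}_2(\mathbb Z)$, $Y_0(1)=\Gamma\backslash\mathbb H$ with projection $\pi$ and the measure induced by $dx\,dy/y^2$. Let $\mathrm{Partial}(Y_0(1))$ be the additive monoid of measurable functions $Y_0(1)\to\mathbb Z_{\ge 0}$ modulo equality almost everywhere. A measurable set $B\subset\mathbb H$ for which $\pi^{-1}(x)\cap B$ is finite for almost every $x$ defines the element $x\mapsto\#(\pi^{-1}(x)\cap B)$ of $\mathrm{Partial}(Y_0(1))$, again denoted $B$; $Y_0(1)$ itself denotes the constant function $1$. Let $\mathcal F_0=\{z\in\mathbb H: |z-1|>1,\ 0<\Re z<1/2\}$, $S=\pm\begin{pmatrix}0&-1\\1&0\end{pmatrix}$, $T=\pm\begin{pmatrix}1&1\\0&1\end{pmatrix}$. Let $K$ be a real quadratic field, viewed as a subfield of $\mathbb R$, with conjugation $w\mapsto w^\sigma$, and let $A\in\mathrm{Cl}_K^+$ be a narrow ideal class. Say that $w\in K$ *represents* $A$ if $w>w^\sigma$ and $\mathbb Zw+\mathbb Z$ is a fractional ideal in $A$. * **The closed geodesic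 $\mathcal C_A$ and $\mathcal P(\mathcal C_A,\mathcal F_0)$.** Let $w$ represent $A$, let $\varepsilon>1$ be the smallest unit $>1$ of $\mathcal O_K$ of positive norm, and let $\gamma_w=\pm\begin{pmatrix}a&b\\c&d\end{pmatrix}\in\Gamma$ be given by $aw+b=\varepsilon w$, $cw+d=\varepsilon$. Let $S_w$ be the geodesic of $\mathbb H$ oriented from $w^\sigma$ to $w$, and $\tilde B$ the closed half-plane to its left. The oriented closed geodesic $\mathcal C_A$ is the projection of the segment $\tilde{\mathcal C}$ of $S_w$ from $z_0$ to $\gamma_wz_0$, where $z_0\in S_w$; the point $z_0$ is taken outside all the open polygons $\gamma\mathcal F_0$, $\gamma\in\Gamma$. If $\gamma_1\mathcal F_0,\dots,\gamma_r\mathcal F_0$ are the distinct translates that $\tilde{\mathcal C}$ meets, then $$\mathcal P(\mathcal C_A,\mathcal F_0)=\sum_{i=1}^r\bigl(\tilde B\cap\gamma_i\mathcal F_0\bigr)\in\mathrm{Partial}(Y_0(1)).$$ * **The Duke–Imamoḡlu–Tóth covering $\mathcal F_A$.** Let $((n_1,\dots,n_\ell))$ be the primitive cycle of the class $A$, i.e.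 the primitive period, in any of its cyclic rotations, of the (eventually periodic) minus continued fraction $a_0-\cfrac1{a_1-\cfrac1{a_2-\cdots}}$, with $a_j\in\mathbb Z$ and $a_j\ge2$ for $j\ge1$, of some $w$ representing $A$. Put $m_k=n_1+\dots+n_k$, $$\Gamma_A=\langle\, T^{m_k}ST^{-m_k}\ (1\le k\le\ell),\ T^{m_\ell}\,\rangle\le\Gamma,$$ and let $\mathcal N_A$ be the Nielsen region of $\Gamma_A$, the smallest non-empty $\Gamma_A$-invariant open (geodesically) convex subset of $\mathbb H$. Let $\mathcal F_A\subset\mathcal N_A$ be a fundamental polygon for $\Gamma_A\backslash\mathcal N_A$: a non-empty open convex set, with boundary in $\mathbb H$ contained in finitely many geodesics, whose closure meets the $\Gamma_A$-orbit of each point of $\mathcal N_A$, and such that two $\Gamma_A$-equivalent points of its closure are equal or both lie on its boundary. **Lemma.** For all such choices, $\mathcal F_A$ and $\mathcal P(\mathcal C_A,\mathcal F_0)$ are well-defined elements of $\mathrm{Partial}(Y_0(1))$ (the fibres being finite almost everywhere), and there is an integer $n\ge0$ with $$\mathcal F_A=\mathcal P(\mathcal C_A,\mathcal F_0)+n\,Y_0(1)\quad\text{in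 }\mathrm{Partial}(Y_0(1)).$$ -/

import Mathlib

open UpperHalfPlane MatrixGroups NumberField MeasureTheory
open scoped nonZeroDivisors

noncomputable section

namespace PaintLeft

/-! ## Plane hyperbolic geometry

`ℍ` carries Mathlib's hyperbolic distance, the measure `volume = dx dy / y ^ 2`, and the action of
`SL(2, ℤ)` by Moebius transformations (which factors through `PSL(2, ℤ)`). -/

/-- The (closed) geodesic segment between two points of the hyperbolic plane. -/
def hypSegment (z w : ℍ) : Set ℍ := {u | dist z u + dist u w = dist z w}

/-- Geodesic convexity in the hyperbolic plane. -/
def HypConvex (C : Set ℍ) : Prop := ∀ z ∈ C, ∀ w ∈ C, hypSegment z w ⊆ C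

/-- Complete geodesics of `ℍ`: vertical half-lines, and half-circles centred on the real axis. -/
def IsHypLine (l : Set ℍ) : Prop :=
  ∃ a b c : ℝ, 0 < b ^ 2 - 4 * a * c ∧
    l = {z : ℍ | a * Complex.normSq (z : ℂ) + b * z.re + c = 0}

/-- The orientation preserving isometry `z ↦ (x₁ - x₀) (z - x₁) / (z - x₀)` of `ℍ`, given by a
real matrix of determinant `(x₁ - x₀) ^ 2`; it sends `x₀` to `∞` and `x₁` to `0`. -/
def straighten (x₀ x₁ : ℝ) (z : ℍ) : ℂ := (x₁ - x₀) * ((z : ℂ) - x₁) / ((z : ℂ) - x₀)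

/-- The complete geodesic of `ℍ` with real endpoints `x₀ ≠ x₁`, oriented from `x₀` to `x₁`:
the preimage of the imaginary axis. -/
def geodesicLine (x₀ x₁ : ℝ) : Set ℍ := {z | (straighten x₀ x₁ z).re = 0}

/-- The closed half-plane to the left of the geodesic from `x₀` to `x₁`: the preimage of
`Re z ≥ 0` (which lies to the left of the imaginary axis run through from `∞` to `0`). -/
def leftSide (x₀ x₁ : ℝ) : Set ℍ := {z | 0 ≤ (straighten x₀ x₁ z).re}

/-- The translate `γ F`. -/
def translate (γ : SL(2, ℤ)) (F : Set ℍ) : Set ℍ := (fun z => γ • z) '' F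

/-! ## The modular surface and its partial coverings -/

/-- The fundamental polygon with vertices `0`, `(1 + i √3) / 2`, `∞`. -/
def stdPolygon : Set ℍ := {z | 1 < ‖(z : ℂ) - 1‖ ∧ 0 < z.re ∧ z.re < 1 / 2}

/-- The modular surface `PSL(2, ℤ) \ ℍ`. -/
abbrev ModularSurface : Type := MulAction.orbitRel.Quotient SL(2, ℤ) ℍ

/-- The canonical projection. -/
def proj (z : ℍ) : ModularSurface := Quotient.mk'' z

/-- The hyperbolic measure on the modular surface. -/
def surfaceMeasure : Measure ModularSurface :=
  Measure.map proj ((volume : Measure ℍ).restrict stdPolygon)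

/-- Partial coverings: measurable maps to the natural numbers modulo almost everywhere equality,
with pointwise addition. -/
abbrev Partial : Type := ModularSurface →ₘ[surfaceMeasure] ℕ

/-- The number of points of `B` above a point of the modular surface (where this is finite). -/
def sheets (B : Set ℍ) (x : ModularSurface) : ℕ := (proj ⁻¹' {x} ∩ B).ncard

theorem smul_measurable (γ : SL(2, ℤ)) : Measurable (fun z : ℍ => γ • z) :=
  (continuous_const_smul (Matrix.SpecialLinearGroup.mapGL ℝ γ)).measurable

instance : Countable SL(2, ℤ) :=
  Function.Injective.countable (f := fun g : SL(2, ℤ) => (fun i j => g i j : Fin 2 → Fin 2 → ℤ))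
    fun _ _ h => Subtype.ext (Matrix.ext fun i j => congrFun (congrFun h i) j)

theorem proj_eq_iff (z w : ℍ) : proj w = proj z ↔ ∃ γ : SL(2, ℤ), γ • z = w := by
  unfold proj
  rw [Quotient.eq'', MulAction.orbitRel_apply]
  exact Iff.rfl

theorem measurable_sheets {B : Set ℍ} (hB : MeasurableSet B) : Measurable (sheets B) := by
  have key : ∀ k : ℕ, MeasurableSet {z : ℍ | (k : ℕ∞) ≤ (proj ⁻¹' {proj z} ∩ B).encard} := by
    intro k
    have : {z : ℍ | (k : ℕ∞) ≤ (proj ⁻¹' {proj z} ∩ B).encard} =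
        ⋃ g : Fin k → SL(2, ℤ), ((⋂ i, {z : ℍ | g i • z ∈ B}) ∩
          ⋂ i, ⋂ j, {z : ℍ | i ≠ j → g i • z ≠ g j • z}) := by
      ext z
      simp only [Set.mem_ofPred_eq, Set.mem_iUnion, Set.mem_inter_iff, Set.mem_iInter]
      constructor
      · intro h
        obtain ⟨t, ht, htk⟩ := Set.exists_subset_encard_eq h
        have htf : t.Finite := Set.finite_of_encard_eq_coe htk
        have : Nonempty (Fin k ≃ t) := by
          have := htf.fintype
          refine ⟨(Fintype.equivFinOfCardEq ?_).symm⟩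
          rw [Set.encard_eq_coe_toFinset_card] at htk
          rw [← Set.toFinset_card]
          exact_mod_cast htk
        obtain ⟨e⟩ := this
        have hx : ∀ i, ∃ γ : SL(2, ℤ), γ • z = (e i : ℍ) := fun i =>
          (proj_eq_iff z (e i)).1 (ht (e i).2).1
        choose g hg using hx
        refine ⟨g, fun i => ?_, fun i j hij h' => hij ?_⟩
        · rw [hg]; exact (ht (e i).2).2
        · rw [hg, hg] at h'
          exact e.injective (Subtype.ext h')
      · rintro ⟨g, h1, h2⟩
        have hinj : Function.Injective (fun i => g i • z) := fun i j h => by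
          by_contra hne
          exact h2 i j hne h
        have hcard : (Set.range fun i => g i • z).encard = k := by
          rw [← Set.image_univ, hinj.encard_image]
          simp
        rw [← hcard]
        apply Set.encard_le_encard
        rintro _ ⟨i, rfl⟩
        exact ⟨(proj_eq_iff z _).2 ⟨g i, rfl⟩, h1 i⟩
    rw [this]
    refine MeasurableSet.iUnion fun g => MeasurableSet.inter
      (MeasurableSet.iInter fun i => smul_measurable (g i) hB)
      (MeasurableSet.iInter fun i => MeasurableSet.iInter fun j => ?_)
    by_cases hij : i = j
    · simp [hij]
    · simp only [ne_eq, hij, not_false_eq_true, forall_const]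
      exact (measurableSet_eq_fun (smul_measurable (g i)) (smul_measurable (g j))).compl
  have hm : Measurable fun z : ℍ => (proj ⁻¹' {proj z} ∩ B).encard := by
    refine measurable_to_countable' fun c => ?_
    induction c using ENat.recTopCoe with
    | top =>
      have : (fun z : ℍ => (proj ⁻¹' {proj z} ∩ B).encard) ⁻¹' {⊤} =
          ⋂ k : ℕ, {z : ℍ | (k : ℕ∞) ≤ (proj ⁻¹' {proj z} ∩ B).encard} := by
        ext z
        simp only [Set.mem_preimage, Set.mem_singleton_iff, Set.mem_iInter, Set.mem_ofPred_eq]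
        exact ENat.eq_top_iff_forall_ge
      rw [this]
      exact MeasurableSet.iInter key
    | coe k =>
      have : (fun z : ℍ => (proj ⁻¹' {proj z} ∩ B).encard) ⁻¹' {(k : ℕ∞)} =
          {z : ℍ | (k : ℕ∞) ≤ (proj ⁻¹' {proj z} ∩ B).encard} \
            {z : ℍ | ((k + 1 : ℕ) : ℕ∞) ≤ (proj ⁻¹' {proj z} ∩ B).encard} := by
        ext z
        simp only [Set.mem_preimage, Set.mem_singleton_iff, Set.mem_sdiff, Set.mem_ofPred_eq,
          Nat.cast_add, Nat.cast_one, ENat.natCast_add_one_le_iff, not_lt]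
        exact ⟨fun h => ⟨h.ge, h.le⟩, fun h => le_antisymm h.2 h.1⟩
      rw [this]
      exact (key k).diff (key (k + 1))
  exact measurable_from_quotient.2
    ((Measurable.of_discrete (f := ENat.toNat)).comp hm)

/-- A measurable set `B ⊆ ℍ` as a partial covering of the modular surface. -/
def ofSet (B : Set ℍ) (hB : MeasurableSet B) : Partial :=
  AEEqFun.mk (sheets B) (measurable_sheets hB).aestronglyMeasurable

/-- The modular surface itself as a partial covering: the constant function `1`. -/
def fullCovering : Partial := AEEqFun.const ModularSurface 1

/-! ## Painting to the left -/

/-- The union of the polygons `leftSide x₀ x₁ ∩ γ F`, where `γ F` runs over the translates of `F`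
which meet the segment `C` of the geodesic from `x₀` to `x₁`. For an open fundamental polygon `F`
different translates are disjoint, so the number of points of the union above a point is the sum
of the numbers of points of the individual polygons above it. -/
def paint (F : Set ℍ) (x₀ x₁ : ℝ) (C : Set ℍ) : Set ℍ :=
  ⋃ γ ∈ {γ : SL(2, ℤ) | (C ∩ translate γ F).Nonempty}, leftSide x₀ x₁ ∩ translate γ F

theorem measurableSet_leftSide (x₀ x₁ : ℝ) : MeasurableSet (leftSide x₀ x₁) := by
  have hc : Measurable (fun z : ℍ => (z : ℂ)) := UpperHalfPlane.continuous_coe.measurable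
  have : Measurable (straighten x₀ x₁) := by
    unfold straighten
    exact (measurable_const.mul (hc.sub measurable_const)).div (hc.sub measurable_const)
  exact measurableSet_le measurable_const (Complex.measurable_re.comp this)

theorem isOpen_stdPolygon : IsOpen stdPolygon := by
  have hc : Continuous (fun z : ℍ => (z : ℂ)) := UpperHalfPlane.continuous_coe
  have hr : Continuous (fun z : ℍ => z.re) := UpperHalfPlane.continuous_re
  exact (isOpen_lt continuous_const (hc.sub continuous_const).norm).inter
    ((isOpen_lt continuous_const hr).inter (isOpen_lt hr continuous_const))

theorem measurableSet_paint (x₀ x₁ : ℝ) (C : Set ℍ) :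
    MeasurableSet (paint stdPolygon x₀ x₁ C) := by
  refine MeasurableSet.biUnion (Set.to_countable _) fun γ _ =>
    (measurableSet_leftSide x₀ x₁).inter ?_
  have : translate γ stdPolygon = (fun z : ℍ => γ⁻¹ • z) ⁻¹' stdPolygon := by
    ext z
    constructor
    · rintro ⟨w, hw, rfl⟩
      simpa using hw
    · intro hz
      exact ⟨γ⁻¹ • z, hz, by simp⟩
  rw [this]
  exact smul_measurable _ isOpen_stdPolygon.measurableSet

/-! ## Narrow ideal classes and their closed geodesics -/

section Narrow

variable (K : Type*) [Field K] [NumberField K]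

/-- Principal fractional ideals with a totally positive generator. -/
def narrowPrincipal : Subgroup (FractionalIdeal (𝓞 K)⁰ K)ˣ :=
  Subgroup.map (toPrincipalIdeal (𝓞 K) K)
    { carrier := {a : Kˣ | ∀ φ : K →+* ℝ, 0 < φ a}
      mul_mem' := fun ha hb φ => by simpa using mul_pos (ha φ) (hb φ)
      one_mem' := fun φ => by simp
      inv_mem' := fun ha φ => by simpa using ha φ }

/-- The narrow ideal class group. -/
abbrev NarrowClassGroup : Type _ := (FractionalIdeal (𝓞 K)⁰ K)ˣ ⧸ narrowPrincipal K

variable {K}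

/-- `ℤ w + ℤ` is a fractional ideal in the narrow class `A`, and `w > w'`, where `K` is viewed as
a subfield of `ℝ` through `ι` and `w'` is the conjugate of `w`, given by the other embedding. -/
def Represents (ι ι' : K →+* ℝ) (A : NarrowClassGroup K) (w : K) : Prop :=
  ι' w < ι w ∧ ∃ I : (FractionalIdeal (𝓞 K)⁰ K)ˣ, (QuotientGroup.mk I : NarrowClassGroup K) = A ∧
    ∀ x : K, x ∈ (I : FractionalIdeal (𝓞 K)⁰ K) ↔ ∃ a b : ℤ, x = a * w + b

/-- `ε` is the smallest unit `> 1` of positive norm. -/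
def IsPositiveFundamentalUnit (ι : K →+* ℝ) (ε : (𝓞 K)ˣ) : Prop :=
  IsLeast {x : ℝ | ∃ η : (𝓞 K)ˣ, x = ι ((η : 𝓞 K) : K) ∧ 1 < x ∧
    0 < Algebra.norm ℚ ((η : 𝓞 K) : K)} (ι ((ε : 𝓞 K) : K))

/-- `C` is a lift to `ℍ` of the oriented closed geodesic of the class `A`, and `x₀`, `x₁` are the
ordered endpoints of the complete geodesic containing it: for some `w` representing `A`, the
segment `C` runs on the geodesic from `w'` to `w` from a point `z` to `γ z`, where `γ` is the
hyperbolic matrix with `a w + b = ε w`, `c w + d = ε`. The starting point is taken on the boundary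
of the tessellation by translates of `stdPolygon`, so that the closed geodesic, run through once,
does not meet its first polygon a second time when it closes up. -/
def IsLift (ι ι' : K →+* ℝ) (A : NarrowClassGroup K) (x₀ x₁ : ℝ) (C : Set ℍ) : Prop :=
  ∃ (w : K) (ε : (𝓞 K)ˣ) (γ : SL(2, ℤ)) (z : ℍ),
    Represents ι ι' A w ∧ x₀ = ι' w ∧ x₁ = ι w ∧
    IsPositiveFundamentalUnit ι ε ∧
    (γ 0 0 : K) * w + (γ 0 1 : K) = ((ε : 𝓞 K) : K) * w ∧
    (γ 1 0 : K) * w + (γ 1 1 : K) = ((ε : 𝓞 K) : K) ∧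
    z ∈ geodesicLine x₀ x₁ ∧ (∀ δ : SL(2, ℤ), z ∉ translate δ stdPolygon) ∧
    C = hypSegment z (γ • z)

end Narrow

/-! ## The surface attached to a narrow ideal class -/

/-- Complete quotients of the minus continued fraction `x = a₀ - 1 / (a₁ - 1 / (a₂ - ⋯))`. -/
def minusQuotient (x : ℝ) : ℕ → ℝ
  | 0 => x
  | k + 1 => 1 / (⌈minusQuotient x k⌉ - minusQuotient x k)

/-- The digits `a₀, a₁, a₂, …` of the minus continued fraction of `x`. -/
def minusDigit (x : ℝ) (k : ℕ) : ℤ := ⌈minusQuotient x k⌉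

/-- `(n 0, …, n (ℓ - 1))` is a primitive cycle of the class `A`: the minus continued fraction of
some `w` representing `A` ends in the purely periodic sequence `n`, with smallest period `ℓ`. -/
def IsCycle {K : Type*} [Field K] [NumberField K] (ι ι' : K →+* ℝ) (A : NarrowClassGroup K)
    (n : ℕ → ℤ) (ℓ : ℕ) : Prop :=
  ∃ w : K, Represents ι ι' A w ∧ (∃ N : ℕ, ∀ j, n j = minusDigit (ι w) (N + j)) ∧
    IsLeast {p : ℕ | 0 < p ∧ Function.Periodic n p} ℓ

/-- The partial sum `n 0 + ⋯ + n (k - 1)`. -/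
def partialSum (n : ℕ → ℤ) (k : ℕ) : ℤ := ∑ j ∈ Finset.range k, n j

/-- The thin group generated by the `T ^ mₖ S T ^ (-mₖ)`, `1 ≤ k ≤ ℓ`, and `T ^ m_ℓ`, where
`mₖ = n 0 + ⋯ + n (k - 1)` (its full preimage in `SL(2, ℤ)`, since `S ^ 2 = -1`). -/
def thinGroup (n : ℕ → ℤ) (ℓ : ℕ) : Subgroup SL(2, ℤ) :=
  Subgroup.closure
    ({γ | ∃ k ∈ Finset.Icc 1 ℓ,
        γ = ModularGroup.T ^ partialSum n k * ModularGroup.S * ModularGroup.T ^ (-partialSum n k)} ∪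
      {ModularGroup.T ^ partialSum n ℓ})

/-- The Nielsen region: the smallest non-empty `G`-invariant open convex subset of `ℍ`. -/
def nielsenRegion (G : Subgroup SL(2, ℤ)) : Set ℍ :=
  ⋂₀ {C : Set ℍ | C.Nonempty ∧ IsOpen C ∧ HypConvex C ∧ ∀ γ ∈ G, ∀ z ∈ C, γ • z ∈ C}

/-- `F` is a fundamental polygon for the action of `G` on the invariant set `N`. -/
structure IsFundamentalPolygon (G : Subgroup SL(2, ℤ)) (N F : Set ℍ) : Prop where
  subset : F ⊆ N
  isOpen : IsOpen F
  nonempty : F.Nonempty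
  convex : HypConvex F
  covers : ∀ z ∈ N, ∃ γ ∈ G, γ • z ∈ closure F
  unique : ∀ z₁ ∈ closure F, ∀ z₂ ∈ closure F, (∃ γ ∈ G, γ • z₁ = z₂) →
    z₁ = z₂ ∨ (z₁ ∈ frontier F ∧ z₂ ∈ frontier F)
  finite_sides : ∃ L : Set (Set ℍ), L.Finite ∧ (∀ l ∈ L, IsHypLine l) ∧ frontier F ⊆ ⋃₀ L

end PaintLeft

end

noncomputable section

namespace PaintLeft

/-! ## Hyperbolic segments in the Klein model -/

/-! Above a generic point of the modular surface, with representative `z₀` in `stdPolygon`, the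
sheets of both coverings are counted by one finite combinatorial set. The indices are the triples
`(k, j, i)` of `indexSet`: the ideal triangle standing on `[M k + j, M k + j + 1]`, with `0 ≤ j ≤ n
k - 2`, is cut by the rotation `rot` of order three into three copies of `stdPolygon`. For each `k`
these triangles fill the strip from `M k` to `M (k + 1)` except for the last one, and the half-turn
about `M (k + 1) + i` moves the relevant part of that one into the first triangle of the next strip.

The reduced numbers `W k` of the cycle give geodesics with endpoints `W k' + M k` and `W k + M k`,
which bound the Nielsen region from below. A ping-pong argument with the half-turns shows that the
region lies above all of them. Conversely, an invariant convex set accumulates at their endpoints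
and contains arbitrarily high points, so it fills everything above them. Hence the points of the
fundamental polygon above `z₀` correspond to the indices whose copy of `z₀` lies to the left of the
boundary geodesic of its strip. Pulled back to `stdPolygon`, that geodesic belongs to `indexNum W
p`, a number in the modular orbit of `w` (`ReducedCycle.exists_bijOn_fundamentalPolygon`).

On the painted side, pull every translate met by the closed geodesic back to `stdPolygon`. The
translates then correspond to the numbers in the orbit of `w` whose geodesic meets `stdPolygon`: the
stabilizer of `w` is generated up to sign by `γ`, and one period meets no two translates that differ
by a nontrivial power of `γ`. By reduction theory and Serret's theorem every such number is
`indexNum W p` for exactly one index `p` (`ReducedCycle.exists_indexNum_eq`,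
`ReducedCycle.indexNum_injOn`). The painted points are therefore the left indices whose geodesic
meets `stdPolygon` (`ReducedCycle.exists_bijOn_paint`).

The remaining left indices have a geodesic that misses `stdPolygon`. Such a geodesic has the whole
polygon on one side, so their number does not depend on `z₀`; it is the integer of the theorem.
Generic points have full measure because only countably many null conics and their translates are
avoided. -/

theorem cosh_dist_eq (z w : ℍ) : Real.cosh (dist z w) =
    (z.re ^ 2 + z.im ^ 2 + (w.re ^ 2 + w.im ^ 2) - 2 * z.re * w.re) / (2 * z.im * w.im) := by
  rw [UpperHalfPlane.cosh_dist', div_left_inj' (by positivity)]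
  ring

/-- The Klein model: in the coordinates `(Re z, |z|²)`, hyperbolic segments are straight. -/
def klein (z : ℍ) : ℝ × ℝ := (z.re, z.re ^ 2 + z.im ^ 2)

/-- With `v(z) = (1, Re z, |z|²) / Im z` on the hyperboloid, the hypotheses say `v(u) = α v(z) + β
v(w)`. Pairing with `v(z)` and `v(w)` gives the hyperbolic cosines of the two distances, and the
addition formula shows that the distances add up. -/
theorem mem_hypSegment_of_klein {z w u : ℍ} {t : ℝ} (h0 : 0 ≤ t) (h1 : t ≤ 1)
    (hx : u.re = (1 - t) * z.re + t * w.re)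
    (hq : u.re ^ 2 + u.im ^ 2 = (1 - t) * (z.re ^ 2 + z.im ^ 2) + t * (w.re ^ 2 + w.im ^ 2)) :
    u ∈ hypSegment z w := by
  have hz := z.im_pos
  have hw := w.im_pos
  have hu := u.im_pos
  obtain ⟨α, hα⟩ : ∃ α, α = (1 - t) * z.im / u.im := ⟨_, rfl⟩
  obtain ⟨β, hβ⟩ : ∃ β, β = t * w.im / u.im := ⟨_, rfl⟩
  have hα0 : 0 ≤ α := hα ▸ div_nonneg (mul_nonneg (by linarith) hz.le) hu.le
  have hβ0 : 0 ≤ β := hβ ▸ div_nonneg (mul_nonneg h0 hw.le) hu.le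
  set c := Real.cosh (dist z w) with hc
  have hcv := cosh_dist_eq z w
  rw [← hc] at hcv
  have hA : Real.cosh (dist z u) = α + β * c := by
    rw [cosh_dist_eq, hq, hx, hcv, hα, hβ]
    field_simp
    ring
  have hB : Real.cosh (dist u w) = α * c + β := by
    rw [cosh_dist_eq, hq, hx, hcv, hα, hβ]
    field_simp
    ring
  -- This is the normalization of `v(u)`; it turns the cosines just found into the sines `β s` and
  -- `α s`.
  have h1' : α ^ 2 + β ^ 2 + 2 * α * β * c = 1 := by
    rw [hcv, hα, hβ]
    field_simp
    rw [eq_comm, ← sub_eq_iff_eq_add'.2 hq.symm, hx]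
    ring
  set s := Real.sinh (dist z w) with hs
  have hs0 : 0 ≤ s := Real.sinh_nonneg_iff.2 dist_nonneg
  have hcs : c ^ 2 = s ^ 2 + 1 := Real.cosh_sq _
  have hsA : Real.sinh (dist z u) = β * s := by
    have h2 := Real.cosh_sq (dist z u)
    rw [hA] at h2
    refine (sq_eq_sq₀ (Real.sinh_nonneg_iff.2 dist_nonneg) (by positivity)).1 ?_
    nlinarith
  have hsB : Real.sinh (dist u w) = α * s := by
    have h2 := Real.cosh_sq (dist u w)
    rw [hB] at h2
    refine (sq_eq_sq₀ (Real.sinh_nonneg_iff.2 dist_nonneg) (by positivity)).1 ?_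
    nlinarith
  have : Real.cosh (dist z u + dist u w) = Real.cosh (dist z w) := by
    rw [Real.cosh_add, hA, hB, hsA, hsB, ← hc]
    linear_combination c * h1' + α * β * hcs * (-1)
  exact Real.cosh_strictMonoOn.injOn (Set.mem_Ici.2 (by positivity))
    (Set.mem_Ici.2 dist_nonneg) this

theorem klein_of_mem_hypSegment {z w u : ℍ} (h : u ∈ hypSegment z w) :
    ∃ t : ℝ, 0 ≤ t ∧ t ≤ 1 ∧ u.re = (1 - t) * z.re + t * w.re ∧
      u.re ^ 2 + u.im ^ 2 = (1 - t) * (z.re ^ 2 + z.im ^ 2) + t * (w.re ^ 2 + w.im ^ 2) := by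
  have h' : dist z u + dist u w = dist z w := h
  rcases eq_or_ne z w with rfl | hzw
  · have : dist z u = 0 := by
      have := dist_self z; have := dist_nonneg (x := z) (y := u)
      have := dist_nonneg (x := u) (y := z); linarith
    have hzu := eq_of_dist_eq_zero this
    subst hzu
    exact ⟨0, le_rfl, zero_le_one, by ring, by ring⟩
  have hz := z.im_pos
  have hw := w.im_pos
  have hu := u.im_pos
  have hD : 0 < Real.sinh (dist z w) := Real.sinh_pos_iff.2 (dist_pos.2 hzw)
  obtain ⟨d₁, hd₁⟩ : ∃ d, d = dist z u := ⟨_, rfl⟩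
  obtain ⟨d₂, hd₂⟩ : ∃ d, d = dist u w := ⟨_, rfl⟩
  have hC := cosh_dist_eq z w
  have hA := cosh_dist_eq z u
  have hB := cosh_dist_eq u w
  have hd1 : 0 ≤ d₁ := hd₁ ▸ dist_nonneg
  have hd2 : 0 ≤ d₂ := hd₂ ▸ dist_nonneg
  rw [← h'] at hC hD
  rw [← hd₁] at hA hC hD
  rw [← hd₂] at hB hC hD
  rw [Real.cosh_add] at hC
  rw [Real.sinh_add] at hD
  have e1 := Real.cosh_sq d₁
  have e2 := Real.cosh_sq d₂
  have p1 : 0 ≤ Real.sinh d₁ := Real.sinh_nonneg_iff.2 hd1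
  have p2 : 0 ≤ Real.sinh d₂ := Real.sinh_nonneg_iff.2 hd2
  generalize Real.sinh d₁ = s₁ at *
  generalize Real.cosh d₁ = c₁ at *
  generalize Real.sinh d₂ = s₂ at *
  generalize Real.cosh d₂ = c₂ at *
  obtain ⟨s, hs⟩ : ∃ s, s = s₁ * c₂ + c₁ * s₂ := ⟨_, rfl⟩
  rw [← hs] at hD
  -- the vector `s v(u) - s₂ v(z) - s₁ v(w)` is isotropic and orthogonal to `v(z)`
  obtain ⟨n₀, hn₀⟩ : ∃ n, n = s / u.im - s₂ / z.im - s₁ / w.im := ⟨_, rfl⟩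
  obtain ⟨n₁, hn₁⟩ : ∃ n, n = s * u.re / u.im - s₂ * z.re / z.im - s₁ * w.re / w.im := ⟨_, rfl⟩
  obtain ⟨n₂, hn₂⟩ : ∃ n, n = s * (u.re ^ 2 + u.im ^ 2) / u.im - s₂ * (z.re ^ 2 + z.im ^ 2) / z.im
    - s₁ * (w.re ^ 2 + w.im ^ 2) / w.im := ⟨_, rfl⟩
  have horth : n₀ * (z.re ^ 2 + z.im ^ 2) + n₂ - 2 * n₁ * z.re = 0 := by
    have : n₀ * (z.re ^ 2 + z.im ^ 2) + n₂ - 2 * n₁ * z.re = 2 * z.im *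
        (s * c₁ - s₂ - s₁ * (c₁ * c₂ + s₁ * s₂)) := by
      rw [hC, hA, hn₀, hn₁, hn₂]
      field_simp
      ring
    rw [this, hs]
    linear_combination 2 * z.im * s₂ * e1
  have hiso : n₁ ^ 2 - n₀ * n₂ = 0 := by
    have : n₁ ^ 2 - n₀ * n₂ = - (s ^ 2 + s₂ ^ 2 + s₁ ^ 2 + 2 * s₁ * s₂ * (c₁ * c₂ + s₁ * s₂)
        - 2 * s * s₂ * c₁ - 2 * s * s₁ * c₂) := by
      rw [hC, hA, hB, hn₀, hn₁, hn₂]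
      field_simp
      ring
    rw [this, hs]
    linear_combination -s₁ ^ 2 * e2 * (-1) + s₂ ^ 2 * e1
  -- The form is definite on the orthogonal complement of `v(z)`: eliminating `n₂` leaves a sum of
  -- two squares, so the vector vanishes.
  have hsum : (n₁ - n₀ * z.re) ^ 2 + (n₀ * z.im) ^ 2 = 0 := by
    linear_combination n₀ * horth + hiso
  have k0 : n₀ * z.im = 0 := pow_eq_zero_iff two_ne_zero |>.1
    (le_antisymm (by linarith [sq_nonneg (n₁ - n₀ * z.re)]) (sq_nonneg _))
  have k0' : n₀ = 0 := by simpa [hz.ne'] using k0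
  have k1 : n₁ = 0 := by
    rw [k0', zero_mul, zero_mul, sub_zero, zero_pow two_ne_zero, add_zero] at hsum
    exact pow_eq_zero_iff two_ne_zero |>.1 hsum
  have k2 : n₂ = 0 := by rw [k0', k1] at horth; linarith
  rw [k0'] at hn₀
  rw [k1] at hn₁
  rw [k2] at hn₂
  have e : s / u.im * (u.im / s) = 1 := by field_simp
  have ht : s₂ * u.im / (s * z.im) + s₁ * u.im / (s * w.im) = 1 := by
    linear_combination e + (u.im / s) * hn₀
  have hx : u.re = s₂ * u.im / (s * z.im) * z.re + s₁ * u.im / (s * w.im) * w.re := by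
    linear_combination -u.re * e - (u.im / s) * hn₁
  have hq : u.re ^ 2 + u.im ^ 2 = s₂ * u.im / (s * z.im) * (z.re ^ 2 + z.im ^ 2) +
      s₁ * u.im / (s * w.im) * (w.re ^ 2 + w.im ^ 2) := by
    linear_combination -(u.re ^ 2 + u.im ^ 2) * e - (u.im / s) * hn₂
  have q1 : 0 ≤ s₂ * u.im / (s * z.im) := by positivity
  have q2 : 0 ≤ s₁ * u.im / (s * w.im) := by positivity
  refine ⟨s₁ * u.im / (s * w.im), q2, by linarith, ?_, ?_⟩
  · linear_combination hx + z.re * ht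
  · linear_combination hq + (z.re ^ 2 + z.im ^ 2) * ht

theorem hypConvex_preimage_klein {s : Set (ℝ × ℝ)} (hs : Convex ℝ s) :
    HypConvex (klein ⁻¹' s) := by
  intro z hz w hw u hu
  obtain ⟨t, h0, h1, hx, hq⟩ := klein_of_mem_hypSegment hu
  have := hs hz hw (sub_nonneg.2 h1) h0 (by ring)
  refine Set.mem_preimage.2 ?_
  convert this using 1
  ext
  · simpa [klein] using hx
  · simpa [klein] using hq

/-- Being an open embedding lets interiors pass through `klein`, so that the interior of a preimage
of a convex set is again geodesically convex. -/
theorem isOpenEmbedding_klein : Topology.IsOpenEmbedding klein := by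
  have hopen : IsOpen {p : ℝ × ℝ | p.1 ^ 2 < p.2} :=
    isOpen_lt (by fun_prop) (by fun_prop)
  have hcont : Continuous klein := by
    unfold klein
    have := UpperHalfPlane.continuous_re
    have := UpperHalfPlane.continuous_im
    fun_prop
  have hr : ∀ z, 0 < (klein z).2 - (klein z).1 ^ 2 := fun z => by
    have := z.im_pos
    simp only [klein]
    nlinarith [pow_pos this 2]
  refine Topology.IsOpenEmbedding.of_continuous_injective_isOpenMap hcont ?_ ?_
  · intro z w h
    simp only [klein, Prod.mk.injEq] at h
    refine UpperHalfPlane.ext_re_im h.1 ?_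
    rw [h.1] at h
    exact (sq_eq_sq₀ z.im_pos.le w.im_pos.le).1 (by linarith [h.2])
  · intro s hs
    rw [isOpen_iff_mem_nhds]
    rintro _ ⟨z, hz, rfl⟩
    have hinv : ContinuousAt (fun p : ℝ × ℝ => UpperHalfPlane.ofComplex
        ((p.1 : ℂ) + (√(p.2 - p.1 ^ 2) : ℝ) * Complex.I)) (klein z) := by
      have h1 : ContinuousAt (fun p : ℝ × ℝ => (p.1 : ℂ) + (√(p.2 - p.1 ^ 2) : ℝ) * Complex.I)
          (klein z) := by fun_prop
      refine ContinuousAt.comp (g := fun c : ℂ => (UpperHalfPlane.ofComplex c)) ?_ h1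
      refine (UpperHalfPlane.contMDiffAt_ofComplex (n := 0) ?_).continuousAt
      simpa using hr z
    have hval : ∀ z : ℍ, UpperHalfPlane.ofComplex (((klein z).1 : ℂ) +
        (√((klein z).2 - (klein z).1 ^ 2) : ℝ) * Complex.I) = z := by
      intro z
      have : (((klein z).1 : ℂ) + (√((klein z).2 - (klein z).1 ^ 2) : ℝ) * Complex.I) = (z : ℂ) := by
        simp only [klein, add_sub_cancel_left, Real.sqrt_sq z.im_pos.le]
        exact Complex.re_add_im z
      rw [this, UpperHalfPlane.ofComplex_apply]
    have hmem := hinv.preimage_mem_nhds (t := s) (by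
      rw [hval]; exact hs.mem_nhds hz)
    filter_upwards [hmem, hopen.mem_nhds (show klein z ∈ _ by
      have := hr z; simp only [Set.mem_ofPred_eq]; linarith)] with p hp hp2
    have him : 0 < ((p.1 : ℂ) + (√(p.2 - p.1 ^ 2) : ℝ) * Complex.I).im := by
      simpa using hp2
    refine ⟨_, hp, ?_⟩
    dsimp only
    rw [UpperHalfPlane.ofComplex_apply_of_im_pos him]
    ext
    · simp [klein, UpperHalfPlane.re]
    · simp only [klein, UpperHalfPlane.re, UpperHalfPlane.im]
      have := Real.sq_sqrt (sub_nonneg.2 (le_of_lt hp2))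
      simp
      linarith

theorem exists_mem_hypSegment (z w : ℍ) {t : ℝ} (h0 : 0 ≤ t) (h1 : t ≤ 1) :
    ∃ u ∈ hypSegment z w, u.re = (1 - t) * z.re + t * w.re ∧
      u.re ^ 2 + u.im ^ 2 = (1 - t) * (z.re ^ 2 + z.im ^ 2) + t * (w.re ^ 2 + w.im ^ 2) := by
  obtain ⟨X, hX⟩ : ∃ X, X = (1 - t) * z.re + t * w.re := ⟨_, rfl⟩
  obtain ⟨Y, hY⟩ : ∃ Y, Y = (1 - t) * (z.re ^ 2 + z.im ^ 2) + t * (w.re ^ 2 + w.im ^ 2) := ⟨_, rfl⟩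
  have hpos : 0 < Y - X ^ 2 := by
    have : Y - X ^ 2 = (1 - t) * z.im ^ 2 + t * w.im ^ 2 + t * (1 - t) * (z.re - w.re) ^ 2 := by
      rw [hX, hY]; ring
    rw [this]
    have hz := pow_pos z.im_pos 2
    have hw := pow_pos w.im_pos 2
    have h3 : 0 ≤ t * (1 - t) * (z.re - w.re) ^ 2 :=
      mul_nonneg (mul_nonneg h0 (by linarith)) (sq_nonneg _)
    rcases h0.eq_or_lt with rfl | h0
    · simp only [sub_zero, one_mul, zero_mul] at *; linarith
    · have := mul_nonneg (sub_nonneg.2 h1) hz.le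
      have := mul_pos h0 hw
      linarith
  refine ⟨⟨⟨X, √(Y - X ^ 2)⟩, Real.sqrt_pos.2 hpos⟩, ?_, ?_, ?_⟩
  · refine mem_hypSegment_of_klein h0 h1 hX ?_
    change X ^ 2 + √(Y - X ^ 2) ^ 2 = _
    rw [Real.sq_sqrt hpos.le, ← hY]; ring
  · exact hX
  · change X ^ 2 + √(Y - X ^ 2) ^ 2 = _
    rw [Real.sq_sqrt hpos.le, ← hY]; ring

/-! ## Moebius transformations -/

section Mob

variable {F : Type*} [Field F]

/-- The denominator `c x + d`. -/
def den (γ : SL(2, ℤ)) (x : F) : F := (γ 1 0 : F) * x + (γ 1 1 : F)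

/-- The numerator `a x + b`. -/
def num (γ : SL(2, ℤ)) (x : F) : F := (γ 0 0 : F) * x + (γ 0 1 : F)

/-- The Moebius transformation `(a x + b) / (c x + d)`. -/
def mob (γ : SL(2, ℤ)) (x : F) : F := num γ x / den γ x

/-- The elements `1` and `x` are linearly independent over `ℤ`. -/
def Irr (x : F) : Prop := ∀ c d : ℤ, (c : F) * x + d = 0 → c = 0 ∧ d = 0

theorem det_eq (γ : SL(2, ℤ)) : γ 0 0 * γ 1 1 - γ 0 1 * γ 1 0 = 1 := by
  have := γ.det_coe
  rwa [Matrix.det_fin_two] at this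

theorem det_eq_cast (R : Type*) [CommRing R] (γ : SL(2, ℤ)) :
    (γ 0 0 : R) * γ 1 1 - γ 0 1 * γ 1 0 = 1 := by
  exact_mod_cast congrArg (Int.cast : ℤ → R) (det_eq γ)

theorem Irr.den_ne_zero {x : F} (hx : Irr x) (γ : SL(2, ℤ)) : den γ x ≠ 0 := fun h => by
  obtain ⟨h1, h2⟩ := hx _ _ h
  have := det_eq γ
  simp [h1, h2] at this

theorem den_mul {x : F} (γ δ : SL(2, ℤ)) (h : den δ x ≠ 0) :
    den (γ * δ) x = den γ (mob δ x) * den δ x := by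
  have : mob δ x * den δ x = num δ x := div_mul_cancel₀ _ h
  unfold den at *
  rw [add_mul, mul_assoc, this]
  simp [Matrix.mul_apply, Fin.sum_univ_two, num]
  ring

theorem num_mul {x : F} (γ δ : SL(2, ℤ)) (h : den δ x ≠ 0) :
    num (γ * δ) x = num γ (mob δ x) * den δ x := by
  have : mob δ x * den δ x = num δ x := div_mul_cancel₀ _ h
  unfold den num at *
  rw [add_mul, mul_assoc, this]
  simp [Matrix.mul_apply, Fin.sum_univ_two]
  ring

theorem mob_mul {x : F} (γ δ : SL(2, ℤ)) (h : den δ x ≠ 0) :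
    mob (γ * δ) x = mob γ (mob δ x) := by
  rw [mob, mob, den_mul γ δ h, num_mul γ δ h, mul_div_mul_right _ _ h]

@[simp] theorem mob_one (x : F) : mob 1 x = x := by simp [mob, num, den]

theorem mob_neg (γ : SL(2, ℤ)) (x : F) : mob (-γ) x = mob γ x := by
  have h1 : num (-γ) x = - num γ x := by simp [num]; ring
  have h2 : den (-γ) x = - den γ x := by simp [den]; ring
  rw [mob, mob, h1, h2, neg_div_neg_eq]

theorem mob_sub_mob {x y : F} (γ : SL(2, ℤ)) (hx : den γ x ≠ 0) (hy : den γ y ≠ 0) :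
    mob γ x - mob γ y = (x - y) / (den γ x * den γ y) := by
  rw [mob, mob, div_sub_div _ _ hx hy, num, num]
  congr 1
  unfold den
  linear_combination (x - y) * det_eq_cast F γ

theorem Irr.mob {x : F} (hx : Irr x) (γ : SL(2, ℤ)) : Irr (mob γ x) := by
  intro c d h
  rw [PaintLeft.mob, mul_div_assoc', div_add' _ _ _ (hx.den_ne_zero γ), div_eq_zero_iff,
    or_iff_left (hx.den_ne_zero γ)] at h
  have := hx (c * γ 0 0 + d * γ 1 0) (c * γ 0 1 + d * γ 1 1) (by
    push_cast
    unfold num den at h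
    linear_combination h)
  have h3 := det_eq γ
  constructor
  · linear_combination γ 1 1 * this.1 - γ 1 0 * this.2 - c * h3
  · linear_combination -γ 0 1 * this.1 + γ 0 0 * this.2 - d * h3

theorem mob_inv_mob {x : F} (hx : Irr x) (γ : SL(2, ℤ)) : mob γ⁻¹ (mob γ x) = x := by
  rw [← mob_mul _ _ (hx.den_ne_zero γ)]; simp

theorem mob_mob_inv {x : F} (hx : Irr x) (γ : SL(2, ℤ)) : mob γ (mob γ⁻¹ x) = x := by
  rw [← mob_mul _ _ (hx.den_ne_zero _)]; simp

end Mob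

theorem map_den {F L : Type*} [Field F] [Field L] (φ : F →+* L) (γ : SL(2, ℤ)) (x : F) :
    φ (den γ x) = den γ (φ x) := by simp [den]

theorem map_mob {F L : Type*} [Field F] [Field L] (φ : F →+* L) (γ : SL(2, ℤ)) (x : F) :
    φ (mob γ x) = mob γ (φ x) := by simp [mob, num, den]

theorem Irr.map {F L : Type*} [Field F] [Field L] (φ : F →+* L) {x : F} (hx : Irr x) :
    Irr (φ x) := fun c d h => hx c d (φ.injective (by simpa using h))

theorem coe_smul_eq (γ : SL(2, ℤ)) (z : ℍ) : ((γ • z : ℍ) : ℂ) = mob γ (z : ℂ) := by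
  rw [coe_specialLinearGroup_apply]
  simp [mob, num, den]

theorem den_coe_ne_zero (γ : SL(2, ℤ)) (z : ℍ) : den γ (z : ℂ) ≠ 0 := by
  intro h
  have h1 := congrArg Complex.im h
  have h2 := congrArg Complex.re h
  simp [den] at h1 h2
  rcases h1 with h1 | h1
  · have := det_eq γ
    rw [h1] at h2
    simp at h2
    simp [h1, h2] at this
  · exact z.im_pos.ne' h1

theorem coe_sub_ne_zero (z : ℍ) (x : ℝ) : (z : ℂ) - x ≠ 0 := by
  intro h
  have h1 := congrArg Complex.im h
  simp at h1
  exact z.im_pos.ne' h1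

theorem ofReal_den (γ : SL(2, ℤ)) (x : ℝ) : ((den γ x : ℝ) : ℂ) = den γ (x : ℂ) :=
  map_den Complex.ofRealHom γ x

theorem ofReal_mob (γ : SL(2, ℤ)) (x : ℝ) : ((mob γ x : ℝ) : ℂ) = mob γ (x : ℂ) :=
  map_mob Complex.ofRealHom γ x

/-- The factor is a positive real number, so sides and geodesics are carried along; for a matrix
fixing both endpoints it is the multiplier. -/
theorem straighten_smul {x₀ x₁ : ℝ} (γ : SL(2, ℤ)) (h0 : den γ x₀ ≠ 0) (h1 : den γ x₁ ≠ 0)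
    (z : ℍ) : straighten (mob γ x₀) (mob γ x₁) (γ • z) =
      ((den γ x₁ ^ 2)⁻¹ : ℝ) * straighten x₀ x₁ z := by
  have h0' : den γ (x₀ : ℂ) ≠ 0 := by rw [← ofReal_den]; exact_mod_cast h0
  have h1' : den γ (x₁ : ℂ) ≠ 0 := by rw [← ofReal_den]; exact_mod_cast h1
  have hz := den_coe_ne_zero γ z
  have hz0 := coe_sub_ne_zero z x₀
  unfold straighten
  rw [coe_smul_eq, ofReal_mob, ofReal_mob, mob_sub_mob γ h1' h0', mob_sub_mob γ hz h1',
    mob_sub_mob γ hz h0']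
  push_cast
  rw [ofReal_den]
  field_simp

/-! ## Half-planes in coordinates -/

/-- The equation `(x - x₀) (x - x₁) + y ^ 2` of the geodesic with endpoints `x₀`, `x₁`. -/
def side (x₀ x₁ : ℝ) (z : ℍ) : ℝ := (z.re - x₀) * (z.re - x₁) + z.im ^ 2

theorem side_eq (x₀ x₁ : ℝ) (z : ℍ) :
    side x₀ x₁ z = (z.re ^ 2 + z.im ^ 2) - (x₀ + x₁) * z.re + x₀ * x₁ := by
  unfold side; ring

theorem straighten_re (x₀ x₁ : ℝ) (z : ℍ) : (straighten x₀ x₁ z).re =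
    (x₁ - x₀) * side x₀ x₁ z / ((z.re - x₀) ^ 2 + z.im ^ 2) := by
  simp only [straighten, Complex.div_re, Complex.mul_re, Complex.sub_re, Complex.ofReal_re,
    Complex.sub_im, Complex.ofReal_im, Complex.mul_im, Complex.normSq_apply, coe_re, coe_im, side]
  rw [← add_div]
  congr 1 <;> ring

theorem straighten_im (x₀ x₁ : ℝ) (z : ℍ) : (straighten x₀ x₁ z).im =
    (x₁ - x₀) ^ 2 * z.im / ((z.re - x₀) ^ 2 + z.im ^ 2) := by
  simp only [straighten, Complex.div_im, Complex.mul_re, Complex.sub_re, Complex.ofReal_re,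
    Complex.sub_im, Complex.ofReal_im, Complex.mul_im, Complex.normSq_apply, coe_re, coe_im]
  rw [← sub_div]
  congr 1 <;> ring

theorem sq_add_sq_pos (x : ℝ) (z : ℍ) : 0 < (z.re - x) ^ 2 + z.im ^ 2 := by
  have := pow_pos z.im_pos 2
  positivity

theorem mem_leftSide {x₀ x₁ : ℝ} {z : ℍ} : z ∈ leftSide x₀ x₁ ↔ 0 ≤ (x₁ - x₀) * side x₀ x₁ z := by
  unfold leftSide
  rw [Set.mem_ofPred_eq, straighten_re, le_div_iff₀ (sq_add_sq_pos _ _), zero_mul]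

theorem mem_leftSide_of_lt {x₀ x₁ : ℝ} (h : x₀ < x₁) {z : ℍ} :
    z ∈ leftSide x₀ x₁ ↔ 0 ≤ side x₀ x₁ z := by
  rw [mem_leftSide, mul_nonneg_iff_of_pos_left (sub_pos.2 h)]

theorem mem_geodesicLine {x₀ x₁ : ℝ} (h : x₀ ≠ x₁) {z : ℍ} :
    z ∈ geodesicLine x₀ x₁ ↔ side x₀ x₁ z = 0 := by
  unfold geodesicLine
  rw [Set.mem_ofPred_eq, straighten_re, div_eq_zero_iff, or_iff_left (sq_add_sq_pos _ _).ne',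
    mul_eq_zero, or_iff_right (sub_ne_zero.2 h.symm)]

theorem smul_mem_leftSide {x₀ x₁ : ℝ} (γ : SL(2, ℤ)) (h0 : den γ x₀ ≠ 0) (h1 : den γ x₁ ≠ 0)
    {z : ℍ} : γ • z ∈ leftSide (mob γ x₀) (mob γ x₁) ↔ z ∈ leftSide x₀ x₁ := by
  unfold leftSide
  rw [Set.mem_ofPred_eq, Set.mem_ofPred_eq, straighten_smul γ h0 h1, Complex.re_ofReal_mul,
    mul_nonneg_iff_of_pos_left (by positivity)]

theorem smul_mem_geodesicLine {x₀ x₁ : ℝ} (γ : SL(2, ℤ)) (h0 : den γ x₀ ≠ 0)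
    (h1 : den γ x₁ ≠ 0) {z : ℍ} :
    γ • z ∈ geodesicLine (mob γ x₀) (mob γ x₁) ↔ z ∈ geodesicLine x₀ x₁ := by
  unfold geodesicLine
  rw [Set.mem_ofPred_eq, Set.mem_ofPred_eq, straighten_smul γ h0 h1, Complex.re_ofReal_mul,
    mul_eq_zero, or_iff_right (by positivity)]

theorem convex_halfPlane (a b c : ℝ) : Convex ℝ {p : ℝ × ℝ | 0 ≤ a * p.2 + b * p.1 + c} := by
  intro p hp q hq s t hs ht hst
  simp only [Set.mem_ofPred_eq, Prod.snd_add, Prod.smul_snd, smul_eq_mul, Prod.fst_add,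
    Prod.smul_fst] at *
  have := mul_nonneg hs hp
  have := mul_nonneg ht hq
  have e : a * (s * p.2 + t * q.2) + b * (s * p.1 + t * q.1) + c =
    s * (a * p.2 + b * p.1 + c) + t * (a * q.2 + b * q.1 + c) := by
    linear_combination -c * hst
  rw [e]; linarith

theorem leftSide_eq_preimage (x₀ x₁ : ℝ) : leftSide x₀ x₁ = klein ⁻¹'
    {p : ℝ × ℝ | 0 ≤ (x₁ - x₀) * p.2 + (-(x₁ - x₀) * (x₀ + x₁)) * p.1
      + (x₁ - x₀) * (x₀ * x₁)} := by
  ext z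
  rw [mem_leftSide, side_eq, Set.mem_preimage, Set.mem_ofPred_eq, klein]
  ring_nf

/-! ## The action in coordinates -/

theorem re_smul_eq (γ : SL(2, ℤ)) (z : ℍ) : (γ • z).re = (mob γ (z : ℂ)).re := by
  rw [← coe_smul_eq]; rfl

theorem im_smul_eq (γ : SL(2, ℤ)) (z : ℍ) : (γ • z).im = (mob γ (z : ℂ)).im := by
  rw [← coe_smul_eq]; rfl

theorem nsq_pos (z : ℍ) : 0 < z.re ^ 2 + z.im ^ 2 := by
  simpa using sq_add_sq_pos 0 z

theorem re_S_smul (z : ℍ) : (ModularGroup.S • z).re = -z.re / (z.re ^ 2 + z.im ^ 2) := by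
  rw [re_smul_eq]
  simp [mob, num, den, ModularGroup.S, Complex.div_re, Complex.normSq_apply, sq]

theorem im_S_smul (z : ℍ) : (ModularGroup.S • z).im = z.im / (z.re ^ 2 + z.im ^ 2) := by
  rw [im_smul_eq]
  simp [mob, num, den, ModularGroup.S, Complex.normSq_apply, sq, neg_div]

theorem nsq_S_smul (z : ℍ) : (ModularGroup.S • z).re ^ 2 + (ModularGroup.S • z).im ^ 2 =
    1 / (z.re ^ 2 + z.im ^ 2) := by
  have := nsq_pos z
  rw [re_S_smul, im_S_smul]
  field_simp

/-- The rotation of order three `z ↦ 1 / (1 - z)` permuting `0 → 1 → ∞ → 0`. -/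
def rot : SL(2, ℤ) := ⟨!![0, 1; -1, 1], by simp [Matrix.det_fin_two]⟩

theorem mob_rot {F : Type*} [Field F] (x : F) : mob rot x = 1 / (1 - x) := by
  simp [mob, num, den, rot]
  ring

theorem mob_rot_inv {F : Type*} [Field F] (x : F) : mob rot⁻¹ x = (x - 1) / x := by
  have : rot⁻¹ = (⟨!![1, -1; 1, 0], by simp [Matrix.det_fin_two]⟩ : SL(2, ℤ)) := by
    apply inv_eq_of_mul_eq_one_right; decide
  rw [this]
  simp [mob, num, den]
  ring

theorem rot_nsq_pos (z : ℍ) : 0 < z.re ^ 2 + z.im ^ 2 - 2 * z.re + 1 := by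
  have := sq_add_sq_pos 1 z
  linarith

theorem re_rot_smul (z : ℍ) : (rot • z).re =
    (1 - z.re) / (z.re ^ 2 + z.im ^ 2 - 2 * z.re + 1) := by
  rw [re_smul_eq, mob_rot]
  simp [Complex.normSq_apply, sq]
  ring

theorem im_rot_smul (z : ℍ) : (rot • z).im =
    z.im / (z.re ^ 2 + z.im ^ 2 - 2 * z.re + 1) := by
  rw [im_smul_eq, mob_rot]
  simp [Complex.normSq_apply, sq]
  ring

theorem nsq_rot_smul (z : ℍ) : (rot • z).re ^ 2 + (rot • z).im ^ 2 =
    1 / (z.re ^ 2 + z.im ^ 2 - 2 * z.re + 1) := by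
  have := rot_nsq_pos z
  rw [re_rot_smul, im_rot_smul, div_pow, div_pow, ← add_div, div_eq_div_iff (by positivity) this.ne']
  ring

theorem re_rot_inv_smul (z : ℍ) : (rot⁻¹ • z).re = 1 - z.re / (z.re ^ 2 + z.im ^ 2) := by
  have := nsq_pos z
  rw [re_smul_eq, mob_rot_inv]
  simp [Complex.div_re, Complex.normSq_apply, sq] at this ⊢
  field_simp
  ring

theorem im_rot_inv_smul (z : ℍ) : (rot⁻¹ • z).im = z.im / (z.re ^ 2 + z.im ^ 2) := by
  have := nsq_pos z
  rw [im_smul_eq, mob_rot_inv]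
  simp [Complex.div_im, Complex.normSq_apply, sq] at this ⊢
  field_simp
  ring

theorem nsq_rot_inv_smul (z : ℍ) : (rot⁻¹ • z).re ^ 2 + (rot⁻¹ • z).im ^ 2 =
    (z.re ^ 2 + z.im ^ 2 - 2 * z.re + 1) / (z.re ^ 2 + z.im ^ 2) := by
  have := nsq_pos z
  rw [re_rot_inv_smul, im_rot_inv_smul]
  field_simp
  ring

theorem rot_pow_three : rot ^ 3 = -1 := by decide

/-! ## The fundamental polygon -/

theorem mem_stdPolygon {z : ℍ} : z ∈ stdPolygon ↔
    2 * z.re < z.re ^ 2 + z.im ^ 2 ∧ 0 < z.re ∧ z.re < 1 / 2 := by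
  unfold stdPolygon
  rw [Set.mem_ofPred_eq]
  have : ‖(z : ℂ) - 1‖ ^ 2 = z.re ^ 2 + z.im ^ 2 - 2 * z.re + 1 := by
    rw [Complex.sq_norm, Complex.normSq_apply]
    simp
    ring
  rw [← one_lt_sq_iff₀ (norm_nonneg _), this]
  constructor <;> rintro ⟨h1, h2⟩ <;> exact ⟨by linarith, h2⟩

theorem mem_fdo {z : ℍ} : z ∈ ModularGroup.fdo ↔ 1 < z.re ^ 2 + z.im ^ 2 ∧ |z.re| < 1 / 2 := by
  unfold ModularGroup.fdo
  rw [Set.mem_ofPred_eq, Complex.normSq_apply]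
  simp [sq]

theorem mem_fdo_of_mem_stdPolygon {z : ℍ} (hz : z ∈ stdPolygon) (h : 1 < z.re ^ 2 + z.im ^ 2) :
    z ∈ ModularGroup.fdo := by
  rw [mem_stdPolygon] at hz
  rw [mem_fdo]
  exact ⟨h, by rw [abs_of_pos hz.2.1]; exact hz.2.2⟩

theorem S_smul_mem_fdo_of_mem_stdPolygon {z : ℍ} (hz : z ∈ stdPolygon)
    (h : z.re ^ 2 + z.im ^ 2 < 1) : ModularGroup.S • z ∈ ModularGroup.fdo := by
  rw [mem_stdPolygon] at hz
  rw [mem_fdo, nsq_S_smul, re_S_smul]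
  have := nsq_pos z
  refine ⟨by rw [one_lt_div this]; exact h, ?_⟩
  rw [neg_div, abs_neg, abs_of_pos (div_pos hz.2.1 this), div_lt_iff₀ this]
  linarith

/-- Outside the unit circle, `stdPolygon` meets each orbit at most once, with trivial
stabilizers. -/
theorem eq_one_or_neg_one_of_mem_stdPolygon {z : ℍ} {γ : SL(2, ℤ)} (hz : z ∈ stdPolygon)
    (hγ : γ • z ∈ stdPolygon) (h1 : z.re ^ 2 + z.im ^ 2 ≠ 1)
    (h2 : (γ • z).re ^ 2 + (γ • z).im ^ 2 ≠ 1) : γ = 1 ∨ γ = -1 := by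
  have hS : ModularGroup.S * ModularGroup.S = -1 := by decide
  have hS' : ModularGroup.S⁻¹ = -ModularGroup.S := by decide
  have hSr : ∀ w : ℍ, w ∈ stdPolygon → (ModularGroup.S • w).re < 0 := fun w hw => by
    rw [re_S_smul, neg_div]
    exact neg_lt_zero.2 (div_pos (mem_stdPolygon.1 hw).2.1 (nsq_pos w))
  -- The unit circle cuts `stdPolygon` into the right half of the usual fundamental domain and the
  -- `S`-image of its left half. The mixed cases fail because the sign of the real part tells the
  -- two halves apart.
  rcases h1.lt_or_gt with h1 | h1 <;> rcases h2.lt_or_gt with h2 | h2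
  · have a := S_smul_mem_fdo_of_mem_stdPolygon hz h1
    have b := S_smul_mem_fdo_of_mem_stdPolygon hγ h2
    have := ModularGroup.eq_one_or_neg_one_of_mem_fdo_mem_fdo a
      (g := ModularGroup.S * γ * ModularGroup.S⁻¹) (by simpa [mul_smul] using b)
    have e : γ = ModularGroup.S⁻¹ * (ModularGroup.S * γ * ModularGroup.S⁻¹) * ModularGroup.S := by
      group
    rcases this with h | h <;> rw [h] at e
    · left; simpa using e
    · right; simpa using e
  · exfalso
    have a := S_smul_mem_fdo_of_mem_stdPolygon hz h1
    have b := mem_fdo_of_mem_stdPolygon hγ h2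
    have := ModularGroup.eq_smul_self_of_mem_fdo_mem_fdo a
      (g := γ * ModularGroup.S⁻¹) (by simpa [mul_smul] using b)
    simp only [mul_smul, inv_smul_smul] at this
    have h3 := hSr z hz
    rw [this] at h3
    exact lt_asymm h3 (mem_stdPolygon.1 hγ).2.1
  · exfalso
    have a := mem_fdo_of_mem_stdPolygon hz h1
    have b := S_smul_mem_fdo_of_mem_stdPolygon hγ h2
    have := ModularGroup.eq_smul_self_of_mem_fdo_mem_fdo a
      (g := ModularGroup.S * γ) (by simpa [mul_smul] using b)
    simp only [mul_smul] at this
    have h3 := hSr _ hγ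
    rw [← this] at h3
    exact lt_asymm h3 (mem_stdPolygon.1 hz).2.1
  · exact ModularGroup.eq_one_or_neg_one_of_mem_fdo_mem_fdo
      (mem_fdo_of_mem_stdPolygon hz h1) (mem_fdo_of_mem_stdPolygon hγ h2)

theorem hypConvex_stdPolygon : HypConvex stdPolygon := by
  have : stdPolygon = klein ⁻¹' {p : ℝ × ℝ | 2 * p.1 < p.2 ∧ 0 < p.1 ∧ p.1 < 1 / 2} := by
    ext z
    rw [mem_stdPolygon]
    rfl
  rw [this]
  refine hypConvex_preimage_klein ?_
  have e : {p : ℝ × ℝ | 2 * p.1 < p.2 ∧ 0 < p.1 ∧ p.1 < 1 / 2} =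
      {p : ℝ × ℝ | 0 < (LinearMap.snd ℝ ℝ ℝ - (2 : ℝ) • LinearMap.fst ℝ ℝ ℝ) p} ∩
      ({p : ℝ × ℝ | 0 < (LinearMap.fst ℝ ℝ ℝ) p} ∩
        {p : ℝ × ℝ | (LinearMap.fst ℝ ℝ ℝ) p < 1 / 2}) := by
    ext p
    simp
  rw [e]
  exact (convex_halfSpace_gt (LinearMap.isLinear _) _).inter
    ((convex_halfSpace_gt (LinearMap.isLinear _) _).inter
    (convex_halfSpace_lt (LinearMap.isLinear _) _))

/-- A geodesic that misses `stdPolygon` does not separate its points. -/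
theorem stdPolygon_subset_leftSide {x₀ x₁ : ℝ} (h : x₀ ≠ x₁)
    (hF : ¬ (geodesicLine x₀ x₁ ∩ stdPolygon).Nonempty) {z w : ℍ} (hz : z ∈ stdPolygon)
    (hw : w ∈ stdPolygon) (hl : z ∈ leftSide x₀ x₁) : w ∈ leftSide x₀ x₁ := by
  by_contra hn
  rw [mem_leftSide] at hl hn
  push Not at hn
  obtain ⟨a, ha⟩ : ∃ a, a = (x₁ - x₀) * side x₀ x₁ z := ⟨_, rfl⟩
  obtain ⟨b, hb⟩ : ∃ b, b = (x₁ - x₀) * side x₀ x₁ w := ⟨_, rfl⟩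
  rw [← ha] at hl
  rw [← hb] at hn
  have hab : 0 < a - b := by linarith
  -- `side` is affine in Klein coordinates, and this parameter is the zero of its interpolation from
  -- `a` to `b`.
  obtain ⟨u, hu, hx, hq⟩ := exists_mem_hypSegment z w (t := a / (a - b)) (by positivity)
    (by rw [div_le_one hab]; linarith)
  refine hF ⟨u, (mem_geodesicLine h).2 ?_, hypConvex_stdPolygon z hz w hw hu⟩
  have e : (x₁ - x₀) * side x₀ x₁ u = (1 - a / (a - b)) * a + a / (a - b) * b := by
    rw [side_eq, hq, hx, ha, hb, side_eq, side_eq]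
    ring
  have e2 : (1 - a / (a - b)) * a + a / (a - b) * b = 0 := by
    field_simp
    ring
  rw [e2] at e
  exact (mul_eq_zero.1 e).resolve_left (sub_ne_zero.2 h.symm)

/-- The ideal triangle with vertices `0`, `1`, `∞`. -/
def triangle : Set ℍ := {z | 0 < z.re ∧ z.re < 1 ∧ z.re < z.re ^ 2 + z.im ^ 2}

theorem stdPolygon_subset_triangle : stdPolygon ⊆ triangle := fun z hz => by
  rw [mem_stdPolygon] at hz
  exact ⟨hz.2.1, by linarith, by linarith⟩

theorem rot_smul_mem_triangle {z : ℍ} (hz : z ∈ triangle) : rot • z ∈ triangle := by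
  obtain ⟨h1, h2, h3⟩ := hz
  have := rot_nsq_pos z
  refine ⟨?_, ?_, ?_⟩
  · rw [re_rot_smul]; exact div_pos (by linarith) this
  · rw [re_rot_smul, div_lt_one this]; linarith
  · rw [nsq_rot_smul, re_rot_smul]; gcongr; linarith

theorem rot_pow_smul_mem_triangle {z : ℍ} (hz : z ∈ triangle) (i : ℕ) :
    rot ^ i • z ∈ triangle := by
  induction i with
  | zero => simpa using hz
  | succ i ih => rw [pow_succ', mul_smul]; exact rot_smul_mem_triangle ih

/-- The three excluded curves are the symmetry axes of the triangle; together they separate the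
three images of `stdPolygon` under powers of `rot`. -/
theorem exists_rot_pow_smul_mem_stdPolygon {z : ℍ} (hz : z ∈ triangle) (h1 : z.re ≠ 1 / 2)
    (h2 : z.re ^ 2 + z.im ^ 2 ≠ 1) (h3 : z.re ^ 2 + z.im ^ 2 ≠ 2 * z.re) :
    ∃ i < 3, ∃ w ∈ stdPolygon, z = rot ^ i • w := by
  obtain ⟨a, b, c⟩ := hz
  have hq := rot_nsq_pos z
  have hN := nsq_pos z
  by_cases hA : 2 * z.re < z.re ^ 2 + z.im ^ 2 ∧ z.re < 1 / 2
  · exact ⟨0, by norm_num, z, mem_stdPolygon.2 ⟨hA.1, a, hA.2⟩, by simp⟩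
  by_cases hB : z.re ^ 2 + z.im ^ 2 < 2 * z.re ∧ z.re ^ 2 + z.im ^ 2 < 1
  · refine ⟨1, by norm_num, rot⁻¹ • z, mem_stdPolygon.2 ⟨?_, ?_, ?_⟩, by simp⟩
    · rw [nsq_rot_inv_smul, re_rot_inv_smul, lt_div_iff₀ hN]
      have : 2 * (1 - z.re / (z.re ^ 2 + z.im ^ 2)) * (z.re ^ 2 + z.im ^ 2) =
        2 * (z.re ^ 2 + z.im ^ 2) - 2 * z.re := by field_simp
      rw [this]; linarith
    · rw [re_rot_inv_smul, sub_pos, div_lt_one hN]; exact c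
    · rw [re_rot_inv_smul, sub_lt_comm, lt_div_iff₀ hN]; linarith
  · have hC : 1 / 2 < z.re ∧ 1 < z.re ^ 2 + z.im ^ 2 := by
      push Not at hA hB
      rcases h3.lt_or_gt with h3 | h3
      · have := lt_of_le_of_ne (hB h3) h2.symm
        exact ⟨by linarith, this⟩
      · have := lt_of_le_of_ne (hA h3) h1.symm
        exact ⟨this, by linarith⟩
    refine ⟨2, by norm_num, rot • z, mem_stdPolygon.2 ⟨?_, ?_, ?_⟩, ?_⟩
    · rw [nsq_rot_smul, re_rot_smul, ← mul_div_assoc]; gcongr; linarith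
    · rw [re_rot_smul]; exact div_pos (by linarith) hq
    · rw [re_rot_smul, div_lt_iff₀ hq]; linarith
    · rw [← mul_smul, ← pow_succ, rot_pow_three]; simp

/-! ## Narrow classes and Moebius orbits -/

section Field

variable {K : Type*} [Field K] {w : K} {γ δ : SL(2, ℤ)}

theorem irr_of_ne {ι ι' : K →+* ℝ} (h : ι' w ≠ ι w) : Irr w := by
  intro c d hcd
  have h1 := congrArg ι hcd
  have h2 := congrArg ι' hcd
  simp only [map_add, map_mul, map_intCast, map_zero] at h1 h2
  have h3 : (c : ℝ) * (ι w - ι' w) = 0 := by linear_combination h1 - h2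
  have hc : (c : ℝ) = 0 := (mul_eq_zero.1 h3).resolve_right (sub_ne_zero.2 h.symm)
  rw [hc, zero_mul, zero_add] at h1
  exact ⟨by exact_mod_cast hc, by exact_mod_cast h1⟩

theorem num_eq_of_mob_eq (hw : Irr w) (h : mob γ w = w) : num γ w = den γ w * w := by
  rw [mob, div_eq_iff (hw.den_ne_zero γ)] at h
  rw [h, mul_comm]

theorem eq_of_den_eq (hw : Irr w) (hγ : mob γ w = w) (hδ : mob δ w = w)
    (h : den γ w = den δ w) : γ = δ := by
  have h1 := num_eq_of_mob_eq hw hγ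
  have h2 := num_eq_of_mob_eq hw hδ
  rw [h, ← h2] at h1
  have a := hw (γ 1 0 - δ 1 0) (γ 1 1 - δ 1 1) (by
    unfold den at h; push_cast; linear_combination h)
  have b := hw (γ 0 0 - δ 0 0) (γ 0 1 - δ 0 1) (by
    unfold num at h1; push_cast; linear_combination h1)
  ext i j
  fin_cases i <;> fin_cases j
  · exact sub_eq_zero.1 b.1
  · exact sub_eq_zero.1 b.2
  · exact sub_eq_zero.1 a.1
  · exact sub_eq_zero.1 a.2

theorem mob_zpow (hw : Irr w) (hγ : mob γ w = w) (k : ℤ) :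
    mob (γ ^ k) w = w ∧ den (γ ^ k) w = den γ w ^ k := by
  have hd := hw.den_ne_zero γ
  have hi : mob γ⁻¹ w = w := by
    conv_lhs => rw [← hγ]
    exact mob_inv_mob hw γ
  have hdi : den γ⁻¹ w = (den γ w)⁻¹ := by
    have := den_mul γ⁻¹ γ hd
    rw [hγ] at this
    refine eq_inv_of_mul_eq_one_left ?_
    rw [← this]
    simp [den]
  induction k using Int.induction_on with
  | zero => simp [den]
  | succ k ih =>
    rw [zpow_add_one, zpow_add_one₀ hd, mob_mul _ _ hd, den_mul _ _ hd, hγ, ih.2]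
    exact ⟨ih.1, rfl⟩
  | pred k ih =>
    have hd' := hw.den_ne_zero γ⁻¹
    rw [zpow_sub_one, zpow_sub_one₀ hd, mob_mul _ _ hd', den_mul _ _ hd', hi, hdi, ih.2]
    exact ⟨ih.1, rfl⟩

end Field

section NumberField

variable {K : Type*} [Field K] [NumberField K]

/-- The two lattices differ by a totally positive factor, so the bases are related by an integral
matrix of determinant `±1`. Total positivity and the common ordering of conjugates make the
determinant positive. -/
theorem exists_mob_of_represents {ι ι' : K →+* ℝ} {A : NarrowClassGroup K} {w v : K}
    (hw : Represents ι ι' A w) (hv : Represents ι ι' A v) : ∃ γ : SL(2, ℤ), v = mob γ w := by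
  have hirr := irr_of_ne hw.1.ne
  obtain ⟨hw1, I, hI, hIm⟩ := hw
  obtain ⟨hv1, J, hJ, hJm⟩ := hv
  have hmem := QuotientGroup.eq.1 (hI.trans hJ.symm)
  obtain ⟨a, ha, haI⟩ := hmem
  have hmul : ∀ x : K, x ∈ (J : FractionalIdeal (𝓞 K)⁰ K) ↔
      ∃ y ∈ (I : FractionalIdeal (𝓞 K)⁰ K), x = (a : K) * y := by
    intro x
    have : (J : FractionalIdeal (𝓞 K)⁰ K) = FractionalIdeal.spanSingleton (𝓞 K)⁰ (a : K) *
        (I : FractionalIdeal (𝓞 K)⁰ K) := by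
      rw [← coe_toPrincipalIdeal, haI]
      simp [mul_comm]
    rw [this, FractionalIdeal.mem_singleton_mul]
  simp only [hIm, hJm] at hmul
  obtain ⟨_, ⟨p, q, rfl⟩, h1⟩ := (hmul v).1 ⟨1, 0, by simp⟩
  obtain ⟨_, ⟨r, s, rfl⟩, h2⟩ := (hmul 1).1 ⟨0, 1, by simp⟩
  obtain ⟨p', q', h3⟩ := (hmul (a * w)).2 ⟨w, ⟨1, 0, by simp⟩, rfl⟩
  obtain ⟨r', s', h4⟩ := (hmul a).2 ⟨1, ⟨0, 1, by simp⟩, by simp⟩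
  have ha0 : (a : K) ≠ 0 := a.ne_zero
  have e1 := hirr (p' * p + q' * r - 1) (p' * q + q' * s) (by
    refine mul_left_cancel₀ ha0 ?_
    push_cast
    linear_combination -h3 - p' * h1 - q' * h2)
  have e2 := hirr (r' * p + s' * r) (r' * q + s' * s - 1) (by
    refine mul_left_cancel₀ ha0 ?_
    push_cast
    linear_combination -h4 - r' * h1 - s' * h2)
  have hdet : (p' * s' - q' * r') * (p * s - q * r) = 1 := by
    have a1 : p' * p + q' * r = 1 := by linarith [e1.1]
    have a2 : r' * q + s' * s = 1 := by linarith [e2.2]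
    have a3 := e1.2
    linear_combination (r' * q + s' * s) * a1 + a2 - (r' * p + s' * r) * a3
  have hpos : 0 < p * s - q * r := by
    have k1 := congrArg ι h1
    have k2 := congrArg ι h2
    have k3 := congrArg ι' h1
    have k4 := congrArg ι' h2
    simp only [map_add, map_mul, map_intCast, map_one] at k1 k2 k3 k4
    -- Both conjugate differences are positive and so is the norm of `a`; this identity transfers
    -- the sign to the determinant.
    have key : ι v - ι' v = ι a * ι' a * (p * s - q * r) * (ι w - ι' w) := by
      linear_combination k1 * (ι' a * (r * ι' w + s)) - k3 * (ι a * (r * ι w + s))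
        + ι v * k4 - ι' v * k2
    have hl : 0 < ι a * ι' a * (p * s - q * r) * (ι w - ι' w) := by rw [← key]; linarith
    have h5 : 0 < ι a * ι' a := mul_pos (ha ι) (ha ι')
    have h6 := (pos_iff_pos_of_mul_pos hl).2 (by linarith)
    have h7 : (0 : ℝ) < p * s - q * r := (mul_pos_iff_of_pos_left h5).1 h6
    exact_mod_cast h7
  have hone : p * s - q * r = 1 := by
    rcases Int.isUnit_iff.1 (IsUnit.of_mul_eq_one_right _ hdet) with h | h
    · exact h
    · omega
  refine ⟨⟨!![p, q; r, s], by simpa [Matrix.det_fin_two] using hone⟩, ?_⟩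
  have hrs : (r : K) * w + s ≠ 0 := fun h => by simp [h] at h2
  simp only [mob, num, den, Matrix.of_apply, Matrix.cons_val', Matrix.cons_val_zero,
    Matrix.cons_val_one, Matrix.cons_val_fin_one]
  rw [eq_div_iff hrs]
  linear_combination h1 * (r * w + s) - (p * w + q) * h2

theorem norm_eq_mul (hK : Module.finrank ℚ K = 2) {ι ι' : K →+* ℝ} (hι : ι ≠ ι') (x : K) :
    ((Algebra.norm ℚ x : ℚ) : ℝ) = ι x * ι' x := by
  classical
  let f : (K →+* ℝ) → (K →ₐ[ℚ] ℂ) := fun φ => (Complex.ofRealHom.comp φ).toRatAlgHom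
  have hf : f ι ≠ f ι' := fun h => hι (by
    ext y
    have := DFunLike.congr_fun h y
    simpa [f] using this)
  have hcard : Fintype.card (K →ₐ[ℚ] ℂ) = 2 := by rw [AlgHom.card, hK]
  have huniv : (Finset.univ : Finset (K →ₐ[ℚ] ℂ)) = {f ι, f ι'} := by
    symm
    refine Finset.eq_univ_of_card _ ?_
    rw [Finset.card_pair hf, hcard]
  have := Algebra.norm_eq_prod_embeddings ℚ ℂ x
  rw [huniv, Finset.prod_pair hf] at this
  have h2 : ((((Algebra.norm ℚ x : ℚ) : ℝ)) : ℂ) = ((ι x * ι' x : ℝ) : ℂ) := by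
    simpa [f] using this
  exact_mod_cast h2

/-- Dividing by a suitable power of `ε` moves the unit into `[1, ε)`, where minimality leaves only
`1`. -/
theorem eq_zpow_of_norm_pos {ι : K →+* ℝ} {ε η : (𝓞 K)ˣ} (hε : IsPositiveFundamentalUnit ι ε)
    (hη : 0 < Algebra.norm ℚ ((η : 𝓞 K) : K)) (hpos : 0 < ι ((η : 𝓞 K) : K)) :
    ∃ k : ℤ, η = ε ^ k := by
  obtain ⟨⟨ε', he, h1, hn⟩, hmin⟩ := hε
  obtain rfl : ε = ε' := Units.ext (RingOfIntegers.coe_injective (ι.injective he))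
  obtain ⟨k, hk1, hk2⟩ := exists_mem_Ico_zpow hpos h1
  let f : (𝓞 K)ˣ →* K := (algebraMap (𝓞 K) K : (𝓞 K) →* K).comp (Units.coeHom (𝓞 K))
  have hf : ∀ u : (𝓞 K)ˣ, f u = ((u : 𝓞 K) : K) := fun u => rfl
  have hfz : ∀ (u : (𝓞 K)ˣ) (k : ℤ), f (u ^ k) = f u ^ k := fun u k => map_zpow' f (fun u => by
    refine eq_inv_of_mul_eq_one_left ?_
    rw [← map_mul]; simp) u k
  refine ⟨k, ?_⟩
  have hε0 : 0 < ι (f ε) := by rw [hf]; linarith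
  have hval : ι (f (η * ε ^ (-k))) = ι (f η) * ι (f ε) ^ (-k) := by
    rw [map_mul, hfz, map_mul, map_zpow₀]
  have hge : 1 ≤ ι (f (η * ε ^ (-k))) := by
    rw [hval, zpow_neg, ← div_eq_mul_inv, one_le_div (by positivity)]
    exact hk1
  have hlt : ι (f (η * ε ^ (-k))) < ι (f ε) := by
    rw [hval, zpow_neg, ← div_eq_mul_inv, div_lt_iff₀ (by positivity), ← zpow_one_add₀ hε0.ne',
      add_comm]
    exact hk2
  rcases hge.eq_or_lt with h | h
  · have h5 : f (η * ε ^ (-k)) = 1 := ι.injective (by rw [← h, map_one])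
    have : η * ε ^ (-k) = 1 := Units.ext (RingOfIntegers.coe_injective (h5.trans (map_one _).symm))
    rw [zpow_neg] at this
    exact mul_inv_eq_one.1 this
  · exfalso
    refine absurd (hmin ⟨η * ε ^ (-k), rfl, h, ?_⟩) (not_le.2 hlt)
    have : Algebra.norm ℚ (f (η * ε ^ (-k))) =
        Algebra.norm ℚ (f η) * Algebra.norm ℚ (f ε) ^ (-k) := by
      rw [map_mul, map_mul]
      congr 1
      exact map_zpow' ((Algebra.norm ℚ).comp f) (fun u => by
        refine eq_inv_of_mul_eq_one_left ?_
        rw [← map_mul]; simp) ε (-k)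
    change 0 < Algebra.norm ℚ (f (η * ε ^ (-k)))
    rw [this]
    exact mul_pos hη (zpow_pos hn _)

/-- A matrix fixing `w` has `(w, 1)` as eigenvector with eigenvalue `den δ w`, a unit of norm one
that determines the matrix. So the stabilizer embeds in the units of positive norm; the sign
accounts for negative eigenvalues. -/
theorem eq_zpow_of_mob_eq_self (hK : Module.finrank ℚ K = 2) {ι ι' : K →+* ℝ} (hι : ι ≠ ι')
    {w : K} (hw : ι' w ≠ ι w) {ε : (𝓞 K)ˣ} (hε : IsPositiveFundamentalUnit ι ε)
    {γ δ : SL(2, ℤ)} (hγ : mob γ w = w) (hγε : den γ w = ((ε : 𝓞 K) : K)) (hδ : mob δ w = w) :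
    ∃ k : ℤ, δ = γ ^ k ∨ δ = -γ ^ k := by
  have hirr := irr_of_ne hw
  have main : ∀ δ : SL(2, ℤ), mob δ w = w → 0 < ι (den δ w) → ∃ k : ℤ, δ = γ ^ k := by
    intro δ hδ hpos
    have hnum := num_eq_of_mob_eq hirr hδ
    have hdet := det_eq_cast K δ
    -- Characteristic equation of the matrix: it gives integrality of the eigenvalue and its inverse
    -- at the same time.
    have hquad : den δ w * ((δ 0 0 + δ 1 1 : ℤ) - den δ w) = 1 := by
      unfold num den at *
      push_cast
      linear_combination hdet - δ 1 0 * hnum * (-1)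
    have hint : IsIntegral ℤ (den δ w) := by
      refine ⟨Polynomial.X ^ 2 - Polynomial.C (δ 0 0 + δ 1 1) * Polynomial.X + 1, by monicity!, ?_⟩
      simp only [Polynomial.eval₂_add, Polynomial.eval₂_sub, Polynomial.eval₂_mul,
        Polynomial.eval₂_pow, Polynomial.eval₂_X, Polynomial.eval₂_C, Polynomial.eval₂_one]
      rw [eq_intCast]
      linear_combination -hquad
    let η₀ : 𝓞 K := ⟨den δ w, hint⟩
    have hη₀ : η₀ * (((δ 0 0 + δ 1 1 : ℤ) : 𝓞 K) - η₀) = 1 := by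
      apply RingOfIntegers.coe_injective
      simpa using! hquad
    let η : (𝓞 K)ˣ := Units.mkOfMulEqOne _ _ hη₀
    have hηv : ((η : 𝓞 K) : K) = den δ w := rfl
    have hnorm : 0 < Algebra.norm ℚ ((η : 𝓞 K) : K) := by
      have h1 := norm_eq_mul hK hι (den δ w)
      have h2 := mob_sub_mob δ ((hirr.map ι).den_ne_zero δ) ((hirr.map ι').den_ne_zero δ)
      rw [← map_mob, ← map_mob, hδ, ← map_den, ← map_den, ← h1] at h2
      have h3 : ι w - ι' w ≠ 0 := sub_ne_zero.2 hw.symm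
      have h4 : ((Algebra.norm ℚ (den δ w) : ℚ) : ℝ) ≠ 0 := by
        intro h
        rw [h, div_zero] at h2
        exact h3 h2
      rw [eq_div_iff h4, mul_right_eq_self₀, or_iff_left h3] at h2
      rw [hηv]
      have : Algebra.norm ℚ (den δ w) = 1 := by exact_mod_cast h2
      rw [this]; exact one_pos
    obtain ⟨k, hk⟩ := eq_zpow_of_norm_pos hε hnorm hpos
    refine ⟨k, eq_of_den_eq hirr hδ (mob_zpow hirr hγ k).1 ?_⟩
    rw [(mob_zpow hirr hγ k).2, hγε, ← hηv, hk]
    exact map_zpow' ((algebraMap (𝓞 K) K : (𝓞 K) →* K).comp (Units.coeHom (𝓞 K))) (fun u => by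
      refine eq_inv_of_mul_eq_one_left ?_
      rw [← map_mul]; simp) ε k
  have hne : ι (den δ w) ≠ 0 := (map_ne_zero ι).2 (hirr.den_ne_zero δ)
  rcases hne.lt_or_gt with h | h
  · obtain ⟨k, hk⟩ := main (-δ) (by rw [mob_neg, hδ]) (by
      have : den (-δ) w = - den δ w := by simp [den]; ring
      rw [this, map_neg]; linarith)
    exact ⟨k, Or.inr (by rw [← hk, neg_neg])⟩
  · obtain ⟨k, hk⟩ := main δ hδ h
    exact ⟨k, Or.inl hk⟩

end NumberField

/-! ## Minus continued fractions -/

/-- The matrix of `x ↦ 1 / (a - x)`. -/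
def stepMat (a : ℤ) : SL(2, ℤ) := ⟨!![0, 1; -1, a], by simp [Matrix.det_fin_two]⟩

theorem mob_stepMat {F : Type*} [Field F] (a : ℤ) (x : F) : mob (stepMat a) x = 1 / (a - x) := by
  simp [mob, num, den, stepMat]
  ring

theorem Irr.ne_intCast {F : Type*} [Field F] {x : F} (hx : Irr x) (m : ℤ) : x ≠ m := fun h => by
  have := hx 1 (-m) (by push_cast; rw [h]; ring)
  exact one_ne_zero this.1

theorem Irr.lt_ceil {x : ℝ} (hx : Irr x) : x < ⌈x⌉ :=
  lt_of_le_of_ne (Int.le_ceil x) (hx.ne_intCast _)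

theorem ceil_eq_of_lt {x : ℝ} {a : ℤ} (h1 : (a : ℝ) - 1 < x) (h2 : x < a) : ⌈x⌉ = a :=
  Int.ceil_eq_iff.2 ⟨h1, h2.le⟩

theorem minusQuotient_add (x : ℝ) (i j : ℕ) :
    minusQuotient x (i + j) = minusQuotient (minusQuotient x i) j := by
  induction j with
  | zero => rfl
  | succ j ih => rw [← add_assoc, minusQuotient, minusQuotient, ih]

theorem minusQuotient_one (x : ℝ) : minusQuotient x 1 = 1 / (⌈x⌉ - x) := rfl

theorem Irr.minusQuotient {x : ℝ} (hx : Irr x) (k : ℕ) : Irr (minusQuotient x k) := by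
  induction k with
  | zero => exact hx
  | succ k ih => rw [PaintLeft.minusQuotient, ← mob_stepMat]; exact ih.mob _

theorem one_lt_minusQuotient {x : ℝ} (hx : Irr x) (k : ℕ) : 1 < minusQuotient x (k + 1) := by
  have h := hx.minusQuotient k
  have h1 := h.lt_ceil
  have h2 := Int.ceil_lt_add_one (PaintLeft.minusQuotient x k)
  rw [minusQuotient, one_lt_div (by linarith)]
  linarith

/-- A digit `2` lowers `1 / (x - 1)` by one, while this quantity stays positive, so the digits
cannot all be `2` from some point on. -/
theorem exists_three_le_minusDigit {x : ℝ} (hx : Irr x) (m : ℕ) :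
    ∃ k, m ≤ k ∧ 3 ≤ minusDigit x (k + 1) := by
  by_contra hcon
  push Not at hcon
  have hdig : ∀ k, m ≤ k → ⌈minusQuotient x (k + 1)⌉ = 2 := fun k hk => by
    have h1 := hcon k hk
    have h2 : 1 < ⌈minusQuotient x (k + 1)⌉ := Int.lt_ceil.2 (by
      exact_mod_cast one_lt_minusQuotient hx k)
    unfold minusDigit at h1
    omega
  have hstep : ∀ i : ℕ, 1 / (minusQuotient x (m + i + 1) - 1) =
      1 / (minusQuotient x (m + 1) - 1) - i := by
    intro i
    induction i with
    | zero => simp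
    | succ i ih =>
      have h1 := one_lt_minusQuotient hx (m + i)
      have h2 := (hx.minusQuotient (m + i + 1)).lt_ceil
      have h3 := hdig (m + i) (by omega)
      rw [h3] at h2
      have h4 : minusQuotient x (m + (i + 1) + 1) = 1 / (2 - minusQuotient x (m + i + 1)) := by
        rw [show m + (i + 1) + 1 = (m + i + 1) + 1 by ring, minusQuotient, h3]
        norm_num
      push_cast at h2 ⊢
      rw [← sub_sub, ← ih, h4]
      have h5 : minusQuotient x (m + i + 1) - 1 ≠ 0 := by linarith
      have h6 : 2 - minusQuotient x (m + i + 1) ≠ 0 := by linarith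
      have h7 : 1 / (2 - minusQuotient x (m + i + 1)) - 1 =
        (minusQuotient x (m + i + 1) - 1) / (2 - minusQuotient x (m + i + 1)) := by
        field_simp; ring
      rw [h7]
      field_simp
      ring
  obtain ⟨i, hi⟩ := exists_nat_gt (1 / (minusQuotient x (m + 1) - 1))
  have h1 := one_lt_minusQuotient hx (m + i)
  have h2 : 0 < 1 / (minusQuotient x (m + i + 1) - 1) := by
    apply one_div_pos.2; linarith
  rw [hstep] at h2
  linarith

/-- An irrational number is determined by the digits of its minus continued fraction. -/
theorem eq_of_minusDigit_eq {x y : ℝ} (hx : Irr x) (hy : Irr y)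
    (h : ∀ k, minusDigit x k = minusDigit y k) : x = y := by
  by_contra hne
  -- With a common digit, one step multiplies the distance by the product of the new quotients. That
  -- factor exceeds `1` always and is at least `4` infinitely often, but numbers with equal ceilings
  -- are less than `1` apart.
  have hd : ∀ k, |minusQuotient x (k + 1) - minusQuotient y (k + 1)| =
      |minusQuotient x k - minusQuotient y k| *
        (minusQuotient x (k + 1) * minusQuotient y (k + 1)) := by
    intro k
    have h1 := one_lt_minusQuotient hx k
    have h2 := one_lt_minusQuotient hy k
    have h3 := (hx.minusQuotient k).lt_ceil
    have h4 := (hy.minusQuotient k).lt_ceil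
    have h5 := h k
    unfold minusDigit at h5
    rw [← abs_of_pos (show 0 < minusQuotient x (k + 1) * minusQuotient y (k + 1) by positivity),
      ← abs_mul]
    congr 1
    rw [minusQuotient, minusQuotient, ← h5]
    rw [← h5] at h4
    have h6 : (⌈minusQuotient x k⌉ : ℝ) - minusQuotient x k ≠ 0 := by linarith
    have h7 : (⌈minusQuotient x k⌉ : ℝ) - minusQuotient y k ≠ 0 := by linarith
    field_simp
    ring
  have hlt : ∀ k, |minusQuotient x k - minusQuotient y k| < 1 := by
    intro k
    have h5 := h k
    unfold minusDigit at h5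
    have h1 := Int.le_ceil (minusQuotient x k)
    have h2 := Int.ceil_lt_add_one (minusQuotient x k)
    have h3 := Int.le_ceil (minusQuotient y k)
    have h4 := Int.ceil_lt_add_one (minusQuotient y k)
    rw [h5] at h1 h2
    rw [abs_lt]
    constructor <;> linarith
  have hmono : ∀ k, |minusQuotient x k - minusQuotient y k| ≤
      |minusQuotient x (k + 1) - minusQuotient y (k + 1)| := by
    intro k
    rw [hd]
    refine le_mul_of_one_le_right (abs_nonneg _) ?_
    nlinarith [one_lt_minusQuotient hx k, one_lt_minusQuotient hy k]
  have hmono' : Monotone fun k => |minusQuotient x k - minusQuotient y k| :=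
    monotone_nat_of_le_succ hmono
  have hpos : 0 < |x - y| := abs_pos.2 (sub_ne_zero.2 hne)
  have hgrow : ∀ i : ℕ, ∃ k, 4 ^ i * |x - y| ≤ |minusQuotient x k - minusQuotient y k| := by
    intro i
    induction i with
    | zero => exact ⟨0, by simp [minusQuotient]⟩
    | succ i ih =>
      obtain ⟨m, hm⟩ := ih
      obtain ⟨k, hk, h3⟩ := exists_three_le_minusDigit hx m
      refine ⟨k + 1, ?_⟩
      have h3' := h3
      rw [h] at h3'
      unfold minusDigit at h3 h3'
      have a : (2 : ℝ) < minusQuotient x (k + 1) := by exact_mod_cast Int.lt_ceil.1 h3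
      have b : (2 : ℝ) < minusQuotient y (k + 1) := by exact_mod_cast Int.lt_ceil.1 h3'
      rw [hd, pow_succ]
      have h4 := hmono' hk
      have h5 : 4 ≤ minusQuotient x (k + 1) * minusQuotient y (k + 1) := by nlinarith
      calc 4 ^ i * 4 * |x - y| = (4 ^ i * |x - y|) * 4 := by ring
        _ ≤ _ := mul_le_mul (hm.trans h4) h5 (by norm_num) (abs_nonneg _)
  obtain ⟨i, hi⟩ := pow_unbounded_of_one_lt (1 / |x - y|) (by norm_num : (1 : ℝ) < 4)
  obtain ⟨k, hk⟩ := hgrow i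
  have := hlt k
  rw [div_lt_iff₀ hpos] at hi
  linarith

/-- Two numbers whose minus continued fractions have a common complete quotient. -/
def TailEquiv (x y : ℝ) : Prop := ∃ i j, minusQuotient x i = minusQuotient y j

theorem TailEquiv.symm {x y : ℝ} (h : TailEquiv x y) : TailEquiv y x := by
  obtain ⟨i, j, h⟩ := h
  exact ⟨j, i, h.symm⟩

theorem TailEquiv.trans {x y z : ℝ} (h : TailEquiv x y) (h' : TailEquiv y z) : TailEquiv x z := by
  obtain ⟨i, j, h⟩ := h
  obtain ⟨k, l, h'⟩ := h'
  refine ⟨i + k, l + j, ?_⟩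
  rw [minusQuotient_add, h, ← minusQuotient_add, add_comm j, minusQuotient_add, h',
    minusQuotient_add]

theorem tailEquiv_add_one (x : ℝ) : TailEquiv x (x + 1) :=
  ⟨1, 1, by rw [minusQuotient_one, minusQuotient_one, Int.ceil_add_one]; push_cast; ring_nf⟩

theorem tailEquiv_neg_inv_of_one_lt {x : ℝ} (hx : 1 < x) : TailEquiv x (-1 / x) := by
  refine ⟨0, 1, ?_⟩
  have h1 : ⌈-1 / x⌉ = 0 := by
    rw [neg_div]
    refine ceil_eq_of_lt ?_ ?_
    · have := (div_lt_one (by linarith)).2 hx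
      push_cast; linarith
    · have : 0 < 1 / x := by positivity
      push_cast; linarith
  rw [minusQuotient_one, h1]
  simp [minusQuotient, neg_div]

theorem tailEquiv_neg_inv_of_pos {x : ℝ} (hirr : Irr x) (hx : 0 < x) : TailEquiv x (-1 / x) := by
  -- For `x < 1`, the passage from `x` to `x / (1 - x)` lowers `1 / x` by one and changes neither
  -- the tail of `x` nor, up to a unit shift, that of `-1 / x`; the induction ends at `x > 1`.
  have main : ∀ n : ℕ, ∀ x : ℝ, Irr x → 0 < x → 1 / x < n → TailEquiv x (-1 / x) := by
    intro n
    induction n with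
    | zero =>
      intro x _ hx h
      have : 0 < 1 / x := by positivity
      simp only [Nat.cast_zero] at h
      linarith
    | succ n ih =>
      intro x hirr hx h
      rcases lt_or_ge 1 x with h1 | h1
      · exact tailEquiv_neg_inv_of_one_lt h1
      have h1 : x < 1 := lt_of_le_of_ne h1 (by simpa using hirr.ne_intCast 1)
      have hx0 : 0 < 1 - x := by linarith
      have e1 : TailEquiv x (1 / (1 - x)) := by
        have hc : ⌈x⌉ = 1 := ceil_eq_of_lt (by push_cast; linarith) (by push_cast; linarith)
        exact ⟨1, 0, by rw [minusQuotient_one, hc]; simp [minusQuotient]⟩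
      have hs : 1 / (1 - x) - 1 = x / (1 - x) := by field_simp; ring
      have e2 : TailEquiv (x / (1 - x)) (1 / (1 - x)) := by
        have := tailEquiv_add_one (x / (1 - x))
        rwa [← hs, sub_add_cancel, hs] at this
      have e3 : TailEquiv (x / (1 - x)) (-1 / (x / (1 - x))) := by
        refine ih _ ?_ (by positivity) ?_
        · have := hirr.mob ⟨!![1, 0; -1, 1], by simp [Matrix.det_fin_two]⟩
          simpa [mob, num, den, neg_add_eq_sub] using this
        · have : 1 / (x / (1 - x)) = 1 / x - 1 := by field_simp
          rw [this]; push_cast at h; linarith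
      have e4 : TailEquiv (-1 / x) (-1 / (x / (1 - x))) := by
        have := tailEquiv_add_one (-1 / x)
        have e : -1 / x + 1 = -1 / (x / (1 - x)) := by field_simp; ring
        rwa [e] at this
      exact ((e1.trans e2.symm).trans e3).trans e4.symm
  obtain ⟨n, hn⟩ := exists_nat_gt (1 / x)
  exact main n x hirr hx hn

/-- Serret's theorem for minus continued fractions. -/
theorem tailEquiv_mob (γ : SL(2, ℤ)) {x : ℝ} (hx : Irr x) : TailEquiv x (mob γ x) := by
  have hγ : γ ∈ Subgroup.closure {ModularGroup.S, ModularGroup.T} := by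
    rw [SpecialLinearGroup.SL2Z_generators]; trivial
  induction hγ using Subgroup.closure_induction generalizing x with
  | mem γ h =>
    rcases h with rfl | rfl
    · have e : mob ModularGroup.S x = -1 / x := by simp [mob, num, den, ModularGroup.S]
      rw [e]
      rcases lt_or_gt_of_ne (show x ≠ 0 by simpa using hx.ne_intCast 0) with h | h
      · have h' : 0 < -1 / x := div_pos_of_neg_of_neg (by norm_num) h
        have h2 := tailEquiv_neg_inv_of_pos (e ▸ hx.mob _) h'
        have e' : -1 / (-1 / x) = x := by field_simp
        rw [e'] at h2
        exact h2.symm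
      · exact tailEquiv_neg_inv_of_pos hx h
    · have e : mob ModularGroup.T x = x + 1 := by simp [mob, num, den, ModularGroup.T]
      rw [e]
      exact tailEquiv_add_one x
  | one => rw [mob_one]; exact ⟨0, 0, rfl⟩
  | mul γ δ _ _ h1 h2 =>
    rw [mob_mul _ _ (hx.den_ne_zero δ)]
    exact (h2 hx).trans (h1 (hx.mob δ))
  | inv γ _ h =>
    have := h (hx.mob γ⁻¹)
    rw [mob_mob_inv hx] at this
    exact this.symm

/-! ## Reduced numbers and cycles -/

section Cycle

variable {K : Type*} [Field K] (ι ι' : K →+* ℝ)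

/-- The step `x ↦ 1 / (⌈x⌉ - x)` of the minus continued fraction, on a real field. -/
def cfStep (x : K) : K := 1 / ((⌈ι x⌉ : K) - x)

/-- Reduced elements for the minus continued fraction. -/
def Reduced (x : K) : Prop := 0 < ι' x ∧ ι' x < 1 ∧ 1 < ι x

variable {ι ι'}

theorem cfStep_eq_mob (x : K) : cfStep ι x = mob (stepMat ⌈ι x⌉) x := (mob_stepMat _ _).symm

theorem map_cfStep_iterate (x : K) (k : ℕ) :
    ι ((cfStep ι)^[k] x) = minusQuotient (ι x) k := by
  induction k with
  | zero => rfl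
  | succ k ih => rw [Function.iterate_succ_apply', minusQuotient, ← ih]; simp [cfStep]

theorem exists_cfStep_iterate_eq_mob {x : K} (hx : Irr x) (k : ℕ) :
    ∃ γ : SL(2, ℤ), (cfStep ι)^[k] x = mob γ x := by
  induction k with
  | zero => exact ⟨1, by simp⟩
  | succ k ih =>
    obtain ⟨γ, h⟩ := ih
    rw [Function.iterate_succ_apply', h, cfStep_eq_mob, ← mob_mul _ _ (hx.den_ne_zero γ)]
    exact ⟨_, rfl⟩

theorem conj_lt_cfStep {x : K} (h : ι' x < ι x) : ι' (cfStep ι x) < ι (cfStep ι x) ∧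
    0 < ι' (cfStep ι x) := by
  have hirr := irr_of_ne h.ne
  have h1 := (hirr.map ι).lt_ceil
  simp only [cfStep, map_div₀, map_one, map_sub, map_intCast]
  have h2 : 0 < (⌈ι x⌉ : ℝ) - ι x := by linarith
  refine ⟨one_div_lt_one_div_of_lt h2 (by linarith), one_div_pos.2 (by linarith)⟩

theorem Reduced.cfStep {x : K} (h : Reduced ι ι' x) : Reduced ι ι' (cfStep ι x) := by
  obtain ⟨h1, h2, h3⟩ := h
  have hirr := irr_of_ne (h2.trans h3).ne
  refine ⟨(conj_lt_cfStep (h2.trans h3)).2, ?_, ?_⟩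
  · have h4 : (1 : ℤ) < ⌈ι x⌉ := Int.lt_ceil.2 (by exact_mod_cast h3)
    have h5 : (2 : ℝ) ≤ ⌈ι x⌉ := by exact_mod_cast Int.add_one_le_of_lt h4
    simp only [PaintLeft.cfStep, map_div₀, map_one, map_sub, map_intCast]
    rw [div_lt_one (by linarith)]
    linarith
  · exact (map_cfStep_iterate x 1).symm ▸ one_lt_minusQuotient (hirr.map ι) 0

/-- The conjugate lies in `(0, 1)`, so the image determines the lost digit through its conjugate. -/
theorem Reduced.cfStep_injective {x y : K} (hx : Reduced ι ι' x) (hy : Reduced ι ι' y)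
    (h : PaintLeft.cfStep ι x = PaintLeft.cfStep ι y) : x = y := by
  unfold PaintLeft.cfStep at h
  have h1 := congrArg (fun t => 1 / t) h
  simp only [one_div_one_div] at h1
  have h2 := congrArg ι' h1
  simp only [map_sub, map_intCast] at h2
  have h3 : ⌈ι x⌉ = ⌈ι y⌉ := by
    have a : ((⌈ι x⌉ - 1 : ℤ) : ℝ) < (⌈ι y⌉ : ℤ) := by push_cast; linarith [hx.2.1, hy.1]
    have b : ((⌈ι y⌉ - 1 : ℤ) : ℝ) < (⌈ι x⌉ : ℤ) := by push_cast; linarith [hy.2.1, hx.1]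
    have := Int.cast_lt.1 a
    have := Int.cast_lt.1 b
    omega
  rw [h3] at h1
  exact sub_right_injective h1

theorem eq_iterate_of_iterate_eq {x y : K} (hx : Reduced ι ι' x) (hy : Reduced ι ι' y) {i j : ℕ}
    (hij : i ≤ j) (h : (cfStep ι)^[i] x = (cfStep ι)^[j] y) : x = (cfStep ι)^[j - i] y := by
  have hred : ∀ k, Reduced ι ι' ((cfStep ι)^[k] y) := fun k => by
    induction k with
    | zero => exact hy
    | succ k ih => rw [Function.iterate_succ_apply']; exact ih.cfStep
  induction i generalizing x with
  | zero => exact h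
  | succ i ih =>
    rw [Function.iterate_succ_apply] at h
    have := ih hx.cfStep (by omega) h
    rw [show j - i = (j - (i + 1)) + 1 by omega, Function.iterate_succ_apply'] at this
    exact hx.cfStep_injective (hred _) this

/-- A cycle of reduced numbers, indexed by the integers with period `ℓ`. -/
structure ReducedCycle (ι ι' : K →+* ℝ) (n : ℕ → ℤ) (ℓ : ℕ) (W : ℤ → K) : Prop where
  pos : 0 < ℓ
  reduced : ∀ k, Reduced ι ι' (W k)
  ceil : ∀ k, ⌈ι (W k)⌉ = n (k % ℓ).toNat
  step : ∀ k, W (k + 1) = 1 / ((n (k % ℓ).toNat : K) - W k)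
  periodic : ∀ k, W (k + ℓ) = W k
  injective : ∀ i j : ℤ, 0 ≤ i → i < ℓ → 0 ≤ j → j < ℓ → W i = W j → i = j
  complete : ∀ u, (∃ γ : SL(2, ℤ), u = mob γ (W 0)) → Reduced ι ι' u →
    ∃ k : ℤ, 0 ≤ k ∧ k < ℓ ∧ u = W k

/-- A complete quotient with periodic digits is itself periodic, since digits determine an
irrational number, and periodicity forces it to be reduced. Completeness of the cycle is Serret's
theorem combined with the injectivity of the step on reduced numbers. -/
theorem exists_reducedCycle [NumberField K] {A : NarrowClassGroup K} {n : ℕ → ℤ} {ℓ : ℕ}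
    (hn : IsCycle ι ι' A n ℓ) : ∃ W : ℤ → K, ReducedCycle ι ι' n ℓ W ∧
      ∃ w, Represents ι ι' A w ∧ ∃ γ : SL(2, ℤ), W 0 = mob γ w := by
  obtain ⟨w, hw, ⟨N, hN⟩, ⟨hℓ, hper⟩, hmin⟩ := hn
  have hirrw := irr_of_ne hw.1.ne
  obtain ⟨v, hv⟩ : ∃ v, v = (cfStep ι)^[N] w := ⟨_, rfl⟩
  obtain ⟨γ, hγ⟩ := exists_cfStep_iterate_eq_mob (ι := ι) hirrw N
  rw [← hv] at hγ
  have hlt : ∀ k (x : K), ι' x < ι x → ι' ((cfStep ι)^[k] x) < ι ((cfStep ι)^[k] x) := by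
    intro k x hx
    induction k with
    | zero => exact hx
    | succ k ih => rw [Function.iterate_succ_apply']; exact (conj_lt_cfStep ih).1
  have hvlt : ι' v < ι v := hv ▸ hlt N w hw.1
  have hirr : ∀ k, Irr ((cfStep ι)^[k] v) := fun k => irr_of_ne (hlt k v hvlt).ne
  have hdig : ∀ j, n j = ⌈ι ((cfStep ι)^[j] v)⌉ := by
    intro j
    rw [hN, minusDigit, hv, ← Function.iterate_add_apply, map_cfStep_iterate, add_comm]
  have heq : ∀ i j, (∀ t, n (i + t) = n (j + t)) → (cfStep ι)^[i] v = (cfStep ι)^[j] v := by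
    intro i j h
    apply ι.injective
    refine eq_of_minusDigit_eq ((hirr i).map ι) ((hirr j).map ι) fun k => ?_
    have := h k
    rw [hdig, hdig, add_comm i, add_comm j, Function.iterate_add_apply,
      Function.iterate_add_apply, map_cfStep_iterate, map_cfStep_iterate (x := (cfStep ι)^[j] v)]
      at this
    exact this
  have hpv : ∀ j, (cfStep ι)^[j + ℓ] v = (cfStep ι)^[j] v := fun j =>
    heq _ _ fun t => by rw [show j + ℓ + t = (j + t) + ℓ by ring]; exact hper _
  have hpv' : ∀ i j, (cfStep ι)^[j + i * ℓ] v = (cfStep ι)^[j] v := fun i j => by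
    induction i with
    | zero => simp
    | succ i ih => rw [show j + (i + 1) * ℓ = (j + i * ℓ) + ℓ by ring, hpv, ih]
  have hone : ∀ j, 1 < ι ((cfStep ι)^[j] v) := by
    intro j
    rw [← hpv, map_cfStep_iterate, show j + ℓ = (j + ℓ - 1) + 1 by have : 0 < ℓ := hℓ; omega]
    exact one_lt_minusQuotient ((hirr 0).map ι) _
  have htwo : ∀ j, (2 : ℝ) ≤ n j := by
    intro j
    have : (2 : ℤ) ≤ n j := by
      have h : (1 : ℤ) < ⌈ι ((cfStep ι)^[j] v)⌉ := Int.lt_ceil.2 (by exact_mod_cast hone j)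
      rw [hdig]; omega
    exact_mod_cast this
  have hposc : ∀ j, 0 < ι' ((cfStep ι)^[j] v) := by
    intro j
    rw [← hpv, show j + ℓ = (j + ℓ - 1) + 1 by have : 0 < ℓ := hℓ; omega,
      Function.iterate_succ_apply']
    exact (conj_lt_cfStep (hlt _ v hvlt)).2
  have hconj : ∀ j, ι' ((cfStep ι)^[j + 1] v) = 1 / (n j - ι' ((cfStep ι)^[j] v)) := by
    intro j
    rw [Function.iterate_succ_apply', hdig]
    simp [cfStep]
  -- Otherwise the conjugate of `v` would have the same digits as `v` and hence equal it. Once below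
  -- `n j - 1`, the next conjugate is below `1` and stays there.
  have hex : ∃ j, ι' ((cfStep ι)^[j] v) < n j - 1 := by
    by_contra hcon
    push Not at hcon
    have hq : ∀ j, minusQuotient (ι' v) j = ι' ((cfStep ι)^[j] v) ∧
        minusDigit (ι' v) j = n j := by
      intro j
      have hc : ⌈ι' ((cfStep ι)^[j] v)⌉ = n j := by
        refine ceil_eq_of_lt (lt_of_le_of_ne (hcon j) ?_) ?_
        · have := ((hirr j).map ι').ne_intCast (n j - 1)
          push_cast at this
          exact this.symm
        · have := ((hirr j).map ι).lt_ceil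
          rw [← hdig] at this
          exact (hlt j v hvlt).trans this
      have : minusQuotient (ι' v) j = ι' ((cfStep ι)^[j] v) := by
        induction j with
        | zero => rfl
        | succ j ih =>
          have hc' : ⌈ι' ((cfStep ι)^[j] v)⌉ = n j := by
            refine ceil_eq_of_lt (lt_of_le_of_ne (hcon j) ?_) ?_
            · have := ((hirr j).map ι').ne_intCast (n j - 1)
              push_cast at this
              exact this.symm
            · have := ((hirr j).map ι).lt_ceil
              rw [← hdig] at this
              exact (hlt j v hvlt).trans this
          rw [minusQuotient, ih hc', hconj, hc']
      exact ⟨this, by rw [minusDigit, this, hc]⟩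
    refine hvlt.ne (eq_of_minusDigit_eq ((hirr 0).map ι') ((hirr 0).map ι) fun k => ?_)
    rw [(hq k).2, hdig, map_cfStep_iterate, minusDigit]
  obtain ⟨j₀, hj₀⟩ := hex
  have hlt1 : ∀ i, ι' ((cfStep ι)^[j₀ + 1 + i] v) < 1 := by
    intro i
    induction i with
    | zero => rw [add_zero, hconj, div_lt_one (by linarith)]; linarith
    | succ i ih =>
      rw [← add_assoc, hconj]
      have := htwo (j₀ + 1 + i)
      rw [div_lt_one (by linarith)]
      linarith
  have hred : ∀ j, Reduced ι ι' ((cfStep ι)^[j] v) := by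
    intro j
    refine ⟨hposc j, ?_, hone j⟩
    have hℓ' : 0 < ℓ := hℓ
    -- Going `j₀ + 1` times round the period reaches an index past `j₀`, where the bound is known,
    -- without changing the number.
    have hle : j₀ + 1 ≤ (j₀ + 1) * ℓ := Nat.le_mul_of_pos_right _ hℓ'
    have := hlt1 (j + (j₀ + 1) * ℓ - (j₀ + 1))
    rwa [show j₀ + 1 + (j + (j₀ + 1) * ℓ - (j₀ + 1)) = j + (j₀ + 1) * ℓ by omega, hpv'] at this
  have hℓ' : 0 < ℓ := hℓ
  refine ⟨fun k => (cfStep ι)^[(k % ℓ).toNat] v, ⟨hℓ, fun k => hred _, fun k => (hdig _).symm,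
    ?_, fun k => by simp, ?_, ?_⟩, w, hw, γ, by simpa using hγ⟩
  · intro k
    have h1 : 1 / ((n (k % ℓ).toNat : K) - (cfStep ι)^[(k % ℓ).toNat] v) =
        (cfStep ι)^[(k % ℓ).toNat + 1] v := by
      rw [Function.iterate_succ_apply', hdig, cfStep]
    have hk0 := Int.emod_nonneg k (show (ℓ : ℤ) ≠ 0 by omega)
    have hk1 := Int.emod_lt_of_pos k (show (0 : ℤ) < ℓ by omega)
    rw [h1]
    rcases (show k % ℓ + 1 ≤ ℓ by omega).lt_or_eq with h | h
    · have : (k + 1) % ℓ = k % ℓ + 1 := by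
        rw [Int.add_emod, Int.emod_eq_of_lt (a := k % ℓ + 1 % ℓ)]
        · congr 1
          exact Int.emod_eq_of_lt (by omega) (by omega)
        · have := Int.emod_nonneg 1 (show (ℓ : ℤ) ≠ 0 by omega); omega
        · rw [Int.emod_eq_of_lt (a := 1) (by omega) (by omega)]; exact h
      simp only [this]
      rw [show (k % ℓ + 1).toNat = (k % ℓ).toNat + 1 by omega]
    · have : (k + 1) % ℓ = 0 := by
        rw [← Int.emod_add_emod, h, Int.emod_self]
      simp only [this]
      rw [show (k % ℓ).toNat + 1 = 0 + ℓ by omega, hpv]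
      rfl
  · have main : ∀ i j : ℕ, i < j → j < ℓ → (cfStep ι)^[i] v ≠ (cfStep ι)^[j] v := by
      intro i j hij hj h
      have hnn : ∀ t, n (i + t) = n (j + t) := by
        intro t
        rw [hdig, hdig, add_comm i, add_comm j, Function.iterate_add_apply,
          Function.iterate_add_apply, h]
      have := hmin (show j - i ∈ {p : ℕ | 0 < p ∧ Function.Periodic n p} from ⟨by omega, fun t => by
        have a := hnn (t + (ℓ - i))
        rw [show i + (t + (ℓ - i)) = t + ℓ by omega,
          show j + (t + (ℓ - i)) = (t + (j - i)) + ℓ by omega] at a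
        have b := hper t
        have c := hper (t + (j - i))
        exact (c.symm.trans a.symm).trans b⟩)
      omega
    intro i j hi0 hi hj0 hj h
    simp only [Int.emod_eq_of_lt hi0 hi, Int.emod_eq_of_lt hj0 hj] at h
    rcases lt_trichotomy i j with hij | hij | hij
    · exact absurd h (main _ _ (by omega) (by omega))
    · exact hij
    · exact absurd h.symm (main _ _ (by omega) (by omega))
  · rintro u ⟨δ, hδ⟩ hu
    simp only [Int.zero_emod, Int.toNat_zero, Function.iterate_zero, id] at hδ
    obtain ⟨i, j, hij⟩ := tailEquiv_mob δ ((hirr 0).map ι)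
    change minusQuotient (ι v) i = minusQuotient (mob δ (ι v)) j at hij
    rw [← map_mob, ← hδ, ← map_cfStep_iterate, ← map_cfStep_iterate] at hij
    -- Adding `j` periods makes the right exponent at least `j`, so that the steps on the left can
    -- be cancelled.
    have h1 : (cfStep ι)^[j] u = (cfStep ι)^[i + j * ℓ] v := by
      rw [hpv']; exact (ι.injective hij).symm
    have hle : j ≤ j * ℓ := Nat.le_mul_of_pos_right _ hℓ'
    have h2 := eq_iterate_of_iterate_eq hu (hred 0) (by omega) h1
    refine ⟨((i + j * ℓ - j : ℕ) : ℤ) % ℓ, Int.emod_nonneg _ (by omega),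
      Int.emod_lt_of_pos _ (by omega), ?_⟩
    simp only [Int.emod_emod_of_dvd, dvd_refl]
    rw [h2, ← Int.natCast_mod, Int.toNat_natCast]
    change (cfStep ι)^[i + j * ℓ - j] v = _
    conv_lhs => rw [← Nat.mod_add_div (i + j * ℓ - j) ℓ, mul_comm ℓ]
    rw [hpv']

end Cycle

/-! ## Half-turns around the points `m + i` -/

/-- The half-turn around `m + i`. -/
def rho (m : ℤ) : SL(2, ℤ) := ModularGroup.T ^ m * ModularGroup.S * ModularGroup.T ^ (-m)

theorem coe_rho (m : ℤ) : (rho m : Matrix (Fin 2) (Fin 2) ℤ) = !![m, -m ^ 2 - 1; 1, -m] := by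
  unfold rho
  rw [Matrix.SpecialLinearGroup.coe_mul, Matrix.SpecialLinearGroup.coe_mul,
    ModularGroup.coe_T_zpow, ModularGroup.coe_T_zpow, ModularGroup.coe_S]
  ext i j
  fin_cases i <;> fin_cases j <;> simp [Matrix.mul_apply, Fin.sum_univ_two]
  ring

theorem rho_mul_rho (m : ℤ) : rho m * rho m = -1 := by
  ext i j
  rw [Matrix.SpecialLinearGroup.coe_mul, coe_rho]
  fin_cases i <;> fin_cases j <;> simp [Matrix.mul_apply, Fin.sum_univ_two] <;> ring

theorem rho_smul_rho_smul (m : ℤ) (z : ℍ) : rho m • rho m • z = z := by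
  rw [← mul_smul, rho_mul_rho, ModularGroup.SL_neg_smul, one_smul]

theorem rho_inv_smul (m : ℤ) (z : ℍ) : (rho m)⁻¹ • z = rho m • z := by
  rw [inv_smul_eq_iff, rho_smul_rho_smul]

theorem den_rho {F : Type*} [Field F] (m : ℤ) (x : F) : den (rho m) x = x - m := by
  simp [den, coe_rho]
  ring

theorem mob_rho {F : Type*} [Field F] (m : ℤ) {x : F} (h : x ≠ m) :
    mob (rho m) x = m - 1 / (x - m) := by
  have h' : x - m ≠ 0 := sub_ne_zero.2 h
  rw [mob, den_rho, div_eq_iff h', sub_mul, div_mul_cancel₀ _ h']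
  simp [num, coe_rho]
  ring

theorem den_T_zpow {F : Type*} [Field F] (m : ℤ) (x : F) : den (ModularGroup.T ^ m) x = 1 := by
  simp [den, ModularGroup.coe_T_zpow]

theorem mob_T_zpow {F : Type*} [Field F] (m : ℤ) (x : F) :
    mob (ModularGroup.T ^ m) x = x + m := by
  simp [mob, num, den, ModularGroup.coe_T_zpow]

theorem rho_smul_T_zpow_smul (m j : ℤ) (z : ℍ) :
    rho m • ModularGroup.T ^ j • z = ModularGroup.T ^ j • rho (m - j) • z := by
  simp only [← mul_smul, rho]
  congr 1
  rw [mul_assoc, ← zpow_add, ← mul_assoc, ← mul_assoc, ← zpow_add]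
  congr 2
  · congr 2; ring
  · ring

theorem re_rho_smul (m : ℤ) (z : ℍ) :
    (rho m • z).re = m - (z.re - m) / ((z.re - m) ^ 2 + z.im ^ 2) := by
  unfold rho
  rw [mul_smul, mul_smul, ModularGroup.re_T_zpow_smul, re_S_smul, ModularGroup.re_T_zpow_smul,
    ModularGroup.im_T_zpow_smul]
  push_cast
  ring

theorem im_rho_smul (m : ℤ) (z : ℍ) :
    (rho m • z).im = z.im / ((z.re - m) ^ 2 + z.im ^ 2) := by
  unfold rho
  rw [mul_smul, mul_smul, ModularGroup.im_T_zpow_smul, im_S_smul, ModularGroup.re_T_zpow_smul,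
    ModularGroup.im_T_zpow_smul]
  push_cast
  ring

/-- The square of the Euclidean distance from the integer `m`. -/
def rad (m : ℤ) (z : ℍ) : ℝ := (z.re - m) ^ 2 + z.im ^ 2

theorem rad_pos (m : ℤ) (z : ℍ) : 0 < rad m z := sq_add_sq_pos _ _

theorem rad_rho_smul (m : ℤ) (z : ℍ) : rad m (rho m • z) = 1 / rad m z := by
  have := rad_pos m z
  unfold rad at *
  rw [re_rho_smul, im_rho_smul]
  field_simp
  ring

theorem one_lt_rad_of_le {m : ℤ} {z : ℍ} (h : 1 ≤ |z.re - m|) : 1 < rad m z := by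
  have h1 : 1 ≤ (z.re - m) ^ 2 := by rw [← sq_abs]; nlinarith
  have h2 := pow_pos z.im_pos 2
  unfold rad
  linarith

theorem abs_lt_of_rad_lt {m : ℤ} {z : ℍ} (h : rad m z < 1) : |z.re - m| < 1 := by
  by_contra hn
  exact lt_asymm h (one_lt_rad_of_le (not_lt.1 hn))

/-! ## The configuration of half-turns and boundary geodesics of a thin group -/

/-- The centres `M k` of the half-turns in `thinGroup n ℓ`, and the endpoints `lo k`, `hi k` of a
boundary geodesic of the Nielsen region between `M k` and `M (k + 1)`. -/
structure ThinData (n : ℕ → ℤ) (ℓ : ℕ) (M : ℤ → ℤ) (lo hi : ℤ → ℝ) : Prop where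
  pos : 0 < ℓ
  M_eq : ∀ k : ℕ, k ≤ ℓ → M k = partialSum n k
  M_step : ∀ k, M k + 2 ≤ M (k + 1)
  M_add : ∀ k, M (k + ℓ) = M k + partialSum n ℓ
  lo_add : ∀ k, lo (k + ℓ) = lo k + partialSum n ℓ
  hi_add : ∀ k, hi (k + ℓ) = hi k + partialSum n ℓ
  lt_lo : ∀ k, M k < lo k
  lo_lt : ∀ k, lo k < M k + 1
  lt_hi : ∀ k, M (k + 1) - 1 < hi k
  hi_lt : ∀ k, hi k < M (k + 1)
  lo_succ : ∀ k, lo (k + 1) = M (k + 1) - 1 / (lo k - M (k + 1))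
  hi_succ : ∀ k, hi (k + 1) = M (k + 1) - 1 / (hi k - M (k + 1))
  irr_lo : ∀ k, Irr (lo k)
  irr_hi : ∀ k, Irr (hi k)

namespace ThinData

variable {n : ℕ → ℤ} {ℓ : ℕ} {M : ℤ → ℤ} {lo hi : ℤ → ℝ}

theorem M_le (D : ThinData n ℓ M lo hi) {i j : ℤ} (h : i ≤ j) : M i + 2 * (j - i) ≤ M j := by
  induction j, h using Int.leInduction with
  | base => simp
  | succ j _ ih => have := D.M_step j; linarith

theorem M_mono (D : ThinData n ℓ M lo hi) {i j : ℤ} (h : i ≤ j) : (M i : ℝ) ≤ M j := by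
  have := D.M_le h
  exact_mod_cast (show M i ≤ M j by omega)

theorem M_lt (D : ThinData n ℓ M lo hi) {i j : ℤ} (h : i < j) : (M i : ℝ) + 2 ≤ M j := by
  have := D.M_le h.le
  exact_mod_cast (show M i + 2 ≤ M j by omega)

theorem M_add_mul (D : ThinData n ℓ M lo hi) (k j : ℤ) :
    M (k + j * ℓ) = M k + j * partialSum n ℓ := by
  induction j using Int.induction_on with
  | zero => simp
  | succ i ih => rw [add_mul, one_mul, ← add_assoc, D.M_add, ih]; ring
  | pred i ih =>
    have := D.M_add (k + (-i - 1) * ℓ)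
    rw [show k + (-(i : ℤ) - 1) * ℓ + ℓ = k + -(i : ℤ) * ℓ by ring, ih] at this
    linarith

theorem lo_add_mul (D : ThinData n ℓ M lo hi) (k j : ℤ) :
    lo (k + j * ℓ) = lo k + (j * partialSum n ℓ : ℤ) := by
  induction j using Int.induction_on with
  | zero => simp
  | succ i ih => rw [add_mul, one_mul, ← add_assoc, D.lo_add, ih]; push_cast; ring
  | pred i ih =>
    have := D.lo_add (k + (-i - 1) * ℓ)
    rw [show k + (-(i : ℤ) - 1) * ℓ + ℓ = k + -(i : ℤ) * ℓ by ring, ih] at this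
    push_cast at this ⊢
    linarith

theorem hi_add_mul (D : ThinData n ℓ M lo hi) (k j : ℤ) :
    hi (k + j * ℓ) = hi k + (j * partialSum n ℓ : ℤ) := by
  induction j using Int.induction_on with
  | zero => simp
  | succ i ih => rw [add_mul, one_mul, ← add_assoc, D.hi_add, ih]; push_cast; ring
  | pred i ih =>
    have := D.hi_add (k + (-i - 1) * ℓ)
    rw [show k + (-(i : ℤ) - 1) * ℓ + ℓ = k + -(i : ℤ) * ℓ by ring, ih] at this
    push_cast at this ⊢
    linarith

theorem lo_lt_hi (D : ThinData n ℓ M lo hi) (k : ℤ) : lo k < hi k := by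
  have := D.M_lt (lt_add_one k)
  have := D.lo_lt k
  have := D.lt_hi k
  linarith

theorem two_le_partialSum (D : ThinData n ℓ M lo hi) : 2 ≤ partialSum n ℓ := by
  have h1 := D.M_le (i := 0) (j := 0 + ℓ) (by omega)
  rw [D.M_add] at h1
  have := D.pos
  omega

theorem T_zpow_mem (j : ℤ) :
    ModularGroup.T ^ (j * partialSum n ℓ) ∈ thinGroup n ℓ := by
  rw [mul_comm, zpow_mul]
  have h : ModularGroup.T ^ partialSum n ℓ ∈ thinGroup n ℓ :=
    Subgroup.subset_closure (Or.inr rfl)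
  exact zpow_mem h j

theorem rho_mem (D : ThinData n ℓ M lo hi) (k : ℤ) : rho (M k) ∈ thinGroup n ℓ := by
  have hℓ : (0 : ℤ) < ℓ := by have := D.pos; omega
  obtain ⟨i, j, hi0, hi1, rfl⟩ : ∃ i j : ℤ, 1 ≤ i ∧ i ≤ ℓ ∧ k = i + j * ℓ := by
    refine ⟨(k - 1) % ℓ + 1, (k - 1) / ℓ, ?_, ?_, ?_⟩
    · have := Int.emod_nonneg (k - 1) hℓ.ne'; omega
    · have := Int.emod_lt_of_pos (k - 1) hℓ; omega
    · have := Int.emod_add_mul_ediv (k - 1) ℓ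
      linarith
  have h1 : rho (M i) ∈ thinGroup n ℓ := by
    lift i to ℕ using by omega
    rw [D.M_eq i (by omega)]
    exact Subgroup.subset_closure (Or.inl ⟨i, Finset.mem_Icc.2 ⟨by omega, by omega⟩, rfl⟩)
  have h2 : rho (M (i + j * ℓ)) = ModularGroup.T ^ (j * partialSum n ℓ) * rho (M i) *
      (ModularGroup.T ^ (j * partialSum n ℓ))⁻¹ := by
    rw [D.M_add_mul, rho, rho]
    rw [show M i + j * partialSum n ℓ = j * partialSum n ℓ + M i by ring, zpow_add, neg_add,
      add_comm (-(j * partialSum n ℓ)), zpow_add]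
    simp only [zpow_neg]
    group
  rw [h2]
  exact mul_mem (mul_mem (T_zpow_mem j) h1) (inv_mem (T_zpow_mem j))

/-- The points obtained from `z` by a reduced word in the half-turns with given first letter. -/
inductive Reach (M : ℤ → ℤ) (z : ℍ) : Option ℤ → ℍ → Prop
  | nil : Reach M z none z
  | cons (k : ℤ) (o : Option ℤ) (u : ℍ) : Reach M z o u → o ≠ some k →
      Reach M z (some k) (rho (M k) • u)

/-- The translation normalizes the family of half-turns, shifting the index by `ℓ`. Its powers can
thus be collected in front, and equal adjacent half-turns cancel because they act as involutions. -/
theorem exists_reach (D : ThinData n ℓ M lo hi) {g : SL(2, ℤ)} (hg : g ∈ thinGroup n ℓ) (z : ℍ) :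
    ∃ (j : ℤ) (o : Option ℤ) (u : ℍ), Reach M z o u ∧
      g • z = ModularGroup.T ^ (j * partialSum n ℓ) • u := by
  have key : ∀ (k j : ℤ) (o : Option ℤ) (u : ℍ), Reach M z o u →
      ∃ (j' : ℤ) (o' : Option ℤ) (u' : ℍ), Reach M z o' u' ∧
        rho (M k) • ModularGroup.T ^ (j * partialSum n ℓ) • u =
          ModularGroup.T ^ (j' * partialSum n ℓ) • u' := by
    intro k j o u hu
    have hM : M k - j * partialSum n ℓ = M (k + (-j) * ℓ) := by
      rw [D.M_add_mul]; ring
    rw [rho_smul_T_zpow_smul, hM]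
    by_cases ho : o = some (k + (-j) * ℓ)
    · cases hu with
      | nil => simp at ho
      | cons k' o' u' h h' =>
        rw [Option.some.injEq] at ho
        subst ho
        exact ⟨j, o', u', h, by rw [rho_smul_rho_smul]⟩
    · exact ⟨j, _, _, Reach.cons _ _ _ hu ho, rfl⟩
  have hT : ∀ (i j : ℤ) (u : ℍ), ModularGroup.T ^ (i * partialSum n ℓ) •
      ModularGroup.T ^ (j * partialSum n ℓ) • u =
        ModularGroup.T ^ ((i + j) * partialSum n ℓ) • u := by
    intro i j u
    rw [← mul_smul, ← zpow_add, add_mul]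
  unfold thinGroup at hg
  induction hg using Subgroup.closure_induction_left with
  | one => exact ⟨0, none, z, Reach.nil, by simp⟩
  | mul_left x hx y _ ih =>
    obtain ⟨j, o, u, hu, h⟩ := ih
    rw [mul_smul, h]
    rcases hx with ⟨k, hk, rfl⟩ | rfl
    · have := key k j o u hu
      rwa [D.M_eq k (Finset.mem_Icc.1 hk).2] at this
    · exact ⟨1 + j, o, u, hu, by rw [← hT, one_mul]⟩
  | inv_mul_cancel x hx y _ ih =>
    obtain ⟨j, o, u, hu, h⟩ := ih
    rw [mul_smul, h]
    rcases hx with ⟨k, hk, rfl⟩ | rfl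
    · have := key k j o u hu
      rw [D.M_eq k (Finset.mem_Icc.1 hk).2, ← rho_inv_smul] at this
      exact this
    · exact ⟨-1 + j, o, u, hu, by rw [← hT, neg_one_mul, zpow_neg]⟩

/-- Ping-pong for the half-turns. -/
theorem rad_lt_of_reach (D : ThinData n ℓ M lo hi) {z : ℍ} (hz : ∀ k, 1 < rad (M k) z)
    {o : Option ℤ} {u : ℍ} (h : Reach M z o u) :
    (o = none ∧ u = z) ∨ ∃ k, o = some k ∧ rad (M k) u < 1 := by
  induction h with
  | nil => exact Or.inl ⟨rfl, rfl⟩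
  | cons k o u _ ho ih =>
    refine Or.inr ⟨k, rfl, ?_⟩
    rw [rad_rho_smul, div_lt_one (rad_pos _ _)]
    rcases ih with ⟨_, rfl⟩ | ⟨k', rfl, h⟩
    · exact hz k
    · have hne : k' ≠ k := fun h => ho (by rw [h])
      have h1 := abs_lt.1 (abs_lt_of_rad_lt h)
      apply one_lt_rad_of_le
      rcases hne.lt_or_gt with hlt | hlt
      · have := D.M_lt hlt
        rw [abs_of_nonpos (by linarith)]; linarith
      · have := D.M_lt hlt
        rw [abs_of_nonneg (by linarith)]; linarith

/-- By ping-pong a nonempty reduced word ends inside a disc, and translations permute the discs; so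
only the translation part of `g` can survive. -/
theorem exists_rad_lt (D : ThinData n ℓ M lo hi) {g : SL(2, ℤ)} (hg : g ∈ thinGroup n ℓ) {z : ℍ}
    (hz : ∀ k, 1 < rad (M k) z) (hgz : ∀ k, 1 < rad (M k) (g • z)) :
    ∃ j : ℤ, g • z = ModularGroup.T ^ (j * partialSum n ℓ) • z := by
  obtain ⟨j, o, u, hu, h⟩ := D.exists_reach hg z
  rcases D.rad_lt_of_reach hz hu with ⟨_, rfl⟩ | ⟨k, _, hk⟩
  · exact ⟨j, h⟩
  · exfalso
    have := hgz (k + j * ℓ)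
    rw [h, D.M_add_mul] at this
    unfold rad at this hk
    rw [ModularGroup.re_T_zpow_smul, ModularGroup.im_T_zpow_smul] at this
    push_cast at this
    rw [show u.re + (j : ℝ) * (partialSum n ℓ : ℝ) - ((M k : ℝ) + j * partialSum n ℓ) =
      u.re - M k by ring] at this
    linarith

/-- The half-turn between two neighbouring boundary geodesics carries the first to the second, so
all of them form one orbit. -/
theorem rho_smul_mem_leftSide (D : ThinData n ℓ M lo hi) (k : ℤ) (z : ℍ) :
    rho (M (k + 1)) • z ∈ leftSide (lo (k + 1)) (hi (k + 1)) ↔ z ∈ leftSide (lo k) (hi k) := by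
  have h0 : lo k ≠ (M (k + 1) : ℝ) := (D.irr_lo k).ne_intCast _
  have h1 : hi k ≠ (M (k + 1) : ℝ) := (D.irr_hi k).ne_intCast _
  have := smul_mem_leftSide (rho (M (k + 1))) ((D.irr_lo k).den_ne_zero _)
    ((D.irr_hi k).den_ne_zero _) (z := z)
  rwa [mob_rho _ h0, mob_rho _ h1, ← D.lo_succ, ← D.hi_succ] at this

theorem T_smul_mem_leftSide (D : ThinData n ℓ M lo hi) (k j : ℤ) (z : ℍ) :
    ModularGroup.T ^ (j * partialSum n ℓ) • z ∈ leftSide (lo (k + j * ℓ)) (hi (k + j * ℓ)) ↔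
      z ∈ leftSide (lo k) (hi k) := by
  have := smul_mem_leftSide (ModularGroup.T ^ (j * partialSum n ℓ)) ((D.irr_lo k).den_ne_zero _)
    ((D.irr_hi k).den_ne_zero _) (z := z)
  rwa [mob_T_zpow, mob_T_zpow, ← D.lo_add_mul, ← D.hi_add_mul] at this

/-- After the last half-turn the point lies in the disc about `M i`. That disc is horizontally
disjoint from the interval under the `k`-th geodesic unless `i` is `k` or `k + 1`, and in these two
cases undoing the half-turn replaces the geodesic by a neighbouring one. -/
theorem mem_leftSide_of_reach (D : ThinData n ℓ M lo hi) {z : ℍ} (hz : ∀ k, 1 < rad (M k) z)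
    (hz' : ∀ k, z ∈ leftSide (lo k) (hi k)) {o : Option ℤ} {u : ℍ} (h : Reach M z o u) (k : ℤ) :
    u ∈ leftSide (lo k) (hi k) := by
  induction h generalizing k with
  | nil => exact hz' k
  | cons i o u hu ho ih =>
    have hdisc : rad (M i) (rho (M i) • u) < 1 := by
      rcases D.rad_lt_of_reach hz (Reach.cons i o u hu ho) with ⟨h, _⟩ | ⟨i', h, h'⟩
      · simp at h
      · rw [Option.some.injEq] at h
        rw [← h] at h'
        exact h'
    have habs := abs_lt.1 (abs_lt_of_rad_lt hdisc)
    rw [mem_leftSide_of_lt (D.lo_lt_hi k)]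
    have him := pow_pos (rho (M i) • u).im_pos 2
    rcases lt_trichotomy i k with hik | rfl | hik
    · have h1 := D.M_lt hik
      have h2 := D.lt_lo k
      have h3 := D.lo_lt_hi k
      unfold side
      nlinarith
    · rw [← mem_leftSide_of_lt (D.lo_lt_hi i)]
      have := D.rho_smul_mem_leftSide (i - 1) u
      rw [sub_add_cancel] at this
      exact this.2 (ih (i - 1))
    · rcases (show k + 1 ≤ i by omega).lt_or_eq with hik | rfl
      · have h1 := D.M_lt hik
        have h2 := D.hi_lt k
        have h3 := D.lo_lt_hi k
        unfold side
        nlinarith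
      · rw [← mem_leftSide_of_lt (D.lo_lt_hi k), ← D.rho_smul_mem_leftSide k, rho_smul_rho_smul]
        exact ih (k + 1)

/-- This height clears every unit disc and every boundary semicircle, since each of these has
diameter less than `partialSum n ℓ`. It provides an interior point for the upper bound on the
Nielsen region. -/
theorem mem_leftSide_of_high (D : ThinData n ℓ M lo hi) {z : ℍ} (hz : (partialSum n ℓ : ℝ) < z.im)
    {g : SL(2, ℤ)} (hg : g ∈ thinGroup n ℓ) (k : ℤ) : g • z ∈ leftSide (lo k) (hi k) := by
  have h2 : (2 : ℝ) ≤ partialSum n ℓ := by exact_mod_cast D.two_le_partialSum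
  have hr : ∀ k, 1 < rad (M k) z := fun k => by
    unfold rad
    nlinarith [sq_nonneg (z.re - M k)]
  have hl : ∀ k, z ∈ leftSide (lo k) (hi k) := fun k => by
    rw [mem_leftSide_of_lt (D.lo_lt_hi k)]
    have a := D.lt_lo k
    have b := D.hi_lt k
    have c : (M (k + 1) : ℝ) ≤ M (k + ℓ) := D.M_mono (by have := D.pos; omega)
    rw [D.M_add] at c
    push_cast at c
    have e : 0 < hi k - lo k := sub_pos.2 (D.lo_lt_hi k)
    have f : hi k - lo k < partialSum n ℓ := by linarith
    have s1 : side (lo k) (hi k) z = (z.re - (lo k + hi k) / 2) ^ 2 + z.im ^ 2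
      - ((hi k - lo k) / 2) ^ 2 := by unfold side; ring
    rw [s1]
    nlinarith [sq_nonneg (z.re - (lo k + hi k) / 2)]
  obtain ⟨j, o, u, hu, h⟩ := D.exists_reach hg z
  rw [h]
  have := D.T_smul_mem_leftSide (k - j * ℓ) j u
  rw [sub_add_cancel] at this
  exact this.2 (D.mem_leftSide_of_reach hr hl hu _)

theorem continuous_smul (γ : SL(2, ℤ)) : Continuous (fun z : ℍ => γ • z) :=
  continuous_const_smul (Matrix.SpecialLinearGroup.mapGL ℝ γ)

theorem nielsenRegion_subset_leftSide (D : ThinData n ℓ M lo hi) (k : ℤ) :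
    nielsenRegion (thinGroup n ℓ) ⊆ leftSide (lo k) (hi k) := by
  obtain ⟨P, hP⟩ : ∃ P : SL(2, ℤ) → ℤ → Set (ℝ × ℝ), ∀ g k, Convex ℝ (P g k) ∧
      {z : ℍ | g • z ∈ leftSide (lo k) (hi k)} = klein ⁻¹' P g k := by
    refine ⟨fun g k => _, fun g k => ⟨convex_halfPlane
      (mob g⁻¹ (hi k) - mob g⁻¹ (lo k))
      (-(mob g⁻¹ (hi k) - mob g⁻¹ (lo k)) * (mob g⁻¹ (lo k) + mob g⁻¹ (hi k)))
      ((mob g⁻¹ (hi k) - mob g⁻¹ (lo k)) * (mob g⁻¹ (lo k) * mob g⁻¹ (hi k))), ?_⟩⟩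
    rw [← leftSide_eq_preimage]
    ext z
    have := smul_mem_leftSide g⁻¹ ((D.irr_lo k).den_ne_zero _) ((D.irr_hi k).den_ne_zero _)
      (z := g • z)
    rw [inv_smul_smul] at this
    exact this.symm
  -- The intersection of all translates of the half-planes is convex and invariant; its interior
  -- competes in the definition of the Nielsen region.
  obtain ⟨Q, hQ⟩ : ∃ Q : Set ℍ, Q = {z | ∀ g ∈ thinGroup n ℓ, ∀ k, g • z ∈ leftSide (lo k) (hi k)} :=
    ⟨_, rfl⟩
  have hQP : Q = klein ⁻¹' ⋂ g ∈ thinGroup n ℓ, ⋂ k, P g k := by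
    ext z
    simp only [hQ, Set.mem_ofPred_eq, Set.mem_preimage, Set.mem_iInter]
    refine forall_congr' fun g => forall_congr' fun _ => forall_congr' fun k => ?_
    exact Set.ext_iff.1 (hP g k).2 z
  have hsub : nielsenRegion (thinGroup n ℓ) ⊆ interior Q := by
    refine Set.sInter_subset_of_mem ⟨?_, isOpen_interior, ?_, ?_⟩
    · have hopen : IsOpen {z : ℍ | (partialSum n ℓ : ℝ) < z.im} :=
        isOpen_lt continuous_const UpperHalfPlane.continuous_im
      have hm : {z : ℍ | (partialSum n ℓ : ℝ) < z.im} ⊆ Q := by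
        intro z hz
        rw [hQ]
        exact fun g hg k => D.mem_leftSide_of_high hz hg k
      have h2 : (2 : ℝ) ≤ partialSum n ℓ := by exact_mod_cast D.two_le_partialSum
      refine ⟨⟨⟨0, partialSum n ℓ + 1⟩, ?_⟩, interior_maximal hm hopen ?_⟩
      · show (0 : ℝ) < partialSum n ℓ + 1
        linarith
      · show (partialSum n ℓ : ℝ) < partialSum n ℓ + 1
        linarith
    · rw [hQP, ← isOpenEmbedding_klein.isOpenMap.preimage_interior_eq_interior_preimage
        isOpenEmbedding_klein.continuous]
      refine hypConvex_preimage_klein (Convex.interior ?_)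
      exact convex_iInter fun g => convex_iInter fun _ => convex_iInter fun k => (hP g k).1
    · intro γ hγ z hz
      have hO : IsOpen ((fun w : ℍ => γ⁻¹ • w) ⁻¹' interior Q) :=
        isOpen_interior.preimage (continuous_smul γ⁻¹)
      refine interior_maximal ?_ hO (show γ⁻¹ • γ • z ∈ interior Q by rwa [inv_smul_smul])
      intro w hw
      have hw' : γ⁻¹ • w ∈ Q := interior_subset hw
      rw [hQ] at hw' ⊢
      intro g hg k
      have := hw' (g * γ) (mul_mem hg hγ) k
      rwa [mul_smul, smul_inv_smul] at this
  intro z hz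
  have := interior_subset (hsub hz)
  rw [hQ] at this
  simpa using this 1 (one_mem _) k

/-- Each orbit of the thin group meets the closed strip outside the unit discs around the `M k`. -/
theorem exists_smul_mem_strip (D : ThinData n ℓ M lo hi) (z : ℍ) :
    ∃ g ∈ thinGroup n ℓ, (∀ k, 1 ≤ rad (M k) (g • z)) ∧
      ∃ k : ℤ, 0 ≤ k ∧ k < ℓ ∧ M k ≤ (g • z).re ∧ (g • z).re < M (k + 1) := by
  -- The highest point of an orbit lies outside all open discs, since a half-turn raises any point
  -- inside its disc. It exists because only finitely many bottom rows give bounded denominators.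
  have hmax : ∃ g ∈ thinGroup n ℓ, ∀ g' ∈ thinGroup n ℓ, (g' • z).im ≤ (g • z).im := by
    let s : Set (Fin 2 → ℤ) := {cd | ∃ g ∈ thinGroup n ℓ, g 1 = cd}
    obtain ⟨p, ⟨g, hg, rfl⟩, hp⟩ := Filter.Tendsto.exists_within_forall_le (s := s)
      ⟨_, 1, one_mem _, rfl⟩ (ModularGroup.tendsto_normSq_coprime_pair z)
    refine ⟨g, hg, fun g' hg' => ?_⟩
    rw [ModularGroup.im_smul_eq_div_normSq, ModularGroup.im_smul_eq_div_normSq,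
      div_le_div_iff_of_pos_left]
    · simpa using! hp (g' 1) ⟨g', hg', rfl⟩
    · exact z.im_pos
    · exact normSq_denom_pos g' z.im_ne_zero
    · exact normSq_denom_pos g z.im_ne_zero
  obtain ⟨g, hg, hmax⟩ := hmax
  have hrad : ∀ g' ∈ thinGroup n ℓ, (g' • z).im = (g • z).im → ∀ k, 1 ≤ rad (M k) (g' • z) := by
    intro g' hg' he k
    have := hmax (rho (M k) * g') (mul_mem (D.rho_mem k) hg')
    rw [mul_smul, im_rho_smul, ← he] at this
    rw [div_le_iff₀ (sq_add_sq_pos _ _)] at this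
    exact le_of_mul_le_mul_left (by rw [mul_one]; exact this) (g' • z).im_pos
  have hm : (0 : ℝ) < partialSum n ℓ := by
    have := D.two_le_partialSum
    exact_mod_cast (show 0 < partialSum n ℓ by omega)
  obtain ⟨j, hj⟩ : ∃ j : ℤ, j = ⌊((g • z).re - M 0) / partialSum n ℓ⌋ := ⟨_, rfl⟩
  obtain ⟨g', hg'⟩ : ∃ g', g' = ModularGroup.T ^ ((-j) * partialSum n ℓ) * g := ⟨_, rfl⟩
  have hre : (g' • z).re = (g • z).re - j * partialSum n ℓ := by
    rw [hg', mul_smul, ModularGroup.re_T_zpow_smul]; push_cast; ring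
  have hlo : (M 0 : ℝ) ≤ (g' • z).re := by
    have := Int.floor_le (((g • z).re - M 0) / partialSum n ℓ)
    rw [← hj, le_div_iff₀ hm] at this
    rw [hre]; linarith
  have hhi : (g' • z).re < M (ℓ : ℤ) := by
    have := Int.lt_floor_add_one (((g • z).re - M 0) / partialSum n ℓ)
    rw [← hj, div_lt_iff₀ hm] at this
    have h3 := D.M_add 0
    rw [zero_add] at h3
    rw [hre, h3]; push_cast; linarith
  refine ⟨g', hg' ▸ mul_mem (T_zpow_mem _) hg, hrad g' (hg' ▸ mul_mem (T_zpow_mem _) hg) (by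
    rw [hg', mul_smul, ModularGroup.im_T_zpow_smul]), ?_⟩
  classical
  have hex : ∃ k : ℕ, (g' • z).re < M (k + 1 : ℤ) := ⟨ℓ - 1, by
    have := D.pos
    rwa [show ((ℓ - 1 : ℕ) : ℤ) + 1 = ℓ by omega]⟩
  refine ⟨(Nat.find hex : ℤ), by omega, ?_, ?_, Nat.find_spec hex⟩
  · have : Nat.find hex ≤ ℓ - 1 := Nat.find_min' hex (by
      have := D.pos
      rwa [show ((ℓ - 1 : ℕ) : ℤ) + 1 = ℓ by omega])
    have := D.pos
    omega
  · rcases Nat.eq_zero_or_pos (Nat.find hex) with h0 | h0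
    · rw [h0]; exact_mod_cast hlo
    · have := Nat.find_min hex (m := Nat.find hex - 1) (by omega)
      rw [show ((Nat.find hex - 1 : ℕ) : ℤ) + 1 = Nat.find hex by omega] at this
      exact not_lt.1 this

end ThinData

/-! ## Convex sets with given limit points -/

theorem HypConvex.exists_re_eq {C : Set ℍ} (hC : HypConvex C) {p q : ℍ} (hp : p ∈ C) (hq : q ∈ C)
    {x : ℝ} (h1 : p.re < x) (h2 : x < q.re) : ∃ u ∈ C, u.re = x ∧ ∃ t : ℝ, 0 ≤ t ∧ t ≤ 1 ∧
      u.im ^ 2 = (x - p.re) * (q.re - x) + (1 - t) * p.im ^ 2 + t * q.im ^ 2 := by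
  have hd : 0 < q.re - p.re := by linarith
  obtain ⟨t, ht⟩ : ∃ t, t = (x - p.re) / (q.re - p.re) := ⟨_, rfl⟩
  have ht' : t * (q.re - p.re) = x - p.re := by rw [ht]; field_simp
  have h0 : 0 ≤ t := ht ▸ div_nonneg (by linarith) hd.le
  have h1' : t ≤ 1 := by rw [ht, div_le_one hd]; linarith
  obtain ⟨u, hu, hx, hn⟩ := exists_mem_hypSegment p q h0 h1'
  have hux : u.re = x := by rw [hx]; linarith
  refine ⟨u, hC p hp q hq hu, hux, t, h0, h1', ?_⟩
  rw [hux] at hn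
  linear_combination hn + (q.re + p.re) * ht'

theorem HypConvex.mem_of_re_eq {C : Set ℍ} (hC : HypConvex C) {p q z : ℍ} (hp : p ∈ C)
    (hq : q ∈ C) (h1 : p.re = z.re) (h2 : q.re = z.re) (h3 : p.im ≤ z.im) (h4 : z.im < q.im) :
    z ∈ C := by
  have hp0 := p.im_pos
  have hz0 := z.im_pos
  have hd : 0 < q.im ^ 2 - p.im ^ 2 := by nlinarith
  obtain ⟨t, ht⟩ : ∃ t, t = (z.im ^ 2 - p.im ^ 2) / (q.im ^ 2 - p.im ^ 2) := ⟨_, rfl⟩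
  have ht' : t * (q.im ^ 2 - p.im ^ 2) = z.im ^ 2 - p.im ^ 2 := by rw [ht]; field_simp
  refine hC p hp q hq (mem_hypSegment_of_klein (t := t) ?_ ?_ ?_ ?_)
  · rw [ht]; exact div_nonneg (by nlinarith) hd.le
  · rw [ht, div_le_one hd]; nlinarith
  · rw [h1, h2]; ring
  · rw [h1, h2]; linear_combination -ht'

/-- A convex set that approaches the real points `y₀ < y₁` and contains points of large height
above each real number contains the points above the geodesic from `y₀` to `y₁`. -/
theorem HypConvex.mem_of_side_pos {C : Set ℍ} (hC : HypConvex C) {y₀ y₁ : ℝ}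
    (h0 : ∀ δ > 0, ∃ u ∈ C, |u.re - y₀| < δ ∧ u.im < δ)
    (h1 : ∀ δ > 0, ∃ u ∈ C, |u.re - y₁| < δ ∧ u.im < δ)
    (hhigh : ∀ x Y : ℝ, ∃ u ∈ C, u.re = x ∧ Y < u.im) {z : ℍ} (hz0 : y₀ < z.re) (hz1 : z.re < y₁)
    (hs : 0 < side y₀ y₁ z) : z ∈ C := by
  have hy : 0 < y₁ - y₀ := by linarith
  -- Moving the endpoints by `δ`, at heights below `δ`, raises the squared height above `Re z` by at
  -- most `δ (y₁ - y₀) + 2 δ²`, which the gap `side y₀ y₁ z` absorbs.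
  obtain ⟨δ, hδ0, hδ1, hδs, hδa, hδb⟩ : ∃ δ : ℝ, 0 < δ ∧ δ ≤ 1 ∧
      δ * (y₁ - y₀ + 3) ≤ side y₀ y₁ z ∧ δ ≤ z.re - y₀ ∧ δ ≤ y₁ - z.re := by
    refine ⟨min (min 1 (side y₀ y₁ z / (y₁ - y₀ + 3))) (min (z.re - y₀) (y₁ - z.re)), ?_, ?_, ?_,
      ?_, ?_⟩
    · refine lt_min (lt_min one_pos (by positivity)) (lt_min ?_ ?_) <;> linarith
    · exact (min_le_left _ _).trans (min_le_left _ _)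
    · rw [← le_div_iff₀ (by linarith)]
      exact (min_le_left _ _).trans (min_le_right _ _)
    · exact (min_le_right _ _).trans (min_le_left _ _)
    · exact (min_le_right _ _).trans (min_le_right _ _)
  obtain ⟨p, hp, hpx, hpy⟩ := h0 δ hδ0
  obtain ⟨q, hq, hqx, hqy⟩ := h1 δ hδ0
  rw [abs_lt] at hpx hqx
  obtain ⟨u, hu, hux, t, ht0, ht1, hui⟩ := hC.exists_re_eq hp hq (x := z.re) (by linarith)
    (by linarith)
  obtain ⟨v, hv, hvx, hvi⟩ := hhigh z.re z.im
  refine hC.mem_of_re_eq hu hv hux hvx ?_ hvi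
  have hp0 := p.im_pos
  have hq0 := q.im_pos
  have e1 : p.im ^ 2 ≤ δ ^ 2 := by nlinarith
  have e2 : q.im ^ 2 ≤ δ ^ 2 := by nlinarith
  have e3 : (1 - t) * p.im ^ 2 ≤ (1 - t) * δ ^ 2 := mul_le_mul_of_nonneg_left e1 (by linarith)
  have e4 : t * q.im ^ 2 ≤ t * δ ^ 2 := mul_le_mul_of_nonneg_left e2 ht0
  have e5 : (z.re - p.re) * (q.re - z.re) ≤ (z.re - y₀ + δ) * (y₁ - z.re + δ) :=
    mul_le_mul (by linarith) (by linarith) (by linarith) (by linarith)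
  have e6 : u.im ^ 2 ≤ z.im ^ 2 := by
    unfold side at hδs
    nlinarith
  exact (sq_le_sq₀ u.im_pos.le z.im_pos.le).1 e6

theorem coe_sub_eq_div {x₀ x₁ : ℝ} (h : x₀ ≠ x₁) (z : ℍ) : (z : ℂ) - x₀ =
    (x₁ - x₀) ^ 2 / ((x₁ - x₀) - straighten x₀ x₁ z) := by
  have hz := coe_sub_ne_zero z x₀
  have h' : (x₁ : ℂ) - x₀ ≠ 0 := sub_ne_zero.2 (by exact_mod_cast h.symm)
  have e : ((x₁ : ℂ) - x₀) - straighten x₀ x₁ z = (x₁ - x₀) ^ 2 / ((z : ℂ) - x₀) := by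
    unfold straighten
    field_simp
    ring
  rw [e]
  field_simp

/-- Points whose straightened coordinate is large are close to the first endpoint. -/
theorem exists_close {C : Set ℍ} {x₀ x₁ : ℝ} (h : x₀ ≠ x₁)
    (hC : ∀ B : ℝ, ∃ u ∈ C, B < ‖straighten x₀ x₁ u‖) {δ : ℝ} (hδ : 0 < δ) :
    ∃ u ∈ C, |u.re - x₀| < δ ∧ u.im < δ := by
  obtain ⟨u, hu, hB⟩ := hC (|x₁ - x₀| + (x₁ - x₀) ^ 2 / δ)
  have hn : ‖(u : ℂ) - x₀‖ < δ := by
    rw [coe_sub_eq_div h, norm_div]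
    have h1 : ‖straighten x₀ x₁ u‖ - |x₁ - x₀| ≤ ‖((x₁ : ℂ) - x₀) - straighten x₀ x₁ u‖ := by
      rw [norm_sub_rev, ← Real.norm_eq_abs, ← Complex.norm_real, Complex.ofReal_sub]
      exact norm_sub_norm_le _ _
    have h2 : 0 < (x₁ - x₀) ^ 2 / δ := by
      have : x₁ - x₀ ≠ 0 := sub_ne_zero.2 h.symm
      positivity
    have h3 : ‖((x₁ : ℂ) - x₀) ^ 2‖ = (x₁ - x₀) ^ 2 := by
      rw [norm_pow, ← Complex.ofReal_sub, Complex.norm_real, Real.norm_eq_abs, sq_abs]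
    rw [h3, div_lt_comm₀ (by linarith) hδ]
    linarith
  refine ⟨u, hu, ?_, ?_⟩
  · have := (Complex.abs_re_le_norm ((u : ℂ) - x₀)).trans_lt hn
    simpa using this
  · have := (Complex.abs_im_le_norm ((u : ℂ) - x₀)).trans_lt hn
    have h2 := le_abs_self ((u : ℂ) - x₀).im
    simp only [Complex.sub_im, Complex.ofReal_im, sub_zero, coe_im] at h2 this
    linarith

theorem straighten_ne_zero {x₀ x₁ : ℝ} (h : x₀ ≠ x₁) (z : ℍ) : straighten x₀ x₁ z ≠ 0 := by
  unfold straighten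
  have h' : (x₁ : ℂ) - x₀ ≠ 0 := sub_ne_zero.2 (by exact_mod_cast h.symm)
  exact div_ne_zero (mul_ne_zero h' (coe_sub_ne_zero z x₁)) (coe_sub_ne_zero z x₀)

theorem straighten_swap {x₀ x₁ : ℝ} (h : x₀ ≠ x₁) (z : ℍ) :
    straighten x₁ x₀ z = -(x₁ - x₀) ^ 2 / straighten x₀ x₁ z := by
  have h' : (x₁ : ℂ) - x₀ ≠ 0 := sub_ne_zero.2 (by exact_mod_cast h.symm)
  have := coe_sub_ne_zero z x₁
  have := coe_sub_ne_zero z x₀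
  unfold straighten
  field_simp
  ring

/-! ### The Nielsen region from inside: limit points of invariant convex sets -/

namespace ThinData

variable {n : ℕ → ℤ} {ℓ : ℕ} {M : ℤ → ℤ} {lo hi : ℤ → ℝ}

/-- Composing the `ℓ` half-turns that lead from the `k`-th boundary geodesic to its translate, and
translating back, gives a hyperbolic element with this geodesic as axis, attracting towards `lo k`.
-/
theorem exists_straighten_smul (D : ThinData n ℓ M lo hi) (k : ℤ) :
    ∃ g ∈ thinGroup n ℓ, ∃ c : ℝ, 1 < c ∧ ∀ z, straighten (lo k) (hi k) (g • z) =
      c * straighten (lo k) (hi k) z := by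
  have step : ∀ i : ℕ, ∃ g ∈ thinGroup n ℓ, ∃ c : ℝ, 1 < c ∧ ∀ z,
      straighten (lo (k + (i + 1 : ℕ))) (hi (k + (i + 1 : ℕ))) (g • z) =
      c * straighten (lo k) (hi k) z := by
    have one : ∀ k, ∃ c : ℝ, 1 < c ∧ ∀ z, straighten (lo (k + 1)) (hi (k + 1))
        (rho (M (k + 1)) • z) = c * straighten (lo k) (hi k) z := by
      intro k
      have h0 : lo k ≠ (M (k + 1) : ℝ) := (D.irr_lo k).ne_intCast _
      have h1 : hi k ≠ (M (k + 1) : ℝ) := (D.irr_hi k).ne_intCast _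
      -- The factor exceeds `1` because `hi k` is at distance less than `1` from the centre of the
      -- half-turn.
      refine ⟨((hi k - M (k + 1)) ^ 2)⁻¹, ?_, fun z => ?_⟩
      · have a := D.lt_hi k
        have b := D.hi_lt k
        rw [one_lt_inv₀ (by nlinarith)]
        nlinarith
      · have := straighten_smul (rho (M (k + 1))) ((D.irr_lo k).den_ne_zero _)
          ((D.irr_hi k).den_ne_zero _) z
        rwa [mob_rho _ h0, mob_rho _ h1, ← D.lo_succ, ← D.hi_succ, den_rho] at this
    intro i
    induction i with
    | zero =>
      obtain ⟨c, hc, h⟩ := one k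
      refine ⟨_, D.rho_mem (k + 1), c, hc, fun z => ?_⟩
      rw [← h, zero_add, Nat.cast_one]
    | succ i ih =>
      obtain ⟨g, hg, c, hc, h⟩ := ih
      obtain ⟨c', hc', h'⟩ := one (k + (i + 1 : ℕ))
      refine ⟨_, mul_mem (D.rho_mem (k + (i + 1 : ℕ) + 1)) hg, c' * c, by nlinarith, fun z => ?_⟩
      rw [mul_smul, show k + ((i + 1 + 1 : ℕ) : ℤ) = k + ((i + 1 : ℕ) : ℤ) + 1 by push_cast; ring,
        h', h]
      push_cast; ring
  obtain ⟨g, hg, c, hc, h⟩ := step (ℓ - 1)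
  refine ⟨_, mul_mem (T_zpow_mem (-1)) hg, c, hc, fun z => ?_⟩
  have h1 := straighten_smul (ModularGroup.T ^ (-1 * partialSum n ℓ))
    ((D.irr_lo (k + ℓ)).den_ne_zero _) ((D.irr_hi (k + ℓ)).den_ne_zero _) (g • z)
  rw [mob_T_zpow, mob_T_zpow, den_T_zpow, ← D.lo_add_mul, ← D.hi_add_mul] at h1
  have hpos := D.pos
  rw [show ℓ - 1 + 1 = ℓ by omega] at h
  rw [show k + (ℓ : ℤ) + -1 * ℓ = k by ring, h] at h1
  rw [mul_smul, h1]
  simp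

/-- Positive powers of the hyperbolic element push any point to `lo k`, negative powers to `hi k`.
-/
theorem exists_close_endpoints (D : ThinData n ℓ M lo hi) {C : Set ℍ} (hne : C.Nonempty)
    (hinv : ∀ γ ∈ thinGroup n ℓ, ∀ z ∈ C, γ • z ∈ C) (k : ℤ) {δ : ℝ} (hδ : 0 < δ) :
    (∃ u ∈ C, |u.re - lo k| < δ ∧ u.im < δ) ∧ (∃ u ∈ C, |u.re - hi k| < δ ∧ u.im < δ) := by
  obtain ⟨p, hp⟩ := hne
  obtain ⟨g, hg, c, hc, h⟩ := D.exists_straighten_smul k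
  have hlh := (D.lo_lt_hi k).ne
  have hpow : ∀ j : ℕ, straighten (lo k) (hi k) (g ^ j • p) =
      (c : ℂ) ^ j * straighten (lo k) (hi k) p := by
    intro j
    induction j with
    | zero => simp
    | succ j ih => rw [pow_succ', mul_smul, h, ih]; ring
  have hpow' : ∀ j : ℕ, straighten (hi k) (lo k) ((g ^ j)⁻¹ • p) =
      (c : ℂ) ^ j * straighten (hi k) (lo k) p := by
    intro j
    have e : ∀ q, straighten (hi k) (lo k) (g • q) = (c : ℂ)⁻¹ * straighten (hi k) (lo k) q := by
      intro q
      rw [straighten_swap hlh, straighten_swap hlh, h]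
      field_simp
    have hc0 : (c : ℂ) ≠ 0 := by
      have : c ≠ 0 := by linarith
      exact_mod_cast this
    induction j with
    | zero => simp
    | succ j ih =>
      have := e ((g ^ (j + 1))⁻¹ • p)
      rw [← mul_smul, pow_succ, mul_inv_rev, mul_inv_cancel_left, ih] at this
      rw [pow_succ g, mul_inv_rev, pow_succ', mul_assoc, this, mul_inv_cancel_left₀ hc0]
  have grow : ∀ s : ℂ, s ≠ 0 → ∀ B : ℝ, ∃ j : ℕ, B < ‖(c : ℂ) ^ j * s‖ := by
    intro s hs B
    obtain ⟨j, hj⟩ := pow_unbounded_of_one_lt (B / ‖s‖) hc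
    refine ⟨j, ?_⟩
    rw [norm_mul, norm_pow, Complex.norm_real, Real.norm_of_nonneg (by linarith)]
    rwa [div_lt_iff₀ (norm_pos_iff.2 hs)] at hj
  constructor
  · refine exists_close hlh (fun B => ?_) hδ
    obtain ⟨j, hj⟩ := grow _ (straighten_ne_zero hlh p) B
    exact ⟨g ^ j • p, hinv _ (pow_mem hg j) p hp, by rwa [hpow]⟩
  · refine exists_close hlh.symm (fun B => ?_) hδ
    obtain ⟨j, hj⟩ := grow _ (straighten_ne_zero hlh.symm p) B
    exact ⟨(g ^ j)⁻¹ • p, hinv _ (inv_mem (pow_mem hg j)) p hp, by rwa [hpow']⟩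

/-- The geodesic joining two opposite, far translates of one point of `C` passes arbitrarily high
above `x`. -/
theorem exists_high (D : ThinData n ℓ M lo hi) {C : Set ℍ} (hne : C.Nonempty) (hC : HypConvex C)
    (hinv : ∀ γ ∈ thinGroup n ℓ, ∀ z ∈ C, γ • z ∈ C) (x Y : ℝ) :
    ∃ u ∈ C, u.re = x ∧ Y < u.im := by
  obtain ⟨p, hp⟩ := hne
  obtain ⟨J, hJ⟩ := exists_nat_gt (|x - p.re| + |Y| + 1)
  have hm : (2 : ℝ) ≤ partialSum n ℓ := by exact_mod_cast D.two_le_partialSum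
  have hp1 := hinv _ (T_zpow_mem (-J)) p hp
  have hp2 := hinv _ (T_zpow_mem J) p hp
  have hJm : (J : ℝ) ≤ J * partialSum n ℓ := by nlinarith [Nat.cast_nonneg (α := ℝ) J]
  have h1 := neg_abs_le (x - p.re)
  have h2 := le_abs_self (x - p.re)
  have h3 := abs_nonneg Y
  have e1 : (ModularGroup.T ^ (-(J : ℤ) * partialSum n ℓ) • p).re = p.re - J * partialSum n ℓ := by
    rw [ModularGroup.re_T_zpow_smul]; push_cast; ring
  have e2 : (ModularGroup.T ^ ((J : ℤ) * partialSum n ℓ) • p).re = p.re + J * partialSum n ℓ := by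
    rw [ModularGroup.re_T_zpow_smul]; push_cast; ring
  obtain ⟨u, hu, hux, t, ht0, ht1, hui⟩ := hC.exists_re_eq hp1 hp2 (x := x)
    (by rw [e1]; linarith) (by rw [e2]; linarith)
  refine ⟨u, hu, hux, ?_⟩
  rw [e1, e2, ModularGroup.im_T_zpow_smul, ModularGroup.im_T_zpow_smul] at hui
  have h5 : (|Y| + 1) * (|Y| + 1) ≤
      (x - (p.re - J * partialSum n ℓ)) * (p.re + J * partialSum n ℓ - x) :=
    mul_le_mul (by linarith) (by linarith) (by linarith) (by linarith)
  have h6 : |Y| ^ 2 < u.im ^ 2 := by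
    have : (1 - t) * p.im ^ 2 + t * p.im ^ 2 = p.im ^ 2 := by ring
    nlinarith [sq_nonneg p.im]
  exact (le_abs_self Y).trans_lt ((sq_lt_sq₀ h3 u.im_pos.le).1 h6)

/-- Depending on the position of `Re z`, the point lies above the geodesic from `hi (k - 1)` to `lo
k`, from `lo k` to `hi k`, or from `hi k` to `lo (k + 1)`. The outer two lie inside unit discs about
`M k` and `M (k + 1)`, which the point avoids. -/
theorem mem_nielsenRegion (D : ThinData n ℓ M lo hi) {z : ℍ} {k : ℤ} (h1 : M k < z.re)
    (h2 : z.re < M (k + 1)) (h3 : 1 < rad (M k) z) (h4 : 1 < rad (M (k + 1)) z)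
    (h5 : 0 < side (lo k) (hi k) z) (h6 : z.re ≠ lo k) (h7 : z.re ≠ hi k) :
    z ∈ nielsenRegion (thinGroup n ℓ) := by
  rintro C ⟨hne, -, hC, hinv⟩
  have hhigh := D.exists_high hne hC hinv
  rcases h6.lt_or_gt with h6 | h6
  · have a := D.lt_hi (k - 1)
    have b := D.hi_lt (k - 1)
    rw [sub_add_cancel] at a b
    have c := D.lo_lt k
    refine hC.mem_of_side_pos (fun δ hδ => (D.exists_close_endpoints hne hinv (k - 1) hδ).2)
      (fun δ hδ => (D.exists_close_endpoints hne hinv k hδ).1) hhigh (by linarith) h6 ?_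
    unfold rad at h3
    unfold side
    -- With `X`, `a`, `b` the offsets of `Re z` and the endpoints from `M k`, the side is greater
    -- than `1 - (a + b) X + a b = X (1 - a) (1 - b) + (1 - X) (1 + a b)`.
    have e1 : 0 < (1 - (hi (k - 1) - M k)) * (1 - (lo k - M k)) := by
      apply mul_pos <;> linarith
    have e2 : 0 < (1 + (hi (k - 1) - M k) * (lo k - M k)) := by nlinarith
    have e3 : 0 < z.re - M k := by linarith
    have e4 : 0 < 1 - (z.re - M k) := by linarith
    have e5 := mul_pos e3 e1
    have e6 := mul_pos e4 e2
    linarith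
  rcases h7.lt_or_gt with h7 | h7
  · exact hC.mem_of_side_pos (fun δ hδ => (D.exists_close_endpoints hne hinv k hδ).1)
      (fun δ hδ => (D.exists_close_endpoints hne hinv k hδ).2) hhigh h6 h7 h5
  · have a := D.lt_lo (k + 1)
    have b := D.lo_lt (k + 1)
    have c := D.lt_hi k
    refine hC.mem_of_side_pos (fun δ hδ => (D.exists_close_endpoints hne hinv k hδ).2)
      (fun δ hδ => (D.exists_close_endpoints hne hinv (k + 1) hδ).1) hhigh h7 (by linarith) ?_
    unfold rad at h4
    unfold side
    have e1 : 0 < (1 + (hi k - M (k + 1))) * (1 + (lo (k + 1) - M (k + 1))) := by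
      apply mul_pos <;> linarith
    have e2 : 0 < (1 + (hi k - M (k + 1)) * (lo (k + 1) - M (k + 1))) := by nlinarith
    have e3 : 0 < -(z.re - M (k + 1)) := by linarith
    have e4 : 0 < 1 + (z.re - M (k + 1)) := by linarith
    have e5 := mul_pos e3 e1
    have e6 := mul_pos e4 e2
    linarith

theorem smul_mem_nielsenRegion {G : Subgroup SL(2, ℤ)} {g : SL(2, ℤ)} (hg : g ∈ G) {z : ℍ}
    (hz : z ∈ nielsenRegion G) : g • z ∈ nielsenRegion G := by
  intro C hC
  exact hC.2.2.2 g hg z (hz C hC)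

end ThinData

/-! ## The configuration attached to a cycle -/

/-- The partial sums of the periodic sequence `n`, indexed by the integers. -/
def cusp (n : ℕ → ℤ) (ℓ : ℕ) (k : ℤ) : ℤ :=
  k / ℓ * partialSum n ℓ + partialSum n (k % ℓ).toNat

theorem cusp_add (n : ℕ → ℤ) {ℓ : ℕ} (hℓ : 0 < ℓ) (k : ℤ) :
    cusp n ℓ (k + ℓ) = cusp n ℓ k + partialSum n ℓ := by
  unfold cusp
  rw [Int.add_ediv_of_dvd_right (dvd_refl _), Int.ediv_self (by omega), Int.add_emod_right]
  ring

theorem cusp_natCast (n : ℕ → ℤ) {ℓ : ℕ} (hℓ : 0 < ℓ) {k : ℕ} (hk : k ≤ ℓ) :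
    cusp n ℓ k = partialSum n k := by
  rcases hk.lt_or_eq with h | rfl
  · unfold cusp
    rw [Int.ediv_eq_zero_of_lt (by omega) (by omega), Int.emod_eq_of_lt (by omega) (by omega)]
    simp
  · unfold cusp
    rw [Int.ediv_self (by omega), Int.emod_self]
    simp [partialSum]

theorem cusp_add_one (n : ℕ → ℤ) {ℓ : ℕ} (hℓ : 0 < ℓ) (k : ℤ) :
    cusp n ℓ (k + 1) = cusp n ℓ k + n (k % ℓ).toNat := by
  have hmul : ∀ i j : ℤ, cusp n ℓ (i + j * ℓ) = cusp n ℓ i + j * partialSum n ℓ := by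
    intro i j
    unfold cusp
    rw [Int.add_mul_ediv_right _ _ (by omega), Int.add_mul_emod_self_right]
    ring
  have hk0 := Int.emod_nonneg k (show (ℓ : ℤ) ≠ 0 by omega)
  have hk1 := Int.emod_lt_of_pos k (show (0 : ℤ) < ℓ by omega)
  have hk : k = ((k % ℓ).toNat : ℤ) + k / ℓ * ℓ := by
    rw [Int.toNat_of_nonneg hk0]
    have := Int.emod_add_mul_ediv k ℓ
    linarith
  have h1 : cusp n ℓ k = partialSum n (k % ℓ).toNat + k / ℓ * partialSum n ℓ := by
    conv_lhs => rw [hk, hmul, cusp_natCast n hℓ (by omega)]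
  have h2 : cusp n ℓ (k + 1) = partialSum n ((k % ℓ).toNat + 1) + k / ℓ * partialSum n ℓ := by
    conv_lhs => rw [hk, show ((k % ℓ).toNat : ℤ) + k / ℓ * ℓ + 1 =
      (((k % ℓ).toNat + 1 : ℕ) : ℤ) + k / ℓ * ℓ by push_cast; ring, hmul,
      cusp_natCast n hℓ (by omega)]
  have h3 : ∀ a, partialSum n (a + 1) = partialSum n a + n a := fun a => by
    simp [partialSum, Finset.sum_range_succ]
  rw [h1, h2, h3]
  ring

section

variable {K : Type*} [Field K] {ι ι' : K →+* ℝ} {n : ℕ → ℤ} {ℓ : ℕ} {W : ℤ → K}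

theorem ReducedCycle.lt (h : ReducedCycle ι ι' n ℓ W) (k : ℤ) : ι' (W k) < ι (W k) :=
  (h.reduced k).2.1.trans (h.reduced k).2.2

theorem ReducedCycle.irr (h : ReducedCycle ι ι' n ℓ W) (k : ℤ) : Irr (W k) :=
  irr_of_ne (h.lt k).ne

theorem Irr.add_intCast {F : Type*} [Field F] {x : F} (hx : Irr x) (m : ℤ) : Irr (x + m) := by
  rw [← mob_T_zpow]; exact hx.mob _

theorem ReducedCycle.two_le (h : ReducedCycle ι ι' n ℓ W) (k : ℤ) : 2 ≤ n (k % ℓ).toNat := by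
  rw [← h.ceil]
  have : (1 : ℤ) < ⌈ι (W k)⌉ := Int.lt_ceil.2 (by exact_mod_cast (h.reduced k).2.2)
  omega

theorem ReducedCycle.thinData (h : ReducedCycle ι ι' n ℓ W) :
    ThinData n ℓ (cusp n ℓ) (fun k => ι' (W k + cusp n ℓ k)) (fun k => ι (W k + cusp n ℓ k)) := by
  have hc := cusp_add_one n h.pos
  have hlt : ∀ k, ι (W k) < n (k % ℓ).toNat ∧ (n (k % ℓ).toNat : ℝ) - 1 < ι (W k) := fun k => by
    rw [← h.ceil]
    exact ⟨((h.irr k).map ι).lt_ceil, by linarith [Int.ceil_lt_add_one (ι (W k))]⟩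
  have hstep : ∀ (φ : K →+* ℝ) k, φ (W (k + 1) + cusp n ℓ (k + 1)) =
      cusp n ℓ (k + 1) - 1 / (φ (W k + cusp n ℓ k) - cusp n ℓ (k + 1)) := by
    intro φ k
    have e : φ (W k + cusp n ℓ k) - cusp n ℓ (k + 1) = -((n (k % ℓ).toNat : ℝ) - φ (W k)) := by
      rw [hc]; simp; ring
    rw [e, h.step, map_add, map_div₀, map_sub, map_one, map_intCast, map_intCast, div_neg]
    ring
  refine ⟨h.pos, fun k hk => cusp_natCast n h.pos hk, fun k => ?_, fun k => cusp_add n h.pos k,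
    fun k => ?_, fun k => ?_, fun k => ?_, fun k => ?_, fun k => ?_, fun k => ?_, hstep ι',
    hstep ι, fun k => ((h.irr k).add_intCast _).map ι', fun k => ((h.irr k).add_intCast _).map ι⟩
  · have := h.two_le k
    rw [hc]; linarith
  · rw [h.periodic, cusp_add n h.pos]; push_cast; simp; ring
  · rw [h.periodic, cusp_add n h.pos]; push_cast; simp; ring
  · have := (h.reduced k).1
    simp; linarith
  · have := (h.reduced k).2.1
    simp; linarith
  · have := (hlt k).2
    rw [hc]; push_cast; simp; linarith
  · have := (hlt k).1
    rw [hc]; push_cast; simp; linarith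

/-- Genericity of a point: it avoids the geodesics and vertical lines relevant for `K`. -/
structure Generic (ι ι' : K →+* ℝ) (z : ℍ) : Prop where
  lattice : ∀ a b c : ℤ, a * (z.re ^ 2 + z.im ^ 2) + b * z.re + c = 0 → a = 0 ∧ b = 0 ∧ c = 0
  re_ne : ∀ w, z.re ≠ ι w ∧ z.re ≠ ι' w
  side_ne : ∀ w, ι' w ≠ ι w → side (ι' w) (ι w) z ≠ 0

theorem Generic.re_ne_intCast {z : ℍ} (h : Generic ι ι' z) (m : ℤ) : z.re ≠ m := fun e => by
  have := h.lattice 0 1 (-m) (by push_cast; rw [e]; ring)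
  omega

theorem Generic.rad_ne {z : ℍ} (h : Generic ι ι' z) (m : ℤ) : rad m z ≠ 1 := fun e => by
  have := h.lattice 1 (-2 * m) (m ^ 2 - 1) (by
    unfold rad at e
    push_cast
    linear_combination e)
  omega

theorem Generic.nsq_ne {z : ℍ} (h : Generic ι ι' z) : z.re ^ 2 + z.im ^ 2 ≠ 1 := fun e => by
  have := h.lattice 1 0 (-1) (by push_cast; linear_combination e)
  omega

theorem Generic.re_ne_half {z : ℍ} (h : Generic ι ι' z) : z.re ≠ 1 / 2 := fun e => by
  have := h.lattice 0 2 (-1) (by push_cast; linear_combination 2 * e)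
  omega

theorem Generic.nsq_ne_two_mul {z : ℍ} (h : Generic ι ι' z) :
    z.re ^ 2 + z.im ^ 2 ≠ 2 * z.re := fun e => by
  have := h.lattice 1 (-2) 0 (by push_cast; linear_combination e)
  omega

theorem smul_mem_leftSide_mob {w : K} (hw : Irr w) (γ : SL(2, ℤ)) {z : ℍ} :
    γ • z ∈ leftSide (ι' (mob γ w)) (ι (mob γ w)) ↔ z ∈ leftSide (ι' w) (ι w) := by
  rw [map_mob, map_mob]
  exact smul_mem_leftSide γ ((hw.map ι').den_ne_zero _) ((hw.map ι).den_ne_zero _)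

/-- Two equivalent generic points of `stdPolygon` are equal. -/
theorem eq_of_mem_stdPolygon {z : ℍ} {γ : SL(2, ℤ)} (hz : z ∈ stdPolygon) (hγ : γ • z ∈ stdPolygon)
    (h1 : Generic ι ι' z) (h2 : Generic ι ι' (γ • z)) : γ = 1 ∨ γ = -1 :=
  eq_one_or_neg_one_of_mem_stdPolygon hz hγ h1.nsq_ne h2.nsq_ne

/-! ## Points of the Nielsen region in an orbit -/

/-- Index set for the triangles making up a fundamental domain of the Nielsen region, together
with the three translates of `stdPolygon` in each. -/
def indexSet (n : ℕ → ℤ) (ℓ : ℕ) : Set (ℤ × ℤ × ℕ) :=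
  {p | 0 ≤ p.1 ∧ p.1 < ℓ ∧ 0 ≤ p.2.1 ∧ p.2.1 + 2 ≤ n (p.1 % ℓ).toNat ∧ p.2.2 < 3}

theorem indexSet_finite (n : ℕ → ℤ) (ℓ : ℕ) : (indexSet n ℓ).Finite := by
  obtain ⟨B, hB⟩ := ((Finset.Ico (0 : ℤ) ℓ).image fun k : ℤ => n (k % ℓ).toNat).exists_le
  refine Set.Finite.subset (((Finset.Ico (0 : ℤ) ℓ) ×ˢ ((Finset.Icc (0 : ℤ) B) ×ˢ
    (Finset.range 3))).finite_toSet) ?_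
  rintro ⟨k, j, i⟩ ⟨h1, h2, h3, h4, h5⟩
  have := hB (n (k % ℓ).toNat) (Finset.mem_image.2 ⟨k, Finset.mem_Ico.2 ⟨h1, h2⟩, rfl⟩)
  simp only [Finset.coe_product, Set.mem_prod, Finset.mem_coe, Finset.mem_Ico, Finset.mem_Icc,
    Finset.mem_range]
  simp only at h1 h2 h3 h4 h5
  exact ⟨⟨h1, h2⟩, ⟨h3, by omega⟩, h5⟩

/-- The group element moving `stdPolygon` to the polygon with the given index. -/
def indexElt (n : ℕ → ℤ) (ℓ : ℕ) (p : ℤ × ℤ × ℕ) : SL(2, ℤ) :=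
  ModularGroup.T ^ (cusp n ℓ p.1 + p.2.1) * rot ^ p.2.2

/-- The number whose geodesic is the boundary of the Nielsen region, as seen from the polygon with
the given index. -/
def indexNum (W : ℤ → K) (p : ℤ × ℤ × ℕ) : K := mob (rot ^ p.2.2)⁻¹ (W p.1 - p.2.1)

theorem ReducedCycle.irr_sub (h : ReducedCycle ι ι' n ℓ W) (k j : ℤ) : Irr (W k - j) := by
  have := (h.irr k).add_intCast (-j)
  rwa [Int.cast_neg, ← sub_eq_add_neg] at this

theorem ReducedCycle.irr_indexNum (h : ReducedCycle ι ι' n ℓ W) (p : ℤ × ℤ × ℕ) :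
    Irr (indexNum W p) := (h.irr_sub _ _).mob _

theorem ReducedCycle.mob_indexElt (h : ReducedCycle ι ι' n ℓ W) (p : ℤ × ℤ × ℕ) :
    mob (indexElt n ℓ p) (indexNum W p) = W p.1 + cusp n ℓ p.1 := by
  rw [indexElt, mob_mul _ _ ((h.irr_indexNum p).den_ne_zero _), indexNum,
    mob_mob_inv (h.irr_sub _ _), mob_T_zpow]
  push_cast; ring

theorem ReducedCycle.smul_mem_leftSide_iff (h : ReducedCycle ι ι' n ℓ W) (p : ℤ × ℤ × ℕ) (z : ℍ) :
    indexElt n ℓ p • z ∈ leftSide (ι' (W p.1 + cusp n ℓ p.1)) (ι (W p.1 + cusp n ℓ p.1)) ↔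
      z ∈ leftSide (ι' (indexNum W p)) (ι (indexNum W p)) := by
  rw [← h.mob_indexElt, smul_mem_leftSide_mob (h.irr_indexNum p)]

/-- The intervals from `M k` to `M (k + 1)` tile the integers, so a floor determines the strip and
the triangle. -/
theorem cusp_unique {M : ℤ → ℤ} {lo hi : ℤ → ℝ} (D : ThinData n ℓ M lo hi) {k k' j j' : ℤ}
    (h : M k + j = M k' + j') (h0 : 0 ≤ j) (h1 : j < M (k + 1) - M k) (h0' : 0 ≤ j')
    (h1' : j' < M (k' + 1) - M k') : k = k' ∧ j = j' := by
  rcases lt_trichotomy k k' with hlt | rfl | hlt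
  · have := D.M_le (show k + 1 ≤ k' by omega); omega
  · exact ⟨rfl, by omega⟩
  · have := D.M_le (show k' + 1 ≤ k by omega); omega

variable {z₀ : ℍ}

theorem re_indexElt_smul (p : ℤ × ℤ × ℕ) : (indexElt n ℓ p • z₀).re =
    (rot ^ p.2.2 • z₀).re + (cusp n ℓ p.1 + p.2.1) := by
  rw [indexElt, mul_smul, ModularGroup.re_T_zpow_smul]; push_cast; ring

theorem im_indexElt_smul (p : ℤ × ℤ × ℕ) : (indexElt n ℓ p • z₀).im = (rot ^ p.2.2 • z₀).im := by
  rw [indexElt, mul_smul, ModularGroup.im_T_zpow_smul]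

/-- Each indexed point, or its image under a half-turn, lies outside all the unit discs. -/
theorem ReducedCycle.exists_outside (h : ReducedCycle ι ι' n ℓ W) (hz₀ : z₀ ∈ stdPolygon)
    (hgen : ∀ γ : SL(2, ℤ), Generic ι ι' (γ • z₀)) {p : ℤ × ℤ × ℕ} (hp : p ∈ indexSet n ℓ) :
    (∀ k, 1 < rad (cusp n ℓ k) (indexElt n ℓ p • z₀)) ∨
    (p.2.1 = 0 ∧ (∀ k, 1 < rad (cusp n ℓ k) (rho (cusp n ℓ p.1) • indexElt n ℓ p • z₀)) ∧
      cusp n ℓ p.1 - 1 < (rho (cusp n ℓ p.1) • indexElt n ℓ p • z₀).re ∧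
      (rho (cusp n ℓ p.1) • indexElt n ℓ p • z₀).re < cusp n ℓ p.1) := by
  have D := h.thinData
  obtain ⟨k, j, i⟩ := p
  obtain ⟨hk0, hk1, hj0, hj1, hi⟩ := hp
  simp only at hk0 hk1 hj0 hj1 hi ⊢
  have hc := cusp_add_one n h.pos k
  obtain ⟨v1, v2, v3⟩ := rot_pow_smul_mem_triangle (stdPolygon_subset_triangle hz₀) i
  have hre := re_indexElt_smul (n := n) (ℓ := ℓ) (z₀ := z₀) (k, j, i)
  have him := im_indexElt_smul (n := n) (ℓ := ℓ) (z₀ := z₀) (k, j, i)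
  simp only at hre him
  have hj0' : (0 : ℝ) ≤ j := by exact_mod_cast hj0
  have hbig : (cusp n ℓ k : ℝ) + j + 2 ≤ cusp n ℓ (k + 1) := by
    exact_mod_cast (show cusp n ℓ k + j + 2 ≤ cusp n ℓ (k + 1) by omega)
  have hother : ∀ k', k' ≠ k → 1 < rad (cusp n ℓ k') (indexElt n ℓ (k, j, i) • z₀) := by
    intro k' hk'
    apply one_lt_rad_of_le
    rcases hk'.lt_or_gt with hlt | hlt
    · have := D.M_lt hlt
      rw [hre, abs_of_nonneg (by linarith)]; linarith
    · have := D.M_mono (show k + 1 ≤ k' by omega)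
      rw [hre, abs_of_nonpos (by linarith)]; linarith
  rcases ((hgen (indexElt n ℓ (k, j, i))).rad_ne (cusp n ℓ k)).lt_or_gt with hr | hr
  · right
    -- Among the indexed triangles of the strip only the first reaches into the disc about `M k`;
    -- the one touching `M (k + 1)` on its left is excluded from the index set.
    have hj : j = 0 := by
      have := (abs_lt.1 (abs_lt_of_rad_lt hr)).2
      rw [hre] at this
      have : (j : ℝ) < 1 := by linarith
      have : j < 1 := by exact_mod_cast this
      omega
    subst hj
    have hrad : rad (cusp n ℓ k) (indexElt n ℓ (k, 0, i) • z₀) =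
        (rot ^ i • z₀).re ^ 2 + (rot ^ i • z₀).im ^ 2 := by
      unfold rad
      rw [hre, him]; push_cast; ring
    have hpos := rad_pos (cusp n ℓ k) (indexElt n ℓ (k, 0, i) • z₀)
    have hre2 : (rho (cusp n ℓ k) • indexElt n ℓ (k, 0, i) • z₀).re =
        cusp n ℓ k - (rot ^ i • z₀).re / ((rot ^ i • z₀).re ^ 2 + (rot ^ i • z₀).im ^ 2) := by
      rw [re_rho_smul, ← hrad, hre]
      unfold rad
      push_cast
      rw [hre]; push_cast
      congr 2; ring
    rw [hrad] at hpos hr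
    have b1 := div_pos v1 hpos
    have b2 := (div_lt_one hpos).2 v3
    refine ⟨rfl, fun k' => ?_, by rw [hre2]; linarith, by rw [hre2]; linarith⟩
    by_cases hk' : k' = k
    · subst hk'
      rw [rad_rho_smul, hrad, one_lt_div hpos]
      exact hr
    · apply one_lt_rad_of_le
      rcases (show k' ≠ k from hk').lt_or_gt with hlt | hlt
      · have := D.M_lt hlt
        rw [hre2, abs_of_nonneg (by linarith)]; linarith
      · have := D.M_lt hlt
        rw [hre2, abs_of_nonpos (by linarith)]; linarith
  · left
    intro k'
    by_cases hk' : k' = k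
    · rw [hk']; exact hr
    · exact hother k' hk'

theorem ReducedCycle.smul_mem_nielsenRegion (h : ReducedCycle ι ι' n ℓ W) (hz₀ : z₀ ∈ stdPolygon)
    (hgen : ∀ γ : SL(2, ℤ), Generic ι ι' (γ • z₀)) {p : ℤ × ℤ × ℕ} (hp : p ∈ indexSet n ℓ)
    (hl : z₀ ∈ leftSide (ι' (indexNum W p)) (ι (indexNum W p))) :
    indexElt n ℓ p • z₀ ∈ nielsenRegion (thinGroup n ℓ) := by
  have D := h.thinData
  rw [← h.smul_mem_leftSide_iff] at hl
  have hside : ∀ (γ : SL(2, ℤ)) k, γ • z₀ ∈ leftSide (ι' (W k + cusp n ℓ k))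
      (ι (W k + cusp n ℓ k)) → 0 < side (ι' (W k + cusp n ℓ k)) (ι (W k + cusp n ℓ k)) (γ • z₀) := by
    intro γ k hk
    rw [mem_leftSide_of_lt (D.lo_lt_hi k)] at hk
    exact lt_of_le_of_ne hk ((hgen γ).side_ne _ (D.lo_lt_hi k).ne).symm
  rcases h.exists_outside hz₀ hgen hp with ho | ⟨hj, ho, h1, h2⟩
  · obtain ⟨k, j, i⟩ := p
    obtain ⟨hk0, hk1, hj0, hj1, hi⟩ := hp
    simp only at hk0 hk1 hj0 hj1 hi hl
    have hc := cusp_add_one n h.pos k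
    obtain ⟨v1, v2, v3⟩ := rot_pow_smul_mem_triangle (stdPolygon_subset_triangle hz₀) i
    have hre := re_indexElt_smul (n := n) (ℓ := ℓ) (z₀ := z₀) (k, j, i)
    simp only at hre
    have hj0' : (0 : ℝ) ≤ j := by exact_mod_cast hj0
    have hbig : (cusp n ℓ k : ℝ) + j + 2 ≤ cusp n ℓ (k + 1) := by
      exact_mod_cast (show cusp n ℓ k + j + 2 ≤ cusp n ℓ (k + 1) by omega)
    exact D.mem_nielsenRegion (k := k) (by linarith) (by linarith) (ho k) (ho (k + 1))
      (hside _ _ hl) ((hgen _).re_ne _).2 ((hgen _).re_ne _).1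
  · have hl' := D.rho_smul_mem_leftSide (p.1 - 1) (rho (cusp n ℓ p.1) • indexElt n ℓ p • z₀)
    rw [sub_add_cancel, rho_smul_rho_smul] at hl'
    have hl2 := hl'.1 hl
    have hM := D.M_lt (sub_one_lt p.1)
    rw [← mul_smul] at hl2 h1 h2 ho
    have hmem := D.mem_nielsenRegion (k := p.1 - 1) (z := (rho (cusp n ℓ p.1) * indexElt n ℓ p) • z₀)
      (by linarith) (by rw [sub_add_cancel]; exact h2) (ho _) (by rw [sub_add_cancel]; exact ho _)
      (hside _ _ hl2) ((hgen _).re_ne _).2 ((hgen _).re_ne _).1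
    have := ThinData.smul_mem_nielsenRegion (D.rho_mem p.1) hmem
    rwa [mul_smul, rho_smul_rho_smul] at this

theorem floor_eq_of_lt {x : ℝ} {m : ℤ} (h1 : (m : ℝ) < x) (h2 : x < m + 1) : ⌊x⌋ = m :=
  Int.floor_eq_iff.2 ⟨h1.le, h2⟩

theorem rot_pow_smul_injective (hz₀ : z₀ ∈ stdPolygon) (hgen : Generic ι ι' z₀) {i j : ℕ}
    (hi : i < 3) (hj : j < 3) (h : rot ^ i • z₀ = rot ^ j • z₀) : i = j := by
  have h1 : ((rot ^ j)⁻¹ * rot ^ i) • z₀ = z₀ := by rw [mul_smul, h, inv_smul_smul]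
  have h2 := eq_of_mem_stdPolygon (γ := (rot ^ j)⁻¹ * rot ^ i) hz₀ (by rwa [h1]) hgen (by rwa [h1])
  rw [inv_mul_eq_iff_eq_mul, inv_mul_eq_iff_eq_mul] at h2
  revert h2
  clear h h1
  interval_cases i <;> interval_cases j <;> first | (intro _; rfl) | (intro h; revert h; decide)

/-- Different indexed points are inequivalent under the thin group. -/
theorem ReducedCycle.index_injective (h : ReducedCycle ι ι' n ℓ W) (hz₀ : z₀ ∈ stdPolygon)
    (hgen : ∀ γ : SL(2, ℤ), Generic ι ι' (γ • z₀)) {p q : ℤ × ℤ × ℕ} (hp : p ∈ indexSet n ℓ)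
    (hq : q ∈ indexSet n ℓ) {g : SL(2, ℤ)} (hg : g ∈ thinGroup n ℓ)
    (hpq : g • indexElt n ℓ p • z₀ = indexElt n ℓ q • z₀) : p = q := by
  have D := h.thinData
  have hfl : ∀ p : ℤ × ℤ × ℕ, ⌊(indexElt n ℓ p • z₀).re⌋ = cusp n ℓ p.1 + p.2.1 := by
    intro p
    obtain ⟨v1, v2, v3⟩ := rot_pow_smul_mem_triangle (stdPolygon_subset_triangle hz₀) p.2.2
    rw [re_indexElt_smul]
    apply floor_eq_of_lt <;> push_cast <;> linarith
  have hflT : ∀ (m : ℤ) (z : ℍ), ⌊(ModularGroup.T ^ m • z).re⌋ = ⌊z.re⌋ + m := fun m z => by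
    rw [ModularGroup.re_T_zpow_smul, Int.floor_add_intCast]
  have hn : ∀ k, cusp n ℓ (k + 1) - cusp n ℓ k = n (k % ℓ).toNat := fun k => by
    rw [cusp_add_one n h.pos]; ring
  have hrange : ∀ {j : ℤ}, p.1 + j * ℓ = q.1 → j = 0 := by
    intro j hj
    have h1 := hp.1
    have h2 := hp.2.1
    have h3 := hq.1
    have h4 := hq.2.1
    have hℓ := h.pos
    rcases lt_trichotomy j 0 with hlt | rfl | hlt
    · nlinarith
    · rfl
    · nlinarith
  have hfin : indexElt n ℓ p • z₀ = indexElt n ℓ q • z₀ → p.1 = q.1 → p.2.1 = q.2.1 → p = q := by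
    intro he h1 h2
    unfold indexElt at he
    rw [h1, h2, mul_smul, mul_smul, smul_left_cancel_iff] at he
    have := rot_pow_smul_injective hz₀ (by simpa using hgen 1) hp.2.2.2.2 hq.2.2.2.2 he
    ext
    · exact h1
    · exact h2
    · exact this
  have hadd : ∀ k j : ℤ, cusp n ℓ k + j * partialSum n ℓ = cusp n ℓ (k + j * ℓ) :=
    fun k j => (D.M_add_mul k j).symm
  have hmod : ∀ k j : ℤ, (k + j * ℓ) % ℓ = k % ℓ := fun k j => Int.add_mul_emod_self_right _ _ _
  obtain ⟨-, -, pj0, pj1, -⟩ := id hp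
  obtain ⟨-, -, qj0, qj1, -⟩ := id hq
  rcases h.exists_outside hz₀ hgen hp with hpo | ⟨hpj, hpo, hp1, hp2⟩ <;>
    rcases h.exists_outside hz₀ hgen hq with hqo | ⟨hqj, hqo, hq1, hq2⟩
  · obtain ⟨j, hj⟩ := D.exists_rad_lt hg hpo (by rwa [hpq])
    rw [hpq] at hj
    have hf := congrArg (fun z : ℍ => ⌊z.re⌋) hj
    simp only [hflT, hfl] at hf
    have hu := cusp_unique D (k := q.1) (k' := p.1 + j * ℓ) (j := q.2.1) (j' := p.2.1)
      (by rw [← hadd]; linarith) qj0 (by rw [hn]; omega) pj0 (by rw [hn, hmod]; omega)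
    have hj0 := hrange hu.1.symm
    subst hj0
    refine hfin ?_ (by linarith [hu.1]) hu.2.symm
    rw [hj]; simp
  · exfalso
    have hq' : (rho (cusp n ℓ q.1) * g) • indexElt n ℓ p • z₀ =
        rho (cusp n ℓ q.1) • indexElt n ℓ q • z₀ := by rw [mul_smul, hpq]
    obtain ⟨j, hj⟩ := D.exists_rad_lt (mul_mem (D.rho_mem q.1) hg) hpo (by rwa [hq'])
    rw [hq'] at hj
    have hf := congrArg (fun z : ℍ => ⌊z.re⌋) hj
    -- This representative lies over the last triangle of the preceding strip, which carries no
    -- index; so it cannot be a translate of an indexed point.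
    have hf2 : ⌊(rho (cusp n ℓ q.1) • indexElt n ℓ q • z₀).re⌋ = cusp n ℓ q.1 - 1 :=
      floor_eq_of_lt (by push_cast; exact hq1) (by push_cast; linarith)
    simp only [hflT, hfl, hf2] at hf
    have hn1 := hn (q.1 - 1)
    rw [sub_add_cancel] at hn1
    have := h.two_le (q.1 - 1)
    have hu := cusp_unique D (k := q.1 - 1) (k' := p.1 + j * ℓ)
      (j := n ((q.1 - 1) % ℓ).toNat - 1) (j' := p.2.1) (by rw [← hadd]; linarith)
      (by omega) (by rw [hn]; omega) pj0 (by rw [hn, hmod]; omega)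
    rw [hu.1, hmod] at hu
    omega
  · exfalso
    have hp' : (g * rho (cusp n ℓ p.1)) • rho (cusp n ℓ p.1) • indexElt n ℓ p • z₀ =
        indexElt n ℓ q • z₀ := by rw [mul_smul, rho_smul_rho_smul, hpq]
    obtain ⟨j, hj⟩ := D.exists_rad_lt (mul_mem hg (D.rho_mem p.1)) hpo (by rwa [hp'])
    rw [hp'] at hj
    have hf := congrArg (fun z : ℍ => ⌊z.re⌋) hj
    have hf2 : ⌊(rho (cusp n ℓ p.1) • indexElt n ℓ p • z₀).re⌋ = cusp n ℓ p.1 - 1 :=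
      floor_eq_of_lt (by push_cast; exact hp1) (by push_cast; linarith)
    simp only [hflT, hfl, hf2] at hf
    have hn1 := hn (p.1 + j * ℓ - 1)
    rw [sub_add_cancel, ← hadd] at hn1
    have := h.two_le (p.1 + j * ℓ - 1)
    have hu := cusp_unique D (k := p.1 + j * ℓ - 1) (k' := q.1)
      (j := n ((p.1 + j * ℓ - 1) % ℓ).toNat - 1) (j' := q.2.1) (by linarith)
      (by omega) (by rw [hn]; omega) qj0 (by rw [hn]; omega)
    rw [hu.1] at hu
    omega
  · have hpq' : (rho (cusp n ℓ q.1) * g * rho (cusp n ℓ p.1)) •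
        rho (cusp n ℓ p.1) • indexElt n ℓ p • z₀ = rho (cusp n ℓ q.1) • indexElt n ℓ q • z₀ := by
      rw [mul_smul, mul_smul, rho_smul_rho_smul, hpq]
    obtain ⟨j, hj⟩ := D.exists_rad_lt (mul_mem (mul_mem (D.rho_mem q.1) hg) (D.rho_mem p.1)) hpo
      (by rwa [hpq'])
    rw [hpq'] at hj
    have hf := congrArg (fun z : ℍ => ⌊z.re⌋) hj
    have hf1 : ⌊(rho (cusp n ℓ p.1) • indexElt n ℓ p • z₀).re⌋ = cusp n ℓ p.1 - 1 :=
      floor_eq_of_lt (by push_cast; exact hp1) (by push_cast; linarith)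
    have hf2 : ⌊(rho (cusp n ℓ q.1) • indexElt n ℓ q • z₀).re⌋ = cusp n ℓ q.1 - 1 :=
      floor_eq_of_lt (by push_cast; exact hq1) (by push_cast; linarith)
    simp only [hflT, hf1, hf2] at hf
    have hu := cusp_unique D (k := q.1) (k' := p.1 + j * ℓ) (j := 0) (j' := 0)
      (by rw [← hadd]; linarith) le_rfl (by rw [hn]; omega) le_rfl (by rw [hn, hmod]; omega)
    have hj0 := hrange hu.1.symm
    subst hj0
    have hk : p.1 = q.1 := by linarith [hu.1]
    refine hfin ?_ hk (by rw [hpj, hqj])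
    rw [hk] at hj
    simpa using hj.symm

/-- Each point of the orbit in the Nielsen region is equivalent to an indexed point. -/
theorem ReducedCycle.exists_index (h : ReducedCycle ι ι' n ℓ W) (hz₀ : z₀ ∈ stdPolygon)
    (hgen : ∀ γ : SL(2, ℤ), Generic ι ι' (γ • z₀)) {δ : SL(2, ℤ)}
    (hδ : δ • z₀ ∈ nielsenRegion (thinGroup n ℓ)) : ∃ g ∈ thinGroup n ℓ, ∃ p ∈ indexSet n ℓ,
      z₀ ∈ leftSide (ι' (indexNum W p)) (ι (indexNum W p)) ∧
      g • δ • z₀ = indexElt n ℓ p • z₀ := by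
  have D := h.thinData
  have hℓ := h.pos
  have hn : ∀ k, cusp n ℓ (k + 1) - cusp n ℓ k = n (k % ℓ).toNat := fun k => by
    rw [cusp_add_one n h.pos]; ring
  have key : ∀ (γ : SL(2, ℤ)) (k j : ℤ), 0 ≤ k → k < ℓ → 0 ≤ j → j + 2 ≤ n (k % ℓ).toNat →
      γ • z₀ ∈ leftSide (ι' (W k + cusp n ℓ k)) (ι (W k + cusp n ℓ k)) →
      ModularGroup.T ^ (-(cusp n ℓ k + j)) • γ • z₀ ∈ triangle → ∃ p ∈ indexSet n ℓ,
      z₀ ∈ leftSide (ι' (indexNum W p)) (ι (indexNum W p)) ∧ γ • z₀ = indexElt n ℓ p • z₀ := by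
    intro γ k j hk0 hk1 hj0 hj1 hl ht
    rw [← mul_smul] at ht
    have hg := hgen (ModularGroup.T ^ (-(cusp n ℓ k + j)) * γ)
    obtain ⟨i, hi, w, hw, he⟩ := exists_rot_pow_smul_mem_stdPolygon ht hg.re_ne_half hg.nsq_ne
      hg.nsq_ne_two_mul
    have hw' : w = ((rot ^ i)⁻¹ * (ModularGroup.T ^ (-(cusp n ℓ k + j)) * γ)) • z₀ := by
      rw [mul_smul, he, inv_smul_smul]
    have := eq_of_mem_stdPolygon hz₀ (hw' ▸ hw) (by simpa using hgen 1) (hgen _)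
    have hwz : w = z₀ := by
      rw [hw']
      rcases this with h | h <;> rw [h] <;> simp
    rw [hwz] at he
    have hp : γ • z₀ = indexElt n ℓ (k, j, i) • z₀ := by
      rw [indexElt, mul_smul, ← he, mul_smul, ← mul_smul, ← zpow_add]; simp
    refine ⟨(k, j, i), ⟨hk0, hk1, hj0, hj1, hi⟩, ?_, hp⟩
    rw [← h.smul_mem_leftSide_iff, ← hp]
    exact hl
  obtain ⟨g, hg, hrad, k, hk0, hk1, hre0, hre1⟩ := D.exists_smul_mem_strip (δ • z₀)
  have hN := ThinData.smul_mem_nielsenRegion hg hδ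
  rw [← mul_smul] at hrad hre0 hre1 hN
  have hG := hgen (g * δ)
  have hrad' : ∀ k, 1 < rad (cusp n ℓ k) ((g * δ) • z₀) := fun k =>
    lt_of_le_of_ne (hrad k) (hG.rad_ne _).symm
  have hl := D.nielsenRegion_subset_leftSide k hN
  obtain ⟨u, hu⟩ : ∃ u, u = (g * δ) • z₀ := ⟨_, rfl⟩
  obtain ⟨j, hj⟩ : ∃ j, j = ⌊u.re⌋ - cusp n ℓ k := ⟨_, rfl⟩
  have hf1 : ((cusp n ℓ k + j : ℤ) : ℝ) < u.re := by
    have := Int.floor_le u.re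
    rw [show cusp n ℓ k + j = ⌊u.re⌋ by omega]
    exact lt_of_le_of_ne this (by rw [hu]; exact (hG.re_ne_intCast _).symm)
  have hf2 : u.re < ((cusp n ℓ k + j : ℤ) : ℝ) + 1 := by
    have := Int.lt_floor_add_one u.re
    rwa [show cusp n ℓ k + j = ⌊u.re⌋ by omega]
  rw [← hu] at hre0 hre1 hl hrad'
  have hj0 : 0 ≤ j := by
    have : cusp n ℓ k ≤ ⌊u.re⌋ := Int.le_floor.2 hre0
    omega
  have hj1 : j + 1 ≤ n (k % ℓ).toNat := by
    have : ⌊u.re⌋ < cusp n ℓ (k + 1) := Int.floor_lt.2 hre1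
    have := hn k
    omega
  push_cast at hf1 hf2
  have hr0 := hrad' k
  have hr1 := hrad' (k + 1)
  unfold rad at hr0 hr1
  have hcs : (cusp n ℓ (k + 1) : ℝ) = cusp n ℓ k + n (k % ℓ).toNat := by
    rw [cusp_add_one n h.pos]; push_cast; rfl
  have hv : ModularGroup.T ^ (-(cusp n ℓ k + j)) • u ∈ triangle := by
    -- The bottom edge of the triangle is avoided for different reasons: at the two ends of the
    -- strip because it lies in a unit disc, in between because it lies under the boundary geodesic.
    have h3 : u.re - (cusp n ℓ k + j) < (u.re - (cusp n ℓ k + j)) ^ 2 + u.im ^ 2 := by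
      rcases hj0.eq_or_lt with hj' | hj'
      · rw [← hj'] at hf1 hf2 ⊢
        push_cast at hf1 hf2 ⊢
        rw [add_zero] at *
        linarith
      rcases (show j + 1 ≤ n (k % ℓ).toNat from hj1).eq_or_lt with hj2 | hj2
      · rw [hcs, ← hj2] at hr1
        push_cast at hr1
        nlinarith
      · rw [mem_leftSide_of_lt (D.lo_lt_hi k)] at hl
        have a := D.lo_lt k
        have b := D.lt_hi k
        rw [hcs] at b
        have c : (1 : ℝ) ≤ j := by exact_mod_cast hj'
        have d : (j : ℝ) + 2 ≤ n (k % ℓ).toNat := by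
          exact_mod_cast (show j + 2 ≤ n (k % ℓ).toNat by omega)
        unfold side at hl
        have e1 : 0 < u.re - (cusp n ℓ k + j) := by linarith
        have e2 : 0 < 1 - (u.re - (cusp n ℓ k + j)) := by linarith
        have e3 : u.re - (cusp n ℓ k + j) < u.re - ι' (W k + cusp n ℓ k) := by linarith
        have e4 : 1 - (u.re - (cusp n ℓ k + j)) < ι (W k + cusp n ℓ k) - u.re := by linarith
        have e5 := mul_lt_mul'' e3 e4 e1.le e2.le
        nlinarith
    refine ⟨?_, ?_, ?_⟩ <;> rw [ModularGroup.re_T_zpow_smul] <;>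
      try rw [ModularGroup.im_T_zpow_smul]
    · push_cast; linarith
    · push_cast; linarith
    · push_cast
      have e : u.re + -((cusp n ℓ k : ℝ) + j) = u.re - (cusp n ℓ k + j) := by ring
      rw [e]; exact h3
  -- In the last triangle of the strip the half-turn about `M (k + 1) + i` moves the point to the
  -- first triangle of the next strip, followed by a translation when `k + 1 = ℓ`.
  rcases hj1.lt_or_eq with hj2 | hj2
  · obtain ⟨p, hp, h1, h2⟩ := key (g * δ) k j hk0 hk1 hj0 (by omega) (hu ▸ hl) (hu ▸ hv)
    exact ⟨g, hg, p, hp, h1, by rw [← h2, mul_smul]⟩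
  · have hl' := (D.rho_smul_mem_leftSide k u).2 hl
    have hX : 0 < -(u.re - cusp n ℓ (k + 1)) := by linarith
    have hX1 : -(u.re - cusp n ℓ (k + 1)) < 1 := by
      rw [hcs, ← hj2]; push_cast; linarith
    have hq : 0 < (u.re - cusp n ℓ (k + 1)) ^ 2 + u.im ^ 2 := by linarith
    have ht : ModularGroup.T ^ (-cusp n ℓ (k + 1)) • rho (cusp n ℓ (k + 1)) • u ∈ triangle := by
      have e1 : (ModularGroup.T ^ (-cusp n ℓ (k + 1)) • rho (cusp n ℓ (k + 1)) • u).re =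
          -(u.re - cusp n ℓ (k + 1)) / ((u.re - cusp n ℓ (k + 1)) ^ 2 + u.im ^ 2) := by
        rw [ModularGroup.re_T_zpow_smul, re_rho_smul]; push_cast; ring
      have e2 : (ModularGroup.T ^ (-cusp n ℓ (k + 1)) • rho (cusp n ℓ (k + 1)) • u).re ^ 2 +
          (ModularGroup.T ^ (-cusp n ℓ (k + 1)) • rho (cusp n ℓ (k + 1)) • u).im ^ 2 =
          1 / ((u.re - cusp n ℓ (k + 1)) ^ 2 + u.im ^ 2) := by
        have := rad_rho_smul (cusp n ℓ (k + 1)) u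
        unfold rad at this
        rw [← this, ModularGroup.re_T_zpow_smul, ModularGroup.im_T_zpow_smul]
        push_cast; ring
      refine ⟨?_, ?_, ?_⟩
      · rw [e1]; exact div_pos hX hq
      · rw [e1, div_lt_one hq]; linarith
      · rw [e2, e1]; gcongr
    rcases (show k + 1 ≤ ℓ by omega).lt_or_eq with hk2 | hk2
    · obtain ⟨p, hp, h1, h2⟩ := key (rho (cusp n ℓ (k + 1)) * (g * δ)) (k + 1) 0 (by omega) hk2
        le_rfl (by have := h.two_le (k + 1); omega) (by rw [mul_smul, ← hu]; exact hl')
        (by rw [mul_smul, ← hu, add_zero]; exact ht)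
      exact ⟨_, mul_mem (D.rho_mem (k + 1)) hg, p, hp, h1, by rw [← h2]; simp only [mul_smul]⟩
    · have hM : cusp n ℓ (k + 1) = cusp n ℓ 0 + partialSum n ℓ := by
        have := D.M_add 0
        rw [zero_add] at this
        rw [hk2]; exact this
      obtain ⟨p, hp, h1, h2⟩ := key (ModularGroup.T ^ (-1 * partialSum n ℓ) *
          (rho (cusp n ℓ (k + 1)) * (g * δ))) 0 0 le_rfl (by omega)
        le_rfl (by have := h.two_le 0; omega) (by
          rw [mul_smul, mul_smul, ← hu]
          have := (D.T_smul_mem_leftSide (k + 1) (-1) (rho (cusp n ℓ (k + 1)) • u)).2 hl'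
          rwa [show k + 1 + -1 * (ℓ : ℤ) = 0 by omega] at this)
        (by
          rw [mul_smul, mul_smul, ← hu, ← mul_smul, ← zpow_add]
          rwa [show -(cusp n ℓ 0 + 0) + -1 * partialSum n ℓ = -cusp n ℓ (k + 1) by rw [hM]; ring])
      exact ⟨_, mul_mem (ThinData.T_zpow_mem (-1)) (mul_mem (D.rho_mem (k + 1)) hg), p, hp, h1, by
        rw [← h2]; simp only [mul_smul]⟩

end

/-! ### Geodesics through the polygon, and the sheets of the fundamental polygon -/

section

variable {K : Type*} [Field K] {ι ι' : K →+* ℝ} {n : ℕ → ℤ} {ℓ : ℕ} {W : ℤ → K}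

theorem map_mob_rot_pow_inv {u : K} (hu : Irr u) (h : 1 < ι u) {i : ℕ} (hi : i < 3) :
    (i = 0 ∧ 1 < ι (mob (rot ^ i)⁻¹ u)) ∨
    (i = 1 ∧ 0 < ι (mob (rot ^ i)⁻¹ u) ∧ ι (mob (rot ^ i)⁻¹ u) < 1) ∨
    (i = 2 ∧ ι (mob (rot ^ i)⁻¹ u) < 0) := by
  have h1 : ι (mob rot⁻¹ u) = (ι u - 1) / ι u := by rw [map_mob, mob_rot_inv]
  have h2 : ι (mob (rot ^ 2)⁻¹ u) = (ι (mob rot⁻¹ u) - 1) / ι (mob rot⁻¹ u) := by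
    rw [sq, mul_inv_rev, mob_mul _ _ (hu.den_ne_zero _), map_mob, mob_rot_inv]
  have h3 : 0 < ι (mob rot⁻¹ u) := by rw [h1]; exact div_pos (by linarith) (by linarith)
  have h4 : ι (mob rot⁻¹ u) < 1 := by rw [h1, div_lt_one (by linarith)]; linarith
  interval_cases i
  · simpa using h
  · simpa using ⟨h3, h4⟩
  · refine Or.inr (Or.inr ⟨rfl, ?_⟩)
    rw [h2]
    exact div_neg_of_neg_of_pos (by linarith) h3

theorem exists_one_lt_mob_rot_pow {w : K} (hw : Irr w) :
    ∃ i < 3, 1 < ι (mob (rot ^ i) w) := by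
  have h0 := (hw.map ι).ne_intCast 0
  have h1 := (hw.map ι).ne_intCast 1
  push_cast at h0 h1
  have e1 : ι (mob (rot ^ 1) w) = 1 / (1 - ι w) := by rw [map_mob, pow_one, mob_rot]
  have e2 : ι (mob (rot ^ 2) w) = 1 / (1 - ι (mob (rot ^ 1) w)) := by
    rw [sq, mob_mul _ _ (hw.den_ne_zero _), map_mob, mob_rot, pow_one]
  rcases lt_or_gt_of_ne h1 with h | h
  · rcases lt_or_gt_of_ne h0 with h' | h'
    · refine ⟨2, by norm_num, ?_⟩
      have h2 : (1 : ℝ) / (1 - ι w) < 1 := by rw [div_lt_one (by linarith)]; linarith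
      have h3 : (0 : ℝ) < 1 / (1 - ι w) := div_pos one_pos (by linarith)
      rw [e2, e1, one_lt_div (by linarith)]
      linarith
    · refine ⟨1, by norm_num, ?_⟩
      rw [e1, one_lt_div (by linarith)]
      linarith
  · exact ⟨0, by norm_num, by simpa using h⟩

theorem ReducedCycle.one_lt_sub (h : ReducedCycle ι ι' n ℓ W) {k j : ℤ}
    (hj : j + 2 ≤ n (k % ℓ).toNat) : 1 < ι (W k - j) := by
  have h1 : ((⌈ι (W k)⌉ : ℤ) : ℝ) < ι (W k) + 1 := Int.ceil_lt_add_one _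
  rw [h.ceil] at h1
  have h2 : (j : ℝ) + 2 ≤ n (k % ℓ).toNat := by exact_mod_cast hj
  rw [map_sub, map_intCast]
  linarith

/-- The position of the number relative to `0` and `1` reveals the rotation. Since conjugates of
reduced numbers lie in `(0, 1)`, the conjugate then reveals the shift, and the cycle has no
repetition within a period. -/
theorem ReducedCycle.indexNum_injOn (h : ReducedCycle ι ι' n ℓ W) :
    Set.InjOn (indexNum W) (indexSet n ℓ) := by
  rintro ⟨k, j, i⟩ ⟨hk0, hk1, hj0, hj1, hi⟩ ⟨k', j', i'⟩ ⟨hk0', hk1', hj0', hj1', hi'⟩ hpq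
  simp only at hk0 hk1 hj0 hj1 hi hk0' hk1' hj0' hj1' hi'
  unfold indexNum at hpq
  simp only at hpq
  have hii : i = i' := by
    have a := map_mob_rot_pow_inv (ι := ι) (h.irr_sub k j) (h.one_lt_sub hj1) hi
    have b := map_mob_rot_pow_inv (ι := ι) (h.irr_sub k' j') (h.one_lt_sub hj1') hi'
    rw [← hpq] at b
    rcases a with a | a | a <;> rcases b with b | b | b <;> first
      | exact a.1.trans b.1.symm
      | linarith [a.2, b.2]
  subst hii
  have e : W k - j = W k' - j' := by
    have := congrArg (mob (rot ^ i)) hpq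
    rwa [mob_mob_inv (h.irr_sub k j), mob_mob_inv (h.irr_sub k' j')] at this
  have hjj : j = j' := by
    have e' := congrArg ι' e
    rw [map_sub, map_sub, map_intCast, map_intCast] at e'
    have a := h.reduced k
    have b := h.reduced k'
    have h1 : (j : ℝ) < j' + 1 := by linarith [a.1, a.2.1, b.1, b.2.1]
    have h2 : (j' : ℝ) < j + 1 := by linarith [a.1, a.2.1, b.1, b.2.1]
    have h1' : j < j' + 1 := by exact_mod_cast h1
    have h2' : j' < j + 1 := by exact_mod_cast h2
    omega
  subst hjj
  rw [h.injective k k' hk0 hk1 hk0' hk1' (sub_left_injective e)]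

theorem mob_injective_ne {w : K} (hw : Irr w) (h : ι' w ≠ ι w) (γ : SL(2, ℤ)) :
    ι' (mob γ w) ≠ ι (mob γ w) := by
  intro e
  rw [map_mob, map_mob] at e
  have := congrArg (mob γ⁻¹) e
  rw [mob_inv_mob (hw.map ι'), mob_inv_mob (hw.map ι)] at this
  exact h this

theorem smul_mem_geodesicLine_mob {w : K} (hw : Irr w) (γ : SL(2, ℤ)) {z : ℍ} :
    γ • z ∈ geodesicLine (ι' (mob γ w)) (ι (mob γ w)) ↔ z ∈ geodesicLine (ι' w) (ι w) := by
  rw [map_mob, map_mob]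
  exact smul_mem_geodesicLine γ ((hw.map ι').den_ne_zero γ) ((hw.map ι).den_ne_zero γ)

/-- A rotation of the triangle makes the forward endpoint exceed `1`; as the geodesic meets the
triangle, the other endpoint is less than `1`. An integer shift then gives a reduced number, which
belongs to the cycle. -/
theorem ReducedCycle.exists_indexNum_eq (h : ReducedCycle ι ι' n ℓ W) {γ : SL(2, ℤ)} {w : K}
    (hw : w = mob γ (W 0)) (hF : (geodesicLine (ι' w) (ι w) ∩ stdPolygon).Nonempty) :
    ∃ p ∈ indexSet n ℓ, indexNum W p = w := by
  have hirr : Irr w := hw ▸ (h.irr 0).mob γ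
  have hne : ι' w ≠ ι w := hw ▸ mob_injective_ne (h.irr 0) (h.lt 0).ne γ
  obtain ⟨z, hzl, hzF⟩ := hF
  obtain ⟨i, hi, h1⟩ := exists_one_lt_mob_rot_pow (ι := ι) hirr
  obtain ⟨u, hu⟩ : ∃ u, u = mob (rot ^ i) w := ⟨_, rfl⟩
  have hl := (smul_mem_geodesicLine_mob hirr (rot ^ i)).2 hzl
  obtain ⟨t1, t2, -⟩ := rot_pow_smul_mem_triangle (stdPolygon_subset_triangle hzF) i
  rw [mem_geodesicLine (mob_injective_ne hirr hne _)] at hl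
  rw [← hu] at h1 hl
  obtain ⟨y, hy⟩ : ∃ y, y = rot ^ i • z := ⟨_, rfl⟩
  rw [← hy] at hl t1 t2
  have hx : ι' u < 1 := by
    unfold side at hl
    have := pow_pos y.im_pos 2
    by_contra hc
    push Not at hc
    nlinarith [mul_pos (show 0 < ι' u - y.re by linarith) (show 0 < ι u - y.re by linarith)]
  have huirr : Irr u := hu ▸ hirr.mob _
  -- The only shift that puts the conjugate into `(0, 1)`. The condition `ι u > 1` later becomes `j
  -- + 1 < n k`, which is exactly the range of the index set.
  obtain ⟨j, hj⟩ : ∃ j : ℤ, j = -⌊ι' u⌋ := ⟨_, rfl⟩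
  have hfl : (⌊ι' u⌋ : ℝ) = -j := by rw [hj]; push_cast; ring
  have hj0 : 0 ≤ j := by
    have : ⌊ι' u⌋ < 1 := Int.floor_lt.2 (by exact_mod_cast hx)
    omega
  have hj0' : (0 : ℝ) ≤ j := by exact_mod_cast hj0
  have hred : Reduced ι ι' (u + j) := by
    have a := Int.floor_le (ι' u)
    have b := Int.lt_floor_add_one (ι' u)
    have c := (huirr.map ι').ne_intCast (-j)
    rw [hfl] at a b
    push_cast at c
    have d := lt_of_le_of_ne a c.symm
    refine ⟨?_, ?_, ?_⟩ <;> rw [map_add, map_intCast] <;> linarith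
  obtain ⟨k, hk0, hk1, hk⟩ := h.complete (u + j) ⟨ModularGroup.T ^ j * rot ^ i * γ, by
    rw [mul_assoc, mob_mul _ _ ((h.irr 0).den_ne_zero _), mob_mul _ _ ((h.irr 0).den_ne_zero _),
      ← hw, ← hu, mob_T_zpow]⟩ hred
  have hu' : W k - j = u := by rw [← hk]; ring
  refine ⟨(k, j, i), ⟨hk0, hk1, hj0, ?_, hi⟩, ?_⟩
  · have a := Int.le_ceil (ι (W k))
    rw [h.ceil] at a
    rw [← hu', map_sub, map_intCast] at h1
    have b : (j : ℝ) + 1 < n (k % ℓ).toNat := by linarith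
    have b' : j + 1 < n (k % ℓ).toNat := by exact_mod_cast b
    show j + 2 ≤ n (k % ℓ).toNat
    omega
  · show mob (rot ^ i)⁻¹ (W k - j) = w
    rw [hu', hu, mob_inv_mob hirr]

/-- The indices of the polygons whose base point lies to the left of the corresponding geodesic. -/
def leftIndices (ι ι' : K →+* ℝ) (n : ℕ → ℤ) (ℓ : ℕ) (W : ℤ → K) (z₀ : ℍ) : Set (ℤ × ℤ × ℕ) :=
  {p ∈ indexSet n ℓ | z₀ ∈ leftSide (ι' (indexNum W p)) (ι (indexNum W p))}

theorem leftIndices_finite (z₀ : ℍ) : (leftIndices ι ι' n ℓ W z₀).Finite :=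
  (indexSet_finite n ℓ).subset fun _ hp => hp.1

theorem mem_fibre_iff {z₀ u : ℍ} : u ∈ proj ⁻¹' {proj z₀} ↔ ∃ γ : SL(2, ℤ), γ • z₀ = u := by
  rw [Set.mem_preimage, Set.mem_singleton_iff, proj_eq_iff]

/-- Left indices represent exactly once the classes under the thin group of orbit points in the
Nielsen region, and off its boundary the polygon contains exactly one point of each class. -/
theorem ReducedCycle.exists_bijOn_fundamentalPolygon (h : ReducedCycle ι ι' n ℓ W) {FA : Set ℍ}
    (hFA : IsFundamentalPolygon (thinGroup n ℓ) (nielsenRegion (thinGroup n ℓ)) FA) {z₀ : ℍ}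
    (hz₀ : z₀ ∈ stdPolygon) (hgen : ∀ γ : SL(2, ℤ), Generic ι ι' (γ • z₀))
    (hfr : ∀ γ : SL(2, ℤ), γ • z₀ ∉ frontier FA) :
    ∃ f, Set.BijOn f (leftIndices ι ι' n ℓ W z₀) (proj ⁻¹' {proj z₀} ∩ FA) := by
  have hex : ∀ p, ∃ u, p ∈ leftIndices ι ι' n ℓ W z₀ →
      u ∈ FA ∧ ∃ g ∈ thinGroup n ℓ, g • indexElt n ℓ p • z₀ = u := by
    intro p
    by_cases hp : p ∈ leftIndices ι ι' n ℓ W z₀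
    · obtain ⟨g, hg, hgF⟩ := hFA.covers _ (h.smul_mem_nielsenRegion hz₀ hgen hp.1 hp.2)
      refine ⟨_, fun _ => ⟨?_, g, hg, rfl⟩⟩
      by_contra hn
      refine hfr (g * indexElt n ℓ p) ?_
      rw [mul_smul, frontier, hFA.isOpen.interior_eq]
      exact ⟨hgF, hn⟩
    · exact ⟨z₀, fun h => absurd h hp⟩
  choose f hf using hex
  refine ⟨f, fun p hp => ?_, fun p hp q hq hpq => ?_, ?_⟩
  · obtain ⟨h1, g, -, h2⟩ := hf p hp
    exact ⟨mem_fibre_iff.2 ⟨g * indexElt n ℓ p, by rw [mul_smul, h2]⟩, h1⟩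
  · obtain ⟨-, g, hg, h1⟩ := hf p hp
    obtain ⟨-, g', hg', h2⟩ := hf q hq
    refine h.index_injective hz₀ hgen hp.1 hq.1 (mul_mem (inv_mem hg') hg) ?_
    rw [mul_smul, h1, hpq, ← h2, inv_smul_smul]
  · rintro u ⟨hu, huF⟩
    obtain ⟨δ, rfl⟩ := mem_fibre_iff.1 hu
    obtain ⟨g, hg, p, hp, hl, hgp⟩ := h.exists_index hz₀ hgen (hFA.subset huF)
    refine ⟨p, ⟨hp, hl⟩, ?_⟩
    obtain ⟨h1, g', hg', h2⟩ := hf p ⟨hp, hl⟩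
    have := hFA.unique _ (subset_closure huF) _ (subset_closure h1)
      ⟨g' * g, mul_mem hg' hg, by rw [mul_smul, hgp, h2]⟩
    rcases this with e | e
    · exact e.symm
    · exact absurd e.1 (hfr δ)

end

/-! ## Order along an oriented geodesic -/

/-- The height of the image of a point under `straighten`; it decreases along the geodesic. -/
def height (x₀ x₁ : ℝ) (z : ℍ) : ℝ := (straighten x₀ x₁ z).im

theorem height_pos {x₀ x₁ : ℝ} (h : x₀ ≠ x₁) (z : ℍ) : 0 < height x₀ x₁ z := by
  rw [height, straighten_im]
  have := sq_add_sq_pos x₀ z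
  have := z.im_pos
  have := sub_ne_zero.2 h.symm
  positivity

/-- The relative position of the real part is a decreasing function of the height, so betweenness
can be tested by either; the former is affine in the Klein model, the latter scales under the group.
-/
theorem re_sub_div_eq {x₀ x₁ : ℝ} (h : x₀ ≠ x₁) {z : ℍ} (hz : z ∈ geodesicLine x₀ x₁) :
    (z.re - x₀) / (x₁ - x₀) = (x₁ - x₀) ^ 2 / (height x₀ x₁ z ^ 2 + (x₁ - x₀) ^ 2) := by
  rw [mem_geodesicLine h, side] at hz
  have h1 := sub_ne_zero.2 h.symm
  have hN := sq_add_sq_pos x₀ z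
  have e : (z.re - x₀) ^ 2 + z.im ^ 2 = (z.re - x₀) * (x₁ - x₀) := by linear_combination hz
  have h2 : z.re - x₀ ≠ 0 := fun h0 => by rw [e, h0, zero_mul] at hN; exact hN.false
  have h3 : height x₀ x₁ z ^ 2 * (z.re - x₀) = (x₁ - x₀) ^ 2 * (x₁ - z.re) := by
    rw [height, straighten_im, e]
    field_simp
    linear_combination hz
  have h4 : height x₀ x₁ z ^ 2 + (x₁ - x₀) ^ 2 ≠ 0 := by positivity
  rw [div_eq_div_iff h1 h4]
  linear_combination h3

theorem height_le_iff {x₀ x₁ : ℝ} (h : x₀ ≠ x₁) {z w : ℍ} (hz : z ∈ geodesicLine x₀ x₁)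
    (hw : w ∈ geodesicLine x₀ x₁) : height x₀ x₁ z ≤ height x₀ x₁ w ↔
      (w.re - x₀) / (x₁ - x₀) ≤ (z.re - x₀) / (x₁ - x₀) := by
  have h1 : 0 < (x₁ - x₀) ^ 2 := by have := sub_ne_zero.2 h.symm; positivity
  have a := height_pos h z
  have b := height_pos h w
  rw [re_sub_div_eq h hz, re_sub_div_eq h hw, div_le_div_iff_of_pos_left h1 (by positivity)
    (by positivity), add_le_add_iff_right, pow_le_pow_iff_left₀ a.le b.le two_ne_zero]

theorem mem_hypSegment_of_height_le {x₀ x₁ : ℝ} (h : x₀ ≠ x₁) {z u w : ℍ}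
    (hz : z ∈ geodesicLine x₀ x₁) (hu : u ∈ geodesicLine x₀ x₁) (hw : w ∈ geodesicLine x₀ x₁)
    (h1 : height x₀ x₁ u ≤ height x₀ x₁ z) (h2 : height x₀ x₁ w ≤ height x₀ x₁ u) :
    u ∈ hypSegment z w := by
  rw [height_le_iff h hu hz] at h1
  rw [height_le_iff h hw hu] at h2
  rw [mem_geodesicLine h, side_eq] at hz hu hw
  have hx := sub_ne_zero.2 h.symm
  obtain ⟨t, t0, t1, ht⟩ : ∃ t : ℝ, 0 ≤ t ∧ t ≤ 1 ∧ (u.re - x₀) / (x₁ - x₀) =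
      (1 - t) * ((z.re - x₀) / (x₁ - x₀)) + t * ((w.re - x₀) / (x₁ - x₀)) := by
    generalize (z.re - x₀) / (x₁ - x₀) = a at *
    generalize (u.re - x₀) / (x₁ - x₀) = b at *
    generalize (w.re - x₀) / (x₁ - x₀) = c at *
    rcases (h1.trans h2).eq_or_lt with e | e
    · exact ⟨0, le_rfl, zero_le_one, by linarith⟩
    · have e' : 0 < c - a := by linarith
      refine ⟨(b - a) / (c - a), div_nonneg (by linarith) e'.le, ?_, ?_⟩
      · rw [div_le_one e']; linarith
      · field_simp; ring
  have hre : u.re = (1 - t) * z.re + t * w.re := by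
    field_simp at ht
    linarith
  refine mem_hypSegment_of_klein t0 t1 hre ?_
  linear_combination hu - (1 - t) * hz - t * hw + (x₀ + x₁) * hre

theorem height_of_mem_hypSegment {x₀ x₁ : ℝ} (h : x₀ ≠ x₁) {z u w : ℍ}
    (hz : z ∈ geodesicLine x₀ x₁) (hw : w ∈ geodesicLine x₀ x₁)
    (hzw : height x₀ x₁ w ≤ height x₀ x₁ z) (hu : u ∈ hypSegment z w) :
    u ∈ geodesicLine x₀ x₁ ∧ height x₀ x₁ u ≤ height x₀ x₁ z ∧
      height x₀ x₁ w ≤ height x₀ x₁ u := by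
  obtain ⟨t, t0, t1, hre, hq⟩ := klein_of_mem_hypSegment hu
  have hul : u ∈ geodesicLine x₀ x₁ := by
    rw [mem_geodesicLine h, side_eq] at *
    linear_combination hq - (x₀ + x₁) * hre + (1 - t) * hz + t * hw
  refine ⟨hul, ?_, ?_⟩
  all_goals
    have e : (u.re - x₀) / (x₁ - x₀) =
        (1 - t) * ((z.re - x₀) / (x₁ - x₀)) + t * ((w.re - x₀) / (x₁ - x₀)) := by
      rw [hre]; ring
    rw [height_le_iff h hw hz] at hzw
    first | rw [height_le_iff h hul hz] | rw [height_le_iff h hw hul]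
    rw [e]
    nlinarith

theorem height_smul {x₀ x₁ : ℝ} (γ : SL(2, ℤ)) (h0 : den γ x₀ ≠ 0) (h1 : den γ x₁ ≠ 0) (z : ℍ) :
    height (mob γ x₀) (mob γ x₁) (γ • z) = (den γ x₁ ^ 2)⁻¹ * height x₀ x₁ z := by
  rw [height, straighten_smul γ h0 h1, Complex.im_ofReal_mul, height]

theorem mem_translate {γ : SL(2, ℤ)} {F : Set ℍ} {z : ℍ} : z ∈ translate γ F ↔ γ⁻¹ • z ∈ F := by
  constructor
  · rintro ⟨w, hw, rfl⟩
    simpa using hw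
  · exact fun h => ⟨_, h, by simp⟩

theorem translate_neg (γ : SL(2, ℤ)) (F : Set ℍ) : translate (-γ) F = translate γ F := by
  unfold translate
  congr 1
  ext1 z
  exact ModularGroup.SL_neg_smul γ z

/-! ### One period of the axis and the painted sheets -/

section

variable {K : Type*} [Field K] {ι ι' : K →+* ℝ}

/-- A translate of the convex polygon contains the points between two of its points. -/
theorem mem_translate_of_height_le {w : K} (hw : Irr w) (hne : ι' w ≠ ι w) {γ : SL(2, ℤ)}
    {a b c : ℍ} (ha : a ∈ translate γ stdPolygon) (hc : c ∈ translate γ stdPolygon)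
    (hal : a ∈ geodesicLine (ι' w) (ι w)) (hbl : b ∈ geodesicLine (ι' w) (ι w))
    (hcl : c ∈ geodesicLine (ι' w) (ι w)) (hab : height (ι' w) (ι w) b ≤ height (ι' w) (ι w) a)
    (hbc : height (ι' w) (ι w) c ≤ height (ι' w) (ι w) b) : b ∈ translate γ stdPolygon := by
  rw [mem_translate] at *
  refine hypConvex_stdPolygon _ ha _ hc ?_
  have h0 := (hw.map ι').den_ne_zero γ⁻¹
  have h1 := (hw.map ι).den_ne_zero γ⁻¹
  have hpos : 0 ≤ (den γ⁻¹ (ι w) ^ 2)⁻¹ := by positivity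
  refine mem_hypSegment_of_height_le (x₀ := mob γ⁻¹ (ι' w)) (x₁ := mob γ⁻¹ (ι w)) ?_
    ((smul_mem_geodesicLine _ h0 h1).2 hal) ((smul_mem_geodesicLine _ h0 h1).2 hbl)
    ((smul_mem_geodesicLine _ h0 h1).2 hcl) ?_ ?_
  · have := mob_injective_ne hw hne γ⁻¹
    rwa [map_mob, map_mob] at this
  · rw [height_smul _ h0 h1, height_smul _ h0 h1]
    exact mul_le_mul_of_nonneg_left hab hpos
  · rw [height_smul _ h0 h1, height_smul _ h0 h1]
    exact mul_le_mul_of_nonneg_left hbc hpos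

/-- A hyperbolic element fixing `w` and its conjugate, with multiplier `e ^ 2`, a base point `z`
on the axis lying in no open translate of the polygon. -/
structure AxisData (ι ι' : K →+* ℝ) (w : K) (γ : SL(2, ℤ)) (e : ℝ) (z : ℍ) : Prop where
  irr : Irr w
  lt : ι' w < ι w
  fix : mob γ w = w
  den_eq : ι (den γ w) = e
  one_lt : 1 < e
  mem : z ∈ geodesicLine (ι' w) (ι w)
  notMem : ∀ δ : SL(2, ℤ), z ∉ translate δ stdPolygon

namespace AxisData

variable {w : K} {γ : SL(2, ℤ)} {e : ℝ} {z : ℍ}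

theorem smul_mem (D : AxisData ι ι' w γ e z) {k : ℤ} {u : ℍ}
    (hu : u ∈ geodesicLine (ι' w) (ι w)) : γ ^ k • u ∈ geodesicLine (ι' w) (ι w) := by
  have := (smul_mem_geodesicLine_mob D.irr (γ ^ k)).2 hu
  rwa [(mob_zpow D.irr D.fix k).1] at this

theorem height_zpow_smul (D : AxisData ι ι' w γ e z) (k : ℤ) (u : ℍ) :
    height (ι' w) (ι w) (γ ^ k • u) = ((e ^ 2) ^ k)⁻¹ * height (ι' w) (ι w) u := by
  obtain ⟨h1, h2⟩ := mob_zpow D.irr D.fix k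
  have := height_smul (γ ^ k) ((D.irr.map ι').den_ne_zero _) ((D.irr.map ι).den_ne_zero _) u
  rw [← map_mob, ← map_mob, ← map_den, h1, h2, map_zpow₀, D.den_eq] at this
  rw [this, ← zpow_natCast, ← zpow_natCast, ← zpow_mul, ← zpow_mul, mul_comm k]

theorem height_smul_le (D : AxisData ι ι' w γ e z) (u : ℍ) :
    height (ι' w) (ι w) (γ • u) ≤ height (ι' w) (ι w) u := by
  have := D.height_zpow_smul 1 u
  rw [zpow_one, zpow_one] at this
  rw [this]
  have h1 : (e ^ 2)⁻¹ ≤ 1 := inv_le_one_of_one_le₀ (one_le_pow₀ D.one_lt.le)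
  exact mul_le_of_le_one_left (height_pos D.lt.ne _).le h1

theorem of_mem (D : AxisData ι ι' w γ e z) {u : ℍ} (hu : u ∈ hypSegment z (γ • z)) :
    u ∈ geodesicLine (ι' w) (ι w) ∧ height (ι' w) (ι w) u ≤ height (ι' w) (ι w) z ∧
      height (ι' w) (ι w) (γ • z) ≤ height (ι' w) (ι w) u := by
  have := D.smul_mem (k := 1) D.mem
  rw [zpow_one] at this
  exact height_of_mem_hypSegment D.lt.ne D.mem this (D.height_smul_le z) hu

/-- Every point of the axis is moved into the fundamental segment by a power of `γ`. -/
theorem exists_zpow_smul_mem (D : AxisData ι ι' w γ e z) {u : ℍ}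
    (hu : u ∈ geodesicLine (ι' w) (ι w)) : ∃ k : ℤ, γ ^ k • u ∈ hypSegment z (γ • z) := by
  have he : 1 < e ^ 2 := one_lt_pow₀ D.one_lt two_ne_zero
  have he0 : 0 < e ^ 2 := by linarith
  have hz := height_pos D.lt.ne z
  have hu' := height_pos D.lt.ne u
  -- `γ` divides heights by `e ^ 2`, so one period of the axis corresponds to one multiplicative
  -- period of heights.
  obtain ⟨k, hk1, hk2⟩ := exists_mem_Ioc_zpow (div_pos hu' hz) he
  rw [lt_div_iff₀ hz] at hk1
  rw [div_le_iff₀ hz] at hk2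
  have hgz := D.smul_mem (k := 1) D.mem
  have h1 := D.height_zpow_smul 1 z
  rw [zpow_one] at hgz h1
  rw [zpow_one] at h1
  have hp := zpow_pos he0 (k + 1)
  refine ⟨k + 1, mem_hypSegment_of_height_le D.lt.ne D.mem (D.smul_mem hu) hgz ?_ ?_⟩
  · rw [D.height_zpow_smul, inv_mul_le_iff₀ hp]
    exact hk2
  · rw [D.height_zpow_smul, h1, zpow_add_one₀ he0.ne', mul_inv, mul_comm _ (e ^ 2)⁻¹, mul_assoc]
    refine mul_le_mul_of_nonneg_left ?_ (by positivity)
    rw [le_inv_mul_iff₀ (zpow_pos he0 k)]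
    exact hk1.le

/-- If one period met both translates, `γ z` would lie between two points of the second one, hence
in it by convexity, whereas `z` lies in no open translate. -/
theorem not_meets_of_pos (D : AxisData ι ι' w γ e z) {δ : SL(2, ℤ)} {k : ℤ} (hk : 0 < k)
    (h1 : (hypSegment z (γ • z) ∩ translate δ stdPolygon).Nonempty)
    (h2 : (hypSegment z (γ • z) ∩ translate (γ ^ k * δ) stdPolygon).Nonempty) : False := by
  obtain ⟨a, ha, haF⟩ := h1
  obtain ⟨b, hb, hbF⟩ := h2
  obtain ⟨al, az, -⟩ := D.of_mem ha
  obtain ⟨bl, -, bz⟩ := D.of_mem hb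
  have he : 1 < e ^ 2 := one_lt_pow₀ D.one_lt two_ne_zero
  have hgz := D.smul_mem (k := 1) D.mem
  have hg1 := D.height_zpow_smul 1 z
  rw [zpow_one] at hgz hg1
  have haF' : γ ^ k • a ∈ translate (γ ^ k * δ) stdPolygon := by
    rw [mem_translate] at haF ⊢
    simpa [mul_smul] using haF
  have key := mem_translate_of_height_le D.irr D.lt.ne (b := γ • z) hbF haF' bl hgz
    (D.smul_mem al) bz (by
      rw [D.height_zpow_smul, hg1]
      refine mul_le_mul ?_ az (height_pos D.lt.ne _).le (by positivity)
      exact inv_anti₀ (by positivity) (zpow_le_zpow_right₀ he.le (by omega)))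
  rw [mem_translate, ← mul_smul] at key
  refine D.notMem (γ⁻¹ * (γ ^ k * δ)) ?_
  rw [mem_translate]
  simpa using key

theorem eq_zero_of_meets (D : AxisData ι ι' w γ e z) {δ : SL(2, ℤ)} {k : ℤ}
    (h1 : (hypSegment z (γ • z) ∩ translate δ stdPolygon).Nonempty)
    (h2 : (hypSegment z (γ • z) ∩ translate (γ ^ k * δ) stdPolygon).Nonempty) : k = 0 := by
  rcases lt_trichotomy k 0 with h | h | h
  · exfalso
    refine D.not_meets_of_pos (neg_pos.2 h) h2 ?_
    rwa [← mul_assoc, ← zpow_add, neg_add_cancel, zpow_zero, one_mul]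
  · exact h
  · exact (D.not_meets_of_pos h h1 h2).elim

theorem mem_paint_iff (_ : AxisData ι ι' w γ e z) {z₀ : ℍ} (hz₀ : z₀ ∈ stdPolygon)
    (hgen : ∀ γ : SL(2, ℤ), Generic ι ι' (γ • z₀)) (δ : SL(2, ℤ)) :
    δ • z₀ ∈ paint stdPolygon (ι' w) (ι w) (hypSegment z (γ • z)) ↔
      δ • z₀ ∈ leftSide (ι' w) (ι w) ∧
        (hypSegment z (γ • z) ∩ translate δ stdPolygon).Nonempty := by
  unfold paint
  simp only [Set.mem_iUnion, Set.mem_ofPred_eq, exists_prop]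
  constructor
  · rintro ⟨η, hη, hl, hF⟩
    refine ⟨hl, ?_⟩
    rw [mem_translate, ← mul_smul] at hF
    have h0 := hgen 1
    rw [one_smul] at h0
    rcases eq_of_mem_stdPolygon hz₀ hF h0 (hgen _) with h | h
    · rwa [inv_mul_eq_one.1 h] at hη
    · have : δ = -η := by rw [inv_mul_eq_iff_eq_mul] at h; rw [h]; simp
      rwa [this, translate_neg]
  · rintro ⟨hl, hm⟩
    exact ⟨δ, hm, hl, by rw [mem_translate, inv_smul_smul]; exact hz₀⟩

end AxisData

theorem ReducedCycle.exists_eq_mob {n : ℕ → ℤ} {ℓ : ℕ} {W : ℤ → K}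
    (h : ReducedCycle ι ι' n ℓ W) (k : ℤ) : ∃ δ : SL(2, ℤ), W k = mob δ (W 0) := by
  have hstep : ∀ k, W (k + 1) = mob (stepMat (n (k % ℓ).toNat)) (W k) := fun k => by
    rw [mob_stepMat, h.step]
  induction k with
  | zero => exact ⟨1, (mob_one _).symm⟩
  | succ k ih =>
    obtain ⟨δ, hδ⟩ := ih
    exact ⟨_ * δ, by rw [mob_mul _ _ ((h.irr 0).den_ne_zero _), ← hδ, hstep]⟩
  | pred k ih =>
    obtain ⟨δ, hδ⟩ := ih
    have := hstep (-k - 1)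
    rw [sub_add_cancel, hδ] at this
    refine ⟨(stepMat (n ((-(k : ℤ) - 1) % ℓ).toNat))⁻¹ * δ, ?_⟩
    rw [mob_mul _ _ ((h.irr 0).den_ne_zero _), this, mob_inv_mob (h.irr _)]

theorem ReducedCycle.exists_indexNum_eq_mob {n : ℕ → ℤ} {ℓ : ℕ} {W : ℤ → K}
    (h : ReducedCycle ι ι' n ℓ W) (p : ℤ × ℤ × ℕ) :
    ∃ δ : SL(2, ℤ), indexNum W p = mob δ (W 0) := by
  obtain ⟨δ, hδ⟩ := h.exists_eq_mob p.1
  refine ⟨(rot ^ p.2.2)⁻¹ * (ModularGroup.T ^ (-p.2.1) * δ), ?_⟩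
  rw [mob_mul _ _ ((h.irr 0).den_ne_zero _), mob_mul _ _ ((h.irr 0).den_ne_zero _), ← hδ,
    mob_T_zpow, indexNum, Int.cast_neg, ← sub_eq_add_neg]

/-- The indices for which the geodesic meets the polygon. -/
def meetingIndices (ι ι' : K →+* ℝ) (W : ℤ → K) : Set (ℤ × ℤ × ℕ) :=
  {p | (geodesicLine (ι' (indexNum W p)) (ι (indexNum W p)) ∩ stdPolygon).Nonempty}

theorem ReducedCycle.exists_bijOn_paint {n : ℕ → ℤ} {ℓ : ℕ} {W : ℤ → K}
    (h : ReducedCycle ι ι' n ℓ W) {w : K} {γ : SL(2, ℤ)} {e : ℝ} {z : ℍ}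
    (D : AxisData ι ι' w γ e z) (hw : ∃ δ : SL(2, ℤ), w = mob δ (W 0))
    (hstab : ∀ δ : SL(2, ℤ), mob δ w = w → ∃ k : ℤ, δ = γ ^ k ∨ δ = -γ ^ k)
    {z₀ : ℍ} (hz₀ : z₀ ∈ stdPolygon) (hgen : ∀ γ : SL(2, ℤ), Generic ι ι' (γ • z₀)) :
    ∃ f, Set.BijOn f (leftIndices ι ι' n ℓ W z₀ ∩ meetingIndices ι ι' W)
      (proj ⁻¹' {proj z₀} ∩ paint stdPolygon (ι' w) (ι w) (hypSegment z (γ • z))) := by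
  obtain ⟨δ₀, hδ₀⟩ := hw
  -- Any matrix taking the indexed number to `w` puts the polygon on the axis; a power of `γ` then
  -- slides it so that it meets the chosen period.
  have hex : ∀ p, ∃ δ : SL(2, ℤ), p ∈ meetingIndices ι ι' W → mob δ (indexNum W p) = w ∧
      (hypSegment z (γ • z) ∩ translate δ stdPolygon).Nonempty := by
    intro p
    by_cases hp : p ∈ meetingIndices ι ι' W
    · obtain ⟨y, hyl, hyF⟩ := hp
      have hirr := h.irr_indexNum p
      obtain ⟨η, hη⟩ : ∃ η : SL(2, ℤ), mob η (indexNum W p) = w := by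
        obtain ⟨α, hα⟩ := h.exists_indexNum_eq_mob p
        refine ⟨δ₀ * α⁻¹, ?_⟩
        rw [mob_mul _ _ (hirr.den_ne_zero _), hα, mob_inv_mob (h.irr 0), ← hδ₀]
      have hy := (smul_mem_geodesicLine_mob hirr η).2 hyl
      rw [hη] at hy
      obtain ⟨k, hk⟩ := D.exists_zpow_smul_mem hy
      refine ⟨γ ^ k * η, fun _ => ⟨?_, _, hk, ?_⟩⟩
      · rw [mob_mul _ _ (hirr.den_ne_zero _), hη, (mob_zpow D.irr D.fix k).1]
      · rw [mem_translate, ← mul_smul]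
        simpa [← mul_smul, mul_assoc] using hyF
    · exact ⟨1, fun h => absurd h hp⟩
  choose f hf using hex
  refine ⟨fun p => f p • z₀, fun p hp => ?_, fun p hp q hq hpq => ?_, ?_⟩
  · obtain ⟨h1, h2⟩ := hf p hp.2
    refine ⟨mem_fibre_iff.2 ⟨_, rfl⟩, (D.mem_paint_iff hz₀ hgen _).2 ⟨?_, h2⟩⟩
    have := (smul_mem_leftSide_mob (h.irr_indexNum p) (f p)).2 hp.1.2
    rwa [h1] at this
  · have h1 := (hf p hp.2).1
    have h2 := (hf q hq.2).1
    refine h.indexNum_injOn hp.1.1 hq.1.1 ?_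
    have h0 := hgen 1
    rw [one_smul] at h0
    have hpq' : ((f q)⁻¹ * f p) • z₀ = z₀ := by
      rw [mul_smul]; simp only at hpq; rw [hpq, inv_smul_smul]
    have h3 : mob ((f q)⁻¹ * f p) (indexNum W p) = indexNum W q := by
      rw [mob_mul _ _ ((h.irr_indexNum p).den_ne_zero _), h1, ← h2,
        mob_inv_mob (h.irr_indexNum q)]
    rcases eq_of_mem_stdPolygon hz₀ (by rwa [hpq']) h0 (hgen ((f q)⁻¹ * f p)) with h4 | h4
    · rwa [h4, mob_one] at h3
    · rwa [h4, mob_neg, mob_one] at h3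
  · rintro u ⟨hu, huP⟩
    obtain ⟨δ, rfl⟩ := mem_fibre_iff.1 hu
    obtain ⟨hl, hm⟩ := (D.mem_paint_iff hz₀ hgen δ).1 huP
    obtain ⟨v, hv⟩ : ∃ v, v = mob δ⁻¹ w := ⟨_, rfl⟩
    have hvw : mob δ v = w := by rw [hv, mob_mob_inv D.irr]
    have hvi : Irr v := hv ▸ D.irr.mob _
    have hvm : (geodesicLine (ι' v) (ι v) ∩ stdPolygon).Nonempty := by
      obtain ⟨a, ha, haF⟩ := hm
      refine ⟨δ⁻¹ • a, ?_, mem_translate.1 haF⟩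
      rw [hv, smul_mem_geodesicLine_mob D.irr]
      exact (D.of_mem ha).1
    obtain ⟨p, hp, hpv⟩ := h.exists_indexNum_eq (γ := δ⁻¹ * δ₀) (by
      rw [mob_mul _ _ ((h.irr 0).den_ne_zero _), ← hδ₀, hv]) hvm
    have hpm : p ∈ meetingIndices ι ι' W := by
      unfold meetingIndices
      rwa [Set.mem_ofPred_eq, hpv]
    refine ⟨p, ⟨⟨hp, ?_⟩, hpm⟩, ?_⟩
    · rw [hpv, ← smul_mem_leftSide_mob hvi δ, hvw]
      exact hl
    · obtain ⟨h1, h2⟩ := hf p hpm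
      rw [hpv] at h1
      -- Two matrices carrying the same number to `w` differ, up to sign, by a power of `γ`; since
      -- both polygons meet the chosen period, the power is trivial.
      obtain ⟨k, hk⟩ := hstab (f p * δ⁻¹) (by
        rw [mob_mul _ _ (D.irr.den_ne_zero _), ← hv, h1])
      have hk' : f p = γ ^ k * δ ∨ f p = -(γ ^ k * δ) := by
        rcases hk with hk | hk
        · exact Or.inl (mul_inv_eq_iff_eq_mul.1 hk)
        · right
          rw [mul_inv_eq_iff_eq_mul.1 hk]
          simp
      have hk0 : k = 0 := by
        refine D.eq_zero_of_meets hm ?_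
        rcases hk' with e | e
        · rwa [← e]
        · rwa [e, translate_neg] at h2
      subst hk0
      rw [zpow_zero, one_mul] at hk'
      rcases hk' with e | e
      · simp only [e]
      · simp only [e]
        exact ModularGroup.SL_neg_smul δ z₀

/-- Above a generic point, the two coverings differ by the number of polygons to the left of the
geodesics which miss them. -/
theorem exists_ncard_eq [NumberField K] (hK : Module.finrank ℚ K = 2) (hι : ι ≠ ι')
    {A : NarrowClassGroup K} {n : ℕ → ℤ} {ℓ : ℕ} (hn : IsCycle ι ι' A n ℓ) {FA : Set ℍ}
    (hFA : IsFundamentalPolygon (thinGroup n ℓ) (nielsenRegion (thinGroup n ℓ)) FA)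
    {x₀ x₁ : ℝ} {C : Set ℍ} (hC : IsLift ι ι' A x₀ x₁ C) :
    ∃ k : ℕ, ∀ z₀ ∈ stdPolygon, (∀ γ : SL(2, ℤ), Generic ι ι' (γ • z₀)) →
      (∀ γ : SL(2, ℤ), γ • z₀ ∉ frontier FA) →
      (proj ⁻¹' {proj z₀} ∩ FA).Finite ∧
      (proj ⁻¹' {proj z₀} ∩ paint stdPolygon x₀ x₁ C).Finite ∧
      (proj ⁻¹' {proj z₀} ∩ FA).ncard =
        (proj ⁻¹' {proj z₀} ∩ paint stdPolygon x₀ x₁ C).ncard + k := by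
  obtain ⟨W, h, v, hv, δ, hδ⟩ := exists_reducedCycle hn
  obtain ⟨w, ε, γ, z, hw, rfl, rfl, hε, h1, h2, hz, hz', rfl⟩ := hC
  have hirr : Irr w := irr_of_ne hw.1.ne
  have hden : den γ w = ((ε : 𝓞 K) : K) := h2
  have hfix : mob γ w = w := by
    have h3 : num γ w = den γ w * w := by rw [hden]; exact h1
    rw [mob, h3, mul_div_cancel_left₀ _ (hirr.den_ne_zero γ)]
  have he : 1 < ι (den γ w) := by
    rw [hden]
    obtain ⟨η, e, h3, -⟩ := hε.1
    exact h3
  have D : AxisData ι ι' w γ (ι (den γ w)) z := ⟨hirr, hw.1, hfix, rfl, he, hz, hz'⟩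
  have hw0 : ∃ δ : SL(2, ℤ), w = mob δ (W 0) := by
    obtain ⟨η, hη⟩ := exists_mob_of_represents hv hw
    refine ⟨η * δ⁻¹, ?_⟩
    rw [mob_mul _ _ ((h.irr 0).den_ne_zero _), hδ, mob_inv_mob (irr_of_ne hv.1.ne), hη]
  -- The excess indices, described without `z₀`: this is what makes the multiplicity constant over
  -- the surface.
  let R : Set (ℤ × ℤ × ℕ) := {p ∈ indexSet n ℓ | p ∉ meetingIndices ι ι' W ∧
    stdPolygon ⊆ leftSide (ι' (indexNum W p)) (ι (indexNum W p))}
  refine ⟨R.ncard, fun z₀ hz₀ hgen hfr => ?_⟩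
  obtain ⟨f, hf⟩ := h.exists_bijOn_fundamentalPolygon hFA hz₀ hgen hfr
  obtain ⟨g, hg⟩ := h.exists_bijOn_paint D hw0
    (fun δ hδ => eq_zpow_of_mob_eq_self hK hι hw.1.ne hε hfix hden hδ) hz₀ hgen
  have hS := leftIndices_finite (ι := ι) (ι' := ι') (n := n) (ℓ := ℓ) (W := W) z₀
  have hR : leftIndices ι ι' n ℓ W z₀ \ meetingIndices ι ι' W = R := by
    ext p
    constructor
    · rintro ⟨⟨hp, hl⟩, hm⟩
      refine ⟨hp, hm, fun y hy => stdPolygon_subset_leftSide ?_ hm hz₀ hy hl⟩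
      obtain ⟨α, hα⟩ := h.exists_indexNum_eq_mob p
      rw [hα]
      exact mob_injective_ne (h.irr 0) (h.lt 0).ne α
    · rintro ⟨hp, hm, hl⟩
      exact ⟨⟨hp, hl hz₀⟩, hm⟩
  refine ⟨?_, ?_, ?_⟩
  · rw [← hf.image_eq]; exact hS.image f
  · rw [← hg.image_eq]; exact (hS.inter_of_left _).image g
  · rw [← hf.image_eq, ← hg.image_eq, hf.injOn.ncard_image,
      hg.injOn.ncard_image, ← hR, Set.ncard_inter_add_ncard_sdiff_eq_ncard _ _ hS]

end

/-! ## Generic points have full measure -/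

/-- A conic of the pencil containing the geodesics and the vertical lines. -/
def conic (q : ℝ × ℝ × ℝ) : Set ℍ :=
  {z | q.1 * (z.re ^ 2 + z.im ^ 2) + q.2.1 * z.re + q.2.2 = 0}

theorem isClosed_conic (q : ℝ × ℝ × ℝ) : IsClosed (conic q) := by
  have hr : Continuous (fun z : ℍ => z.re) := UpperHalfPlane.continuous_re
  have hi : Continuous (fun z : ℍ => z.im) := UpperHalfPlane.continuous_im
  exact isClosed_eq (by fun_prop) continuous_const

theorem volume_re_eq (c : ℝ) : volume {z : ℂ | z.re = c} = 0 := by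
  have h : {z : ℂ | z.re = c} = Complex.measurableEquivRealProd ⁻¹' ({c} ×ˢ Set.univ) := by
    ext z; simp
  rw [h, Complex.volume_preserving_equiv_real_prod.measure_preimage_equiv,
    Measure.volume_eq_prod, Measure.prod_prod]
  simp

theorem volume_conic {q : ℝ × ℝ × ℝ} (hq : q ≠ 0) : volume (conic q) = 0 := by
  obtain ⟨a, b, c⟩ := q
  have key : volume {z : ℂ | a * (z.re ^ 2 + z.im ^ 2) + b * z.re + c = 0} = 0 := by
    by_cases ha : a = 0
    · by_cases hb : b = 0
      · have hc : c ≠ 0 := fun hc => hq (by rw [ha, hb, hc]; rfl)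
        simp [ha, hb, hc]
      · refine measure_mono_null (fun z hz => ?_) (volume_re_eq (-c / b))
        rw [Set.mem_ofPred_eq] at hz ⊢
        rw [eq_div_iff hb]
        rw [ha] at hz
        linear_combination hz
    -- Completing the square exhibits the conic as part of a Euclidean circle; an empty conic needs
    -- no separate case.
    · refine measure_mono_null (fun z hz => ?_) (Measure.addHaar_sphere volume
        ((-b / (2 * a) : ℝ) : ℂ) (Real.sqrt ((b / (2 * a)) ^ 2 - c / a)))
      rw [Set.mem_ofPred_eq] at hz
      rw [mem_sphere_iff_norm, Complex.norm_eq_sqrt_sq_add_sq]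
      congr 1
      simp only [Complex.sub_re, Complex.ofReal_re, Complex.sub_im, Complex.ofReal_im, sub_zero]
      field_simp
      linear_combination 4 * a * hz
  rw [volume_eq_lintegral]
  refine setLIntegral_measure_zero _ _ (measure_mono_null ?_ key)
  rintro _ ⟨z, hz, rfl⟩
  exact hz

theorem volume_preimage_smul_conic (γ : SL(2, ℤ)) {q : ℝ × ℝ × ℝ} (hq : q ≠ 0) :
    volume ((fun z : ℍ => γ • z) ⁻¹' conic q) = 0 := by
  rw [← volume_conic hq]
  exact measure_preimage_smul volume (Matrix.SpecialLinearGroup.mapGL ℝ γ) (conic q)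

/-- The points whose orbit avoids the conics in `Q`. -/
def avoiding (Q : Set (ℝ × ℝ × ℝ)) : Set ℍ := ⋂ γ : SL(2, ℤ), ⋂ q ∈ Q, {z | γ • z ∉ conic q}

theorem measurableSet_avoiding {Q : Set (ℝ × ℝ × ℝ)} (hQ : Q.Countable) :
    MeasurableSet (avoiding Q) :=
  MeasurableSet.iInter fun γ => MeasurableSet.biInter hQ fun q _ =>
    (smul_measurable γ (isClosed_conic q).measurableSet).compl

theorem ae_mem_avoiding {Q : Set (ℝ × ℝ × ℝ)} (hQ : Q.Countable) (h0 : (0 : ℝ × ℝ × ℝ) ∉ Q) :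
    ∀ᵐ z : ℍ, z ∈ avoiding Q := by
  unfold avoiding
  simp only [Set.mem_iInter]
  refine ae_all_iff.2 fun γ => (ae_ball_iff hQ).2 fun q hq => ?_
  have := volume_preimage_smul_conic γ (q := q) fun h => h0 (h ▸ hq)
  rwa [ae_iff, show {z : ℍ | ¬ z ∈ {z : ℍ | γ • z ∉ conic q}} =
    (fun z : ℍ => γ • z) ⁻¹' conic q by ext z; simp]

theorem measurable_proj : Measurable proj := measurable_quotient_mk''

/-- The property need not be measurable: it is enough that it holds on the image of `stdPolygon ∩
G`, which is measurable because its preimage is a countable union of translates. -/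
theorem ae_surfaceMeasure {P : ModularSurface → Prop} {G : Set ℍ} (hG : MeasurableSet G)
    (hae : ∀ᵐ z : ℍ, z ∈ G) (h : ∀ z ∈ stdPolygon, z ∈ G → P (proj z)) :
    ∀ᵐ x ∂surfaceMeasure, P x := by
  have hE : MeasurableSet (proj '' (stdPolygon ∩ G)) := by
    refine measurableSet_quotient.2 ?_
    have : (Quotient.mk'' : ℍ → ModularSurface) ⁻¹' (proj '' (stdPolygon ∩ G)) =
        ⋃ γ : SL(2, ℤ), (fun z : ℍ => γ • z) ⁻¹' (stdPolygon ∩ G) := by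
      ext z
      simp only [Set.mem_preimage, Set.mem_iUnion]
      constructor
      · rintro ⟨y, hy, hyz⟩
        obtain ⟨γ, hγ⟩ := (proj_eq_iff z y).1 hyz
        exact ⟨γ, hγ ▸ hy⟩
      · rintro ⟨γ, hγ⟩
        exact ⟨_, hγ, (proj_eq_iff _ _).2 ⟨γ, rfl⟩⟩
    rw [this]
    exact MeasurableSet.iUnion fun γ =>
      smul_measurable γ (isOpen_stdPolygon.measurableSet.inter hG)
  have hmem : ∀ᵐ x ∂surfaceMeasure, x ∈ proj '' (stdPolygon ∩ G) := by
    unfold surfaceMeasure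
    refine (ae_map_iff measurable_proj.aemeasurable hE).2 ?_
    filter_upwards [ae_restrict_of_ae hae, ae_restrict_mem isOpen_stdPolygon.measurableSet]
      with z h1 h2
    exact ⟨z, ⟨h2, h1⟩, rfl⟩
  filter_upwards [hmem]
  rintro _ ⟨z, ⟨h1, h2⟩, rfl⟩
  exact h z h1 h2

theorem countable_of_numberField (K : Type*) [Field K] [NumberField K] : Countable K :=
  (Module.finBasis ℚ K).equivFun.injective.countable

/-- The conics to be avoided by generic points. -/
def arithmeticConics {K : Type*} [Field K] (ι ι' : K →+* ℝ) : Set (ℝ × ℝ × ℝ) :=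
  (Set.range (fun a : ℤ × ℤ × ℤ => ((a.1 : ℝ), (a.2.1 : ℝ), (a.2.2 : ℝ))) \ {0}) ∪
    (Set.range (fun w : K => ((0 : ℝ), (1 : ℝ), -ι w)) ∪
      (Set.range (fun w : K => ((0 : ℝ), (1 : ℝ), -ι' w)) ∪
        Set.range (fun w : K => ((1 : ℝ), -(ι' w + ι w), ι' w * ι w))))

theorem arithmeticConics_countable {K : Type*} [Field K] [NumberField K] (ι ι' : K →+* ℝ) :
    (arithmeticConics ι ι').Countable := by
  have := countable_of_numberField K
  exact ((Set.countable_range _).mono Set.sdiff_subset).union ((Set.countable_range _).union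
    ((Set.countable_range _).union (Set.countable_range _)))

theorem zero_notMem_arithmeticConics {K : Type*} [Field K] (ι ι' : K →+* ℝ) :
    (0 : ℝ × ℝ × ℝ) ∉ arithmeticConics ι ι' := by
  rintro (⟨-, h⟩ | ⟨w, h⟩ | ⟨w, h⟩ | ⟨w, h⟩)
  · exact h rfl
  all_goals simp [Prod.ext_iff] at h

theorem generic_of_notMem_conic {K : Type*} [Field K] {ι ι' : K →+* ℝ} {z : ℍ}
    (h : ∀ q ∈ arithmeticConics ι ι', z ∉ conic q) : Generic ι ι' z where
  lattice a b c e := by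
    by_contra hne
    refine h ((a : ℝ), (b : ℝ), (c : ℝ)) (Or.inl ⟨⟨(a, b, c), rfl⟩, fun h0 => hne ?_⟩) e
    simpa [Prod.ext_iff] using h0
  re_ne w := by
    constructor <;> intro e
    · exact h _ (Or.inr (Or.inl ⟨w, rfl⟩)) (by simp [conic, e])
    · exact h _ (Or.inr (Or.inr (Or.inl ⟨w, rfl⟩))) (by simp [conic, e])
  side_ne w _ e := by
    refine h _ (Or.inr (Or.inr (Or.inr ⟨w, rfl⟩))) ?_
    rw [side_eq] at e
    simp only [conic, Set.mem_ofPred_eq]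
    linear_combination e

theorem exists_conics_of_isHypLine {L : Set (Set ℍ)} (hL : L.Finite) (h : ∀ l ∈ L, IsHypLine l) :
    ∃ Q : Set (ℝ × ℝ × ℝ), Q.Countable ∧ 0 ∉ Q ∧ ∀ z, (∀ q ∈ Q, z ∉ conic q) → z ∉ ⋃₀ L := by
  have hex : ∀ l : Set ℍ, ∃ q : ℝ × ℝ × ℝ, l ∈ L → q ≠ 0 ∧ l = conic q := by
    intro l
    by_cases hl : l ∈ L
    · obtain ⟨a, b, c, hd, e⟩ := h l hl
      refine ⟨(a, b, c), fun _ => ⟨fun h0 => ?_, ?_⟩⟩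
      · simp only [Prod.ext_iff, Prod.fst_zero, Prod.snd_zero] at h0
        rw [h0.1, h0.2.1] at hd
        simp at hd
      · rw [e]
        ext z
        simp [conic, Complex.normSq_apply, sq]
    · exact ⟨0, fun h => absurd h hl⟩
  choose f hf using hex
  refine ⟨f '' L, (hL.image f).countable, ?_, ?_⟩
  · rintro ⟨l, hl, h0⟩
    exact (hf l hl).1 h0
  · rintro z hz ⟨l, hl, hzl⟩
    rw [(hf l hl).2] at hzl
    exact hz _ ⟨l, hl, rfl⟩ hzl

theorem nsmul_fullCovering (k : ℕ) : k • fullCovering =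
    AEEqFun.mk (fun _ : ModularSurface => k) aestronglyMeasurable_const := by
  induction k with
  | zero => rw [zero_nsmul]; rfl
  | succ k ih => rw [succ_nsmul, ih]; rfl

end PaintLeft

end

open PaintLeft in
theorem lemma3p2 {K : Type*} [Field K] [NumberField K] (hK : Module.finrank ℚ K = 2)
    (ι ι' : K →+* ℝ) (hι : ι ≠ ι') (A : NarrowClassGroup K)
    (n : ℕ → ℤ) (ℓ : ℕ) (hn : IsCycle ι ι' A n ℓ)
    (FA : Set ℍ) (hFA : IsFundamentalPolygon (thinGroup n ℓ) (nielsenRegion (thinGroup n ℓ)) FA)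
    (x₀ x₁ : ℝ) (C : Set ℍ) (hC : IsLift ι ι' A x₀ x₁ C) :
    (∀ᵐ x ∂surfaceMeasure, (proj ⁻¹' {x} ∩ FA).Finite) ∧
    (∀ᵐ x ∂surfaceMeasure, (proj ⁻¹' {x} ∩ paint stdPolygon x₀ x₁ C).Finite) ∧
    ∃ k : ℕ, ofSet FA hFA.isOpen.measurableSet =
      ofSet (paint stdPolygon x₀ x₁ C) (measurableSet_paint x₀ x₁ C) + k • fullCovering := by
  obtain ⟨k, hk⟩ := exists_ncard_eq hK hι hn hFA hC
  obtain ⟨L, hL, hline, hfr⟩ := hFA.finite_sides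
  obtain ⟨Q, hQ, hQ0, hQL⟩ := exists_conics_of_isHypLine hL hline
  -- The sides of the given polygon join the arithmetic conics, so that the whole orbit of a generic
  -- point also avoids the frontier of `FA`.
  have hcount := hQ.union (arithmeticConics_countable ι ι')
  have hae := ae_surfaceMeasure (P := fun x => (proj ⁻¹' {x} ∩ FA).Finite ∧
      (proj ⁻¹' {x} ∩ paint stdPolygon x₀ x₁ C).Finite ∧
      (proj ⁻¹' {x} ∩ FA).ncard = (proj ⁻¹' {x} ∩ paint stdPolygon x₀ x₁ C).ncard + k)
    (measurableSet_avoiding hcount)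
    (ae_mem_avoiding hcount (by
      rintro (h | h)
      · exact hQ0 h
      · exact zero_notMem_arithmeticConics ι ι' h))
    (fun z hz hG => by
      simp only [avoiding, Set.mem_iInter] at hG
      exact hk z hz (fun γ => generic_of_notMem_conic fun q hq => hG γ q (Or.inr hq))
        (fun γ h => hQL _ (fun q hq => hG γ q (Or.inl hq)) (hfr h)))
  refine ⟨hae.mono fun x h => h.1, hae.mono fun x h => h.2.1, k, ?_⟩
  rw [nsmul_fullCovering]
  unfold ofSet
  rw [AEEqFun.mk_add_mk]
  exact AEEqFun.mk_eq_mk.2 (hae.mono fun x h => h.2.2)
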